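/- **Definitions.** For words $u \in \Sigma^*$, $w \in \Gamma^*$ over finite alphabets, let $\left[{u \atop w}\right]$ be their convolution: $u$ on top of $w$, aligned left, the shorter word padded with a fresh symbol $\#$; it is a word over $\Sigma_\# \times \Gamma_\#$, where $\Sigma_\# = \Sigma \cup \{\#\}$ and $\Gamma_\# = \Gamma \cup \{\#\}$. A transducer over $\Sigma \times \Gamma$ is an NFA over $\Sigma_\# \times \Gamma_\#$; it recognises the relation of all $(u,w) \in \Sigma^* \times \Gamma^*$ whose convolution it accepts (this relation need not be length-preserving). It is deterministic if it has exactly one initial state and exactly one successor for every state and letter. Let $\Delta \subseteq \Sigma^* \times \Sigma^*$ be a transition relation and $\mathcal V \subseteq \Gamma^* \times \Sigma^*$ an interpretation. For a constraint $A \in \Gamma^*$ let $\mathcal V(A) = \{c \in \Sigma^* \mid (A,c) \in \mathcal V\}$. The constraint $A$ is inductive if $\Delta(\mathcal V(A)) \subseteq \mathcal V(A)$; $\mathit{Ind}$ is the set of inductive constraints, and $$\mathit{PReach} = \{(c,c') \in \Sigma^* \times \Sigma^* \mid \forall A \in \mathit{Ind}\colon\ c \in \mathcal V(A) \rightarrow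 c' \in \mathcal V(A)\}.$$ For a set $C \subseteq \Sigma^*$, $\mathit{PReach}(C)$ is the set of all $c'$ with $(c,c') \in \mathit{PReach}$ for some $c \in C$. **Problem** $\textsc{AbstractSafety}$. Given: finite alphabets $\Sigma$ and $\Gamma$; a nondeterministic transducer over $\Sigma \times \Sigma$ recognising a relation $\Delta$; two NFAs over $\Sigma$ recognising sets $C_I, C_U \subseteq \Sigma^*$ of initial and unsafe configurations; and a deterministic transducer over $\Gamma \times \Sigma$ recognising an interpretation $\mathcal V$. Decide: does $\mathit{PReach}(C_I) \cap C_U = \emptyset$ hold? Instances are encoded as bit strings that list the alphabet sizes and the numbers of states in unary, followed by the explicit tables of the automata. **Theorem.** $\textsc{AbstractSafety}$ is in $\mathsf{EXPSPACE}$: there are a polynomial $p$ and a deterministic Turing machine that, on every input bit string of length $n$, halts, uses space at most $2^{p(n)}$, and accepts if and only if the input encodes a positive instance of $\textsc{AbstractSafety}$. -/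

import Mathlib

namespace RegAbs

/-! ### Words, convolutions, transducers -/

/-- The convolution of two words: `u` on top of `w`, aligned left, the shorter one padded.
The padding symbol `#` is `none`, so that `Option α` is the alphabet `α` together with `#`. -/
def convolution {α β : Type} (u : List α) (w : List β) : List (Option α × Option β) :=
  List.zipWithAll Prod.mk u w

/-- The relation recognised by a transducer over `α × β`, that is, by an NFA over
`Option α × Option β`: the pairs of words whose convolution is accepted. -/
def transducerRel {α β Q : Type} (T : NFA (Option α × Option β) Q) :
    SetRel (List α) (List β) :=
  {p | convolution p.1 p.2 ∈ T.accepts}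

/-! ### Abstraction frameworks

Configurations are the words over `α`, constraints are the words over `γ`; `Δ` is the transition
relation and `V` the interpretation. -/

/-- A set of configurations is inductive if it contains its one-step successors. -/
def IsInductiveSet {α : Type} (Δ : SetRel (List α) (List α)) (C : Set (List α)) : Prop :=
  Δ.image C ⊆ C

/-- The set `V(A)` of configurations that satisfy the constraint `A`. -/
def satisfying {α γ : Type} (V : SetRel (List γ) (List α)) (A : List γ) : Set (List α) :=
  V.image {A}

/-- `Ind`, the set of inductive constraints. -/
def Ind {α γ : Type} (Δ : SetRel (List α) (List α)) (V : SetRel (List γ) (List α)) :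
    Set (List γ) :=
  {A | IsInductiveSet Δ (satisfying V A)}

/-- `PReach`, the potential reachability relation: the pairs of configurations that are not
separated by any inductive constraint. -/
def PReach {α γ : Type} (Δ : SetRel (List α) (List α)) (V : SetRel (List γ) (List α)) :
    SetRel (List α) (List α) :=
  {p | ∀ A ∈ Ind Δ V, p.1 ∈ satisfying V A → p.2 ∈ satisfying V A}

/-! ### Instances of the abstract safety problem -/

/-- An instance of the problem. The alphabet of the configurations is `Fin numSym`, the alphabet
of the constraints is `Fin numConstr`, and the states of each automaton are numbered. -/
structure Instance where
  /-- size of the alphabet of the configurations -/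
  numSym : ℕ
  /-- size of the alphabet of the constraints -/
  numConstr : ℕ
  /-- number of states of the transducer for the transition relation -/
  nΔ : ℕ
  /-- number of states of the automaton for the initial configurations -/
  nI : ℕ
  /-- number of states of the automaton for the unsafe configurations -/
  nU : ℕ
  /-- number of states of the transducer for the interpretation -/
  nV : ℕ
  /-- a nondeterministic transducer for the transition relation -/
  autΔ : NFA (Option (Fin numSym) × Option (Fin numSym)) (Fin nΔ)
  /-- an NFA for the set of initial configurations -/
  autI : NFA (Fin numSym) (Fin nI)
  /-- an NFA for the set of unsafe configurations -/
  autU : NFA (Fin numSym) (Fin nU)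
  /-- a deterministic transducer for the interpretation -/
  autV : DFA (Option (Fin numConstr) × Option (Fin numSym)) (Fin nV)

namespace Instance

/-- The transition relation of the instance. -/
def Δ (x : Instance) : SetRel (List (Fin x.numSym)) (List (Fin x.numSym)) :=
  transducerRel x.autΔ

/-- The interpretation of the instance. -/
def V (x : Instance) : SetRel (List (Fin x.numConstr)) (List (Fin x.numSym)) :=
  transducerRel x.autV.toNFA

/-- The set of initial configurations of the instance. -/
def CI (x : Instance) : Set (List (Fin x.numSym)) := {c | c ∈ x.autI.accepts}

/-- The set of unsafe configurations of the instance. -/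
def CU (x : Instance) : Set (List (Fin x.numSym)) := {c | c ∈ x.autU.accepts}

/-- The question of the problem: no unsafe configuration is potentially reachable. -/
def IsAbstractlySafe (x : Instance) : Prop :=
  (PReach x.Δ x.V).image x.CI ∩ x.CU = ∅

end Instance

/-! ### Encoding of instances as bit strings

Alphabet sizes and numbers of states are written in unary, the transition relation of an
automaton as its full table, and the sets of initial and final states as bit vectors. The length
of the code is thus polynomially related to any usual size of the automata. -/

/-- `n` in unary, with an end marker. -/
def encodeUnary (n : ℕ) : List Bool := List.replicate n true ++ [false]

/-- The list of all letters of the padded alphabet. -/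
def paddedLetters (n : ℕ) : List (Option (Fin n)) := none :: (List.finRange n).map some

open scoped Classical in
/-- The tables of an automaton, for a given enumeration `letters` of the alphabet. -/
noncomputable def encodeNFA {α : Type} {n : ℕ} (letters : List α) (M : NFA α (Fin n)) :
    List Bool :=
  ((List.finRange n ×ˢ letters ×ˢ List.finRange n).map
      fun t => decide (t.2.2 ∈ M.step t.1 t.2.1)) ++
    ((List.finRange n).map (fun q => decide (q ∈ M.start)) ++
      (List.finRange n).map (fun q => decide (q ∈ M.accept)))

/-- The bit string that represents an instance. -/
noncomputable def Instance.encode (x : Instance) : List Bool :=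
  encodeUnary x.numSym ++ (encodeUnary x.numConstr ++ (encodeUnary x.nΔ ++ (encodeUnary x.nI ++
    (encodeUnary x.nU ++ (encodeUnary x.nV ++
      (encodeNFA (paddedLetters x.numSym ×ˢ paddedLetters x.numSym) x.autΔ ++
        (encodeNFA (List.finRange x.numSym) x.autI ++
          (encodeNFA (List.finRange x.numSym) x.autU ++
            encodeNFA (paddedLetters x.numConstr ×ˢ paddedLetters x.numSym) x.autV.toNFA))))))))

theorem encodeUnary_append_inj {m n : ℕ} {u v : List Bool}
    (h : encodeUnary m ++ u = encodeUnary n ++ v) : m = n ∧ u = v := by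
  induction m generalizing n with
  | zero => cases n <;> simp_all [encodeUnary, List.replicate_succ]
  | succ m ih =>
    cases n with
    | zero => simp [encodeUnary, List.replicate_succ] at h
    | succ n =>
      have := @ih n (by simpa [encodeUnary, List.replicate_succ] using h)
      simpa using this

theorem mem_paddedLetters {n : ℕ} (a : Option (Fin n)) : a ∈ paddedLetters n := by
  cases a <;> simp [paddedLetters]

theorem encodeNFA_append_inj {α : Type} {n : ℕ} {l : List α} (hl : ∀ a, a ∈ l)
    {M N : NFA α (Fin n)} {u v : List Bool}
    (h : encodeNFA l M ++ u = encodeNFA l N ++ v) : M = N ∧ u = v := by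
  obtain ⟨h1, h2⟩ := List.append_inj h (by simp [encodeNFA])
  refine ⟨?_, h2⟩
  obtain ⟨h3, h4⟩ := List.append_inj h1 (by simp)
  obtain ⟨h5, h6⟩ := List.append_inj h4 (by simp)
  cases M; cases N
  simp only [NFA.mk.injEq]
  refine ⟨?_, ?_, ?_⟩
  · funext q a
    ext q'
    simpa using List.map_inj_left.1 h3 (q, a, q') (by simp [List.mem_product, hl])
  · ext q
    simpa using List.map_inj_left.1 h5 q (by simp)
  · ext q
    simpa using List.map_inj_left.1 h6 q (by simp)

theorem toNFA_inj {α Q : Type} {M N : DFA α Q} (h : M.toNFA = N.toNFA) : M = N := by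
  obtain ⟨s, q, F⟩ := M
  obtain ⟨s', q', F'⟩ := N
  obtain ⟨h1, h2, h3⟩ := NFA.mk.inj h
  obtain rfl : s = s' :=
    funext fun q => funext fun a => Set.singleton_eq_singleton_iff.1 (congrFun (congrFun h1 q) a)
  obtain rfl : q = q' := Set.singleton_eq_singleton_iff.1 h2
  obtain rfl : F = F' := h3
  rfl

/-- Different instances have different codes. -/
theorem Instance.encode_injective : Function.Injective Instance.encode := by
  rintro ⟨s, g, a, b, c, d, A, B, C, D⟩ ⟨s', g', a', b', c', d', A', B', C', D'⟩ h
  simp only [Instance.encode] at h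
  obtain ⟨rfl, h⟩ := encodeUnary_append_inj h
  obtain ⟨rfl, h⟩ := encodeUnary_append_inj h
  obtain ⟨rfl, h⟩ := encodeUnary_append_inj h
  obtain ⟨rfl, h⟩ := encodeUnary_append_inj h
  obtain ⟨rfl, h⟩ := encodeUnary_append_inj h
  obtain ⟨rfl, h⟩ := encodeUnary_append_inj h
  obtain ⟨rfl, h⟩ := encodeNFA_append_inj (by simp [List.mem_product, mem_paddedLetters]) h
  obtain ⟨rfl, h⟩ := encodeNFA_append_inj (by simp) h
  obtain ⟨rfl, h⟩ := encodeNFA_append_inj (by simp) h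
  obtain ⟨h, -⟩ := encodeNFA_append_inj (u := []) (v := [])
    (l := paddedLetters g ×ˢ paddedLetters s)
    (by simp [List.mem_product, mem_paddedLetters]) (congrArg (· ++ []) h)
  obtain rfl := toNFA_inj h
  rfl

/-- The decision problem as a language: the codes of the positive instances. -/
def AbstractSafety : Language Bool :=
  {w | ∃ x : Instance, x.encode = w ∧ x.IsAbstractlySafe}

/-! ### Exponential space -/

/-- The space used by a configuration of a multi-stack Turing machine: the total length of its
stacks (the input is stored on one of them). -/
def spaceUsed (tm : Turing.FinTM2) (c : tm.Cfg) : ℕ :=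
  (@Finset.univ tm.K tm.kFin).sum fun k => (c.stk k).length

open scoped Classical in
/-- A deterministic Turing machine that decides the language `L`, in the sense that it halts on
every input with the truth value of membership in `L` as its output, within space `s n` on every
input of length `n`. -/
structure DecidesInSpace (L : Language Bool) (s : ℕ → ℕ) extends
    Turing.TM2Computable (id : List Bool → List Bool) Computability.encodeBool
      (fun w => decide (w ∈ L)) where
  /-- all stack alphabets are finite -/
  finite_alphabets : ∀ k, Finite (tm.Γ k)
  /-- every configuration of the computation on `w` respects the space bound -/
  space_le : ∀ (w : List Bool) (c : tm.Cfg),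
    StateTransition.Reaches tm.step (Turing.initList tm (w.map inputAlphabet.invFun)) c →
      spaceUsed tm c ≤ s w.length

/-- EXPSPACE: the languages decided in space `2 ^ p(n)` for some polynomial `p`. -/
def EXPSPACE : Set (Language Bool) :=
  {L | ∃ p : Polynomial ℕ, Nonempty (DecidesInSpace L fun n => 2 ^ p.eval n)}

end RegAbs

/-! An instance is unsafe iff some initial `u` and unsafe `v` are separated by no inductive
constraint. This hides two nested universal quantifiers: over constraints `A`, and, inside
inductivity of `A`, over pairs of configurations violating it. Each is removed by the same device. A
search for words is a nondeterministic system that guesses letters and runs automata on them. That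
no run ends badly is witnessed by a sequence of state sets that starts with all initial states, is
closed under steps, and ends in a set that avoids bad states and is closed under reading padding
only (`IsCertificate.not_bad`, `exists_isCertificate`). Such a sequence can be guessed along with
the letters, so it is a run of a larger system.

This gives three levels. Level 1 (`Env.step₁`) guesses two configurations and runs the transducers
on them, looking for a violation of inductivity of `A`; its states are coded below a polynomial `m`.
Level 2 (`Env.step₂`) guesses `A` with a level 1 certificate, a subset of `m` codes at each
position, and checks that `A` separates `u` from `v`; its states are coded below `m'`, exponential
in the input length. Level 3 (`Env.step₃`) guesses `u` and `v` with a level 2 certificate; its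
states are coded below a doubly exponential `B`. By `exists_mem_PReach_iff`, unsafety is
reachability in the level 3 graph. Determinism of the interpretation is essential: that `A` rejects
a configuration is again expressed by a run, with complemented final states
(`convolution_not_mem_accepts_iff`).

Savitch's algorithm decides this reachability with recursion depth `K = log B` and stack frames of
`3 * K + 1` bits, hence in exponential space (`savRun_call`, `savReach_iff`). Since determinism is
regained only at the outermost level, Savitch is needed only once.

Space is accounted for by counter programs. A program whose registers stay at most `M` becomes a
stack machine using about `log M` cells per register (`Prog.code_run`, `mem_EXPSPACE_of_exec`), so
exponential space means doubly exponential registers. Running time plays no role: arithmetic,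
bounded quantifiers and searches may all be done by counting. `Cmp` (registers polynomial in the
code of the argument) is closed under all of these, so `fun_prop` verifies the decision procedure
from its definition, once the three large powers of two have been supplied as arguments. Those
powers are not polynomial in the input number and are computed separately (`cmpIn_answer`). -/

namespace RegAbs

/-! ### Counter programs -/

/-- Structured programs over registers that hold natural numbers. -/
inductive Prog
  | skip : Prog
  | inc : ℕ → Prog
  | dec : ℕ → Prog
  | seq : Prog → Prog → Prog
  | ifz : ℕ → Prog → Prog → Prog
  | loop : ℕ → Prog → Prog

open Function in
/-- `Exec M p s s'`: the program `p`, started with the registers `s`, terminates with the registers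
`s'`, and no register is ever increased beyond `M`. -/
inductive Exec (M : ℕ) : Prog → (ℕ → ℕ) → (ℕ → ℕ) → Prop
  | skip (s) : Exec M .skip s s
  | inc (r s) : s r + 1 ≤ M → Exec M (.inc r) s (update s r (s r + 1))
  | dec (r s) : Exec M (.dec r) s (update s r (s r - 1))
  | seq {p q s t u} : Exec M p s t → Exec M q t u → Exec M (.seq p q) s u
  | ifz_zero {r p q s t} : s r = 0 → Exec M p s t → Exec M (.ifz r p q) s t
  | ifz_pos {r p q s t} : s r ≠ 0 → Exec M q s t → Exec M (.ifz r p q) s t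
  | loop_zero {r p s} : s r = 0 → Exec M (.loop r p) s s
  | loop_pos {r p s t u} : s r ≠ 0 → Exec M p s t → Exec M (.loop r p) t u →
      Exec M (.loop r p) s u

/-- `Exec` checks the bound only at increments, so it has to be assumed at the start; no other
instruction can break it. -/
theorem Exec.le {M : ℕ} {p s t} (e : Exec M p s t) (h : ∀ r, s r ≤ M) : ∀ r, t r ≤ M := by
  induction e with
  | skip s => exact h
  | inc r s hs => intro k; by_cases hk : k = r <;> simp_all
  | dec r s =>
    intro k
    by_cases hk : k = r
    · subst hk; simpa using (Nat.sub_le _ _).trans (h k)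
    · simpa [hk] using h k
  | seq _ _ h1 h2 => exact h2 (h1 h)
  | ifz_zero h0 _ h1 => exact h1 h
  | ifz_pos h0 _ h1 => exact h1 h
  | loop_zero h0 => exact h
  | loop_pos h0 _ _ h1 h2 => exact h2 (h1 h)

/-- A bound that exceeds the indices of all registers that occur in a program. -/
def Prog.regBound : Prog → ℕ
  | skip => 0
  | inc r => r + 1
  | dec r => r + 1
  | seq p q => max p.regBound q.regBound
  | ifz r p q => max (r + 1) (max p.regBound q.regBound)
  | loop r p => max (r + 1) p.regBound

/-! ### Bijective binary numeration -/

/-- The number with a given bijective binary representation, least significant digit first;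
`false` stands for the digit one and `true` for the digit two. -/
def bijVal : List Bool → ℕ
  | [] => 0
  | b :: l => 2 * bijVal l + (if b then 2 else 1)

/-- Increment of a bijective binary representation. -/
def bijInc : List Bool → List Bool
  | [] => [false]
  | false :: l => true :: l
  | true :: l => false :: bijInc l

/-- Decrement of a bijective binary representation. -/
def bijDec : List Bool → List Bool
  | [] => []
  | true :: l => false :: l
  | [false] => []
  | false :: a :: l => true :: bijDec (a :: l)

/-- The bijective binary representation of a number. -/
def bijRepr : ℕ → List Bool
  | 0 => []
  | n + 1 => bijInc (bijRepr n)

theorem bijVal_bijInc (l : List Bool) : bijVal (bijInc l) = bijVal l + 1 := by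
  induction l with
  | nil => simp [bijInc, bijVal]
  | cons b l ih => cases b <;> simp [bijInc, bijVal, ih]; ring

theorem bijVal_bijRepr (n : ℕ) : bijVal (bijRepr n) = n := by
  induction n with
  | zero => rfl
  | succ n ih => rw [bijRepr, bijVal_bijInc, ih]

theorem bijInc_ne_nil (l : List Bool) : bijInc l ≠ [] := by
  rcases l with - | ⟨- | -, l⟩ <;> simp [bijInc]

theorem bijDec_bijInc (l : List Bool) : bijDec (bijInc l) = l := by
  induction l with
  | nil => rfl
  | cons b l ih =>
    cases b
    · rfl
    · rw [bijInc]
      obtain ⟨a, l', h⟩ := List.exists_cons_of_ne_nil (bijInc_ne_nil l)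
      rw [h] at ih ⊢
      rw [bijDec, ih]

theorem bijDec_bijRepr (n : ℕ) : bijDec (bijRepr n) = bijRepr (n - 1) := by
  cases n with
  | zero => rfl
  | succ n => exact bijDec_bijInc _

theorem bijVal_injective : Function.Injective bijVal := by
  intro l l' h
  induction l generalizing l' with
  | nil => cases l' with
    | nil => rfl
    | cons b l' => cases b <;> simp [bijVal] at h
  | cons a l ih => cases l' with
    | nil => cases a <;> simp [bijVal] at h
    | cons b l' =>
      have : a = b := by cases a <;> cases b <;> simp [bijVal] at h ⊢ <;> omega
      subst this
      rw [ih (by simpa [bijVal] using h)]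

/-- This is the reason for bijective numeration: every bit string represents exactly one number, so
the input word on its stack already is a register content. Ordinary binary would lose leading zeros.
-/
theorem bijRepr_bijVal (l : List Bool) : bijRepr (bijVal l) = l :=
  bijVal_injective (bijVal_bijRepr _)

theorem two_pow_length_le_bijVal (l : List Bool) : 2 ^ l.length ≤ bijVal l + 1 := by
  induction l with
  | nil => simp [bijVal]
  | cons b l ih => cases b <;> simp [bijVal, pow_succ] <;> omega

theorem bijVal_lt_two_pow (l : List Bool) : bijVal l + 2 ≤ 2 ^ (l.length + 1) := by
  induction l with
  | nil => simp [bijVal]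
  | cons b l ih => cases b <;> simp [bijVal, pow_succ] at ih ⊢ <;> omega

/-- The source of the logarithm in the space bound. -/
theorem length_bijRepr_le {n M : ℕ} (h : n ≤ M) : (bijRepr n).length ≤ Nat.log 2 (M + 1) := by
  refine Nat.le_log_of_pow_le one_lt_two ((two_pow_length_le_bijVal _).trans ?_)
  rw [bijVal_bijRepr]; omega

theorem bijRepr_eq_nil {n : ℕ} : bijRepr n = [] ↔ n = 0 := by
  cases n with
  | zero => simp [bijRepr]
  | succ n => simp [bijRepr, bijInc_ne_nil]

theorem length_le_length_bijInc (l : List Bool) : l.length ≤ (bijInc l).length := by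
  induction l with
  | nil => simp [bijInc]
  | cons b l ih => cases b <;> simp [bijInc]; omega

/-! ### Compilation to stack machines -/

namespace Prog

open Turing Function

/-- The labels of the compiled program. -/
def Lab : Prog → Type
  | skip => Unit
  | inc _ => Bool
  | dec _ => Bool
  | seq p q => Lab p ⊕ Lab q
  | ifz _ p q => Option (Lab p ⊕ Lab q)
  | loop _ p => Option (Lab p)

/-- The label at which the compiled program starts. -/
def entry : (p : Prog) → p.Lab
  | skip => ()
  | inc _ => false
  | dec _ => false
  | seq p _ => Sum.inl p.entry
  | ifz _ _ _ => none
  | loop _ _ => none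

instance finite_lab : (p : Prog) → Finite p.Lab
  | skip => inferInstanceAs (Finite Unit)
  | inc _ => inferInstanceAs (Finite Bool)
  | dec _ => inferInstanceAs (Finite Bool)
  | seq p q =>
    have := finite_lab p
    have := finite_lab q
    inferInstanceAs (Finite (p.Lab ⊕ q.Lab))
  | ifz _ p q =>
    have := finite_lab p
    have := finite_lab q
    inferInstanceAs (Finite (Option (p.Lab ⊕ q.Lab)))
  | loop _ p =>
    have := finite_lab p
    inferInstanceAs (Finite (Option p.Lab))

variable {m : ℕ} {Λ : Type}

/-- Statements of a machine with `m` stacks for registers and one auxiliary stack. -/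
abbrev MStmt (m : ℕ) (Λ : Type) : Type := TM2.Stmt (fun _ : Fin (m + 1) => Bool) Λ (Option Bool)

/-- Configurations of a machine with `m` stacks for registers and one auxiliary stack. -/
abbrev MCfg (m : ℕ) (Λ : Type) : Type := TM2.Cfg (fun _ : Fin (m + 1) => Bool) Λ (Option Bool)

/-- The stack that represents a register. -/
def stackOf (m r : ℕ) : Fin (m + 1) := ⟨min r m, by omega⟩

/-- Moves the auxiliary stack back on top of a register. -/
def restoreStmt (k : Fin (m + 1)) (self next : Λ) : MStmt m Λ :=
  .pop (Fin.last m) (fun _ o => o) (.branch Option.isSome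
    (.push k (fun v => v.getD false) (.goto fun _ => self)) (.goto fun _ => next))

/-- Propagates the carry of an increment. -/
def incStmt (k : Fin (m + 1)) (self next : Λ) : MStmt m Λ :=
  .pop k (fun _ o => o) (.branch (fun v => v == some true)
    (.push (Fin.last m) (fun _ => false) (.goto fun _ => self))
    (.push k Option.isSome (.goto fun _ => next)))

/-- Propagates the borrow of a decrement. -/
def decStmt (k : Fin (m + 1)) (self next : Λ) : MStmt m Λ :=
  .pop k (fun _ o => o) (.branch (fun v => v == some true)
    (.push k (fun _ => false) (.goto fun _ => next))
    (.branch Option.isSome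
      (.peek k (fun _ o => o) (.branch Option.isSome
        (.push (Fin.last m) (fun _ => true) (.goto fun _ => self)) (.goto fun _ => next)))
      (.goto fun _ => next)))

/-- Tests whether a register is zero. -/
def testStmt (k : Fin (m + 1)) (zero pos : Λ) : MStmt m Λ :=
  .peek k (fun _ o => o) (.branch Option.isSome (.goto fun _ => pos) (.goto fun _ => zero))

/-- The statements of the compiled program; `ι` embeds its labels, and `next` is the label to
continue with. -/
def code : (p : Prog) → (ι : p.Lab → Λ) → (next : Λ) → p.Lab → MStmt m Λ
  | skip, _, next, _ => .goto fun _ => next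
  | inc r, ι, next, l => match l with
    | false => incStmt (stackOf m r) (ι false) (ι true)
    | true => restoreStmt (stackOf m r) (ι true) next
  | dec r, ι, next, l => match l with
    | false => decStmt (stackOf m r) (ι false) (ι true)
    | true => restoreStmt (stackOf m r) (ι true) next
  | seq p q, ι, next, l => match l with
    | Sum.inl l => code p (fun l => ι (Sum.inl l)) (ι (Sum.inr q.entry)) l
    | Sum.inr l => code q (fun l => ι (Sum.inr l)) next l
  | ifz r p q, ι, next, l => match l with
    | none => testStmt (stackOf m r) (ι (some (Sum.inl p.entry))) (ι (some (Sum.inr q.entry)))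
    | some (Sum.inl l) => code p (fun l => ι (some (Sum.inl l))) next l
    | some (Sum.inr l) => code q (fun l => ι (some (Sum.inr l))) next l
  | loop r p, ι, next, l => match l with
    | none => testStmt (stackOf m r) next (ι (some p.entry))
    | some l => code p (fun l => ι (some l)) (ι none) l

/-! ### Space-bounded runs of the register routines -/

/-- Reachability through configurations whose stacks have length at most `L`. -/
def BReach (M : Λ → MStmt m Λ) (L : ℕ) : MCfg m Λ → MCfg m Λ → Prop :=
  Relation.ReflTransGen fun a b => b ∈ TM2.step M a ∧ ∀ k, (b.stk k).length ≤ L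

theorem BReach.head {M : Λ → MStmt m Λ} {L : ℕ} {l : Λ} {v : Option Bool}
    {S : Fin (m + 1) → List Bool} {c : MCfg m Λ}
    (hb : ∀ k, ((TM2.stepAux (M l) v S).stk k).length ≤ L)
    (h : BReach M L (TM2.stepAux (M l) v S) c) : BReach M L ⟨some l, v, S⟩ c :=
  Relation.ReflTransGen.head ⟨rfl, hb⟩ h

theorem length_update_le {S : Fin (m + 1) → List Bool} {L : ℕ} (h : ∀ k, (S k).length ≤ L)
    {k : Fin (m + 1)} {l : List Bool} (hl : l.length ≤ L) (j : Fin (m + 1)) :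
    (update S k l j).length ≤ L := by
  by_cases hj : j = k
  · subst hj; simpa
  · simpa [hj] using h j

variable {M : Λ → MStmt m Λ} {L : ℕ} {k : Fin (m + 1)} {self next next' : Λ}

theorem update_swap (S : Fin (m + 1) → List Bool) (hk : k ≠ Fin.last m) (a b c d : List Bool) :
    update (update (update (update S k a) (Fin.last m) b) k c) (Fin.last m) d =
      update (update S k c) (Fin.last m) d := by
  funext j
  by_cases h1 : j = Fin.last m
  · subst h1; simp
  · by_cases h2 : j = k
    · subst h2; simp [h1]
    · simp [h1, h2]

/-- Digits move one at a time, so the joint length of the two stacks is constant and bounds each of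
them throughout. The order reverses, undoing the reversal that occurred when the digits were set
aside. -/
theorem restore_run (hM : M self = restoreStmt k self next) (hk : k ≠ Fin.last m) (t : List Bool) :
    ∀ (v : Option Bool) (S : Fin (m + 1) → List Bool), S (Fin.last m) = t →
      (∀ j, (S j).length ≤ L) → (S k).length + t.length ≤ L →
      BReach M L ⟨some self, v, S⟩
        ⟨some next, none, update (update S k (t.reverse ++ S k)) (Fin.last m) []⟩ := by
  induction t with
  | nil =>
    intro v S ht hS hL
    refine BReach.head ?_ ?_ <;> simp only [hM, restoreStmt, TM2.stepAux, ht]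
    · simpa using length_update_le hS (by simp)
    · simp only [List.head?_nil, Option.isSome_none, cond_false, List.tail_nil, List.reverse_nil,
        List.nil_append, update_eq_self]
      exact Relation.ReflTransGen.refl
  | cons a t ih =>
    intro v S ht hS hL
    simp only [List.length_cons] at hL
    refine BReach.head ?_ ?_ <;> simp only [hM, restoreStmt, TM2.stepAux, ht]
    · simp only [List.head?_cons, Option.isSome_some, cond_true, List.tail_cons]
      refine length_update_le (length_update_le hS (by omega)) ?_
      simp [hk]; omega
    · simp only [List.head?_cons, Option.isSome_some, cond_true, List.tail_cons]
      have := ih (some a)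
        (update (update S (Fin.last m) t) k (a :: S k)) (by simp [hk.symm])
        (length_update_le (length_update_le hS (by omega)) (by simp; omega)) (by simp; omega)
      rw [update_comm hk.symm] at this ⊢
      rw [update_swap S hk] at this
      simpa [hk] using this

/-- The auxiliary stack holds the digits that the carry has already passed, in reverse. Allowing an
arbitrary content for it is what makes the induction over the remaining digits work. -/
theorem inc_run (hM : M self = incStmt k self next) (hN : M next = restoreStmt k next next')
    (hk : k ≠ Fin.last m) (l : List Bool) :
    ∀ (v : Option Bool) (S : Fin (m + 1) → List Bool), S k = l → (∀ j, (S j).length ≤ L) →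
      (bijInc l).length + (S (Fin.last m)).length ≤ L →
      BReach M L ⟨some self, v, S⟩ ⟨some next', none,
        update (update S k ((S (Fin.last m)).reverse ++ bijInc l)) (Fin.last m) []⟩ := by
  induction l with
  | nil =>
    intro v S hl hS hL
    simp only [bijInc, List.length_singleton] at hL
    refine BReach.head ?_ ?_ <;> simp only [hM, incStmt, TM2.stepAux, hl]
    · simpa using length_update_le hS (by simp; omega)
    · have := restore_run (L := L) hN hk (S (Fin.last m)) none (update S k [false])
        (by simp [hk.symm]) (length_update_le hS (by simp; omega)) (by simp; omega)
      simpa [bijInc] using this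
  | cons b l ih =>
    intro v S hl hS hL
    have h1 := length_le_length_bijInc l
    cases b
    · simp only [bijInc, List.length_cons] at hL
      refine BReach.head ?_ ?_ <;> simp only [hM, incStmt, TM2.stepAux, hl]
      · simpa using length_update_le hS (by simp; omega)
      · have := restore_run (L := L) hN hk (S (Fin.last m)) (some false) (update S k (true :: l))
          (by simp [hk.symm]) (length_update_le hS (by simp; omega)) (by simp; omega)
        simpa [bijInc] using this
    · simp only [bijInc, List.length_cons] at hL
      refine BReach.head ?_ ?_ <;> simp only [hM, incStmt, TM2.stepAux, hl]
      · simpa [hk.symm] using length_update_le (length_update_le hS (by omega)) (by simp; omega)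
      · have := ih (some true) (update (update S k l) (Fin.last m) (false :: S (Fin.last m)))
          (by simp [hk]) (length_update_le (length_update_le hS (by omega)) (by simp; omega))
          (by simp; omega)
        rw [update_swap S hk] at this
        simpa [bijInc, hk.symm] using this

/-- As for the increment. The peek separates a digit one that must borrow, since digits follow, from
a most significant one, which disappears. -/
theorem dec_run (hM : M self = decStmt k self next) (hN : M next = restoreStmt k next next')
    (hk : k ≠ Fin.last m) (l : List Bool) :
    ∀ (v : Option Bool) (S : Fin (m + 1) → List Bool), S k = l → (∀ j, (S j).length ≤ L) →
      l.length + (S (Fin.last m)).length ≤ L →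
      BReach M L ⟨some self, v, S⟩ ⟨some next', none,
        update (update S k ((S (Fin.last m)).reverse ++ bijDec l)) (Fin.last m) []⟩ := by
  induction l with
  | nil =>
    intro v S hl hS hL
    refine BReach.head ?_ ?_ <;> simp only [hM, decStmt, TM2.stepAux, hl]
    · simpa using length_update_le hS (by simp)
    · have := restore_run (L := L) hN hk (S (Fin.last m)) none (update S k [])
        (by simp [hk.symm]) (length_update_le hS (by simp)) (by simp; omega)
      simpa [bijDec] using this
  | cons b l ih =>
    intro v S hl hS hL
    simp only [List.length_cons] at hL
    cases b
    · cases l with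
      | nil =>
        refine BReach.head ?_ ?_ <;> simp only [hM, decStmt, TM2.stepAux, hl]
        · simpa using length_update_le hS (by simp)
        · have := restore_run (L := L) hN hk (S (Fin.last m)) none (update S k [])
            (by simp [hk.symm]) (length_update_le hS (by simp)) (by simp; omega)
          simpa [bijDec] using this
      | cons a l =>
        refine BReach.head ?_ ?_ <;> simp only [hM, decStmt, TM2.stepAux, hl]
        · simpa [hk.symm] using length_update_le (length_update_le hS (l := a :: l) (by omega))
            (by simp; omega)
        · have := ih (some a)
            (update (update S k (a :: l)) (Fin.last m) (true :: S (Fin.last m)))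
            (by simp [hk]) (length_update_le (length_update_le hS (by omega)) (by simp; omega))
            (by simp at hL ⊢; omega)
          rw [update_swap S hk] at this
          simpa [bijDec, hk.symm] using this
    · refine BReach.head ?_ ?_ <;> simp only [hM, decStmt, TM2.stepAux, hl]
      · simpa using length_update_le hS (by simp; omega)
      · have := restore_run (L := L) hN hk (S (Fin.last m)) (some true) (update S k (false :: l))
          (by simp [hk.symm]) (length_update_le hS (by simp; omega)) (by simp; omega)
        simpa [bijDec] using this

/-- The stacks that represent given registers. -/
def regStacks (m : ℕ) (s : ℕ → ℕ) (k : Fin (m + 1)) : List Bool :=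
  if k = Fin.last m then [] else bijRepr (s k)

theorem regStacks_stackOf {r : ℕ} (hr : r < m) (s : ℕ → ℕ) :
    regStacks m s (stackOf m r) = bijRepr (s r) := by
  simp [regStacks, stackOf, Fin.ext_iff, hr.le, hr.ne]

theorem stackOf_ne_last {r : ℕ} (hr : r < m) : stackOf m r ≠ Fin.last m := by
  simp [stackOf, Fin.ext_iff]; omega

theorem regStacks_update {r : ℕ} (hr : r < m) (s : ℕ → ℕ) (x : ℕ) :
    update (update (regStacks m s) (stackOf m r) (bijRepr x)) (Fin.last m) [] =
      regStacks m (update s r x) := by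
  funext j
  by_cases h1 : j = Fin.last m
  · subst h1; simp [regStacks]
  · have h3 : (j : ℕ) ≠ m := fun h => h1 (Fin.ext h)
    by_cases h2 : j = stackOf m r
    · subst h2; rw [regStacks_stackOf hr]; simp [h1]
    · have h4 : (j : ℕ) ≠ r := by
        rintro rfl
        exact h2 (Fin.ext (by simp [stackOf]; omega))
      simp [regStacks, h1, h2, h4]

theorem length_regStacks_le {B : ℕ} {s : ℕ → ℕ} (h : ∀ r, s r ≤ B) (k : Fin (m + 1)) :
    (regStacks m s k).length ≤ Nat.log 2 (B + 1) := by
  unfold regStacks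
  split_ifs
  · simp
  · exact length_bijRepr_le (h _)

theorem test_run {r : ℕ} {zero pos : Λ} (hr : r < m) {B : ℕ} {s : ℕ → ℕ}
    (hs : ∀ r, s r ≤ B) (hM : M self = testStmt (stackOf m r) zero pos) (v : Option Bool) :
    ∃ v', BReach M (Nat.log 2 (B + 1)) ⟨some self, v, regStacks m s⟩
      ⟨some (if s r = 0 then zero else pos), v', regStacks m s⟩ := by
  refine ⟨(bijRepr (s r)).head?, BReach.head ?_ ?_⟩ <;>
    simp only [hM, testStmt, TM2.stepAux, regStacks_stackOf hr]
  · cases (bijRepr (s r)).head? <;> exact length_regStacks_le hs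
  · by_cases h : s r = 0
    · simp only [h, if_pos]
      exact Relation.ReflTransGen.refl
    · obtain ⟨a, l, hl⟩ := List.exists_cons_of_ne_nil (mt bijRepr_eq_nil.1 h)
      simp only [hl, List.head?_cons, h, if_false]
      exact Relation.ReflTransGen.refl

/-- Induction on the execution, for every embedding of the labels and every continuation: the
ambient machine need only agree with `code` on the embedded labels, so the statement applies to
subprograms in place. The body of a loop has the test of that loop as its continuation. -/
theorem code_run {B : ℕ} {p : Prog} {s s' : ℕ → ℕ} (e : Exec B p s s') :
    ∀ (ι : p.Lab → Λ) (next : Λ), (∀ l, M (ι l) = code p ι next l) → p.regBound ≤ m →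
      (∀ r, s r ≤ B) → ∀ v, ∃ v', BReach M (Nat.log 2 (B + 1))
        ⟨some (ι p.entry), v, regStacks m s⟩ ⟨some next, v', regStacks m s'⟩ := by
  induction e with
  | skip s =>
    intro ι next hM hp hs v
    have hM' : M (ι (entry skip)) = .goto fun _ => next := hM ()
    refine ⟨v, BReach.head ?_ ?_⟩ <;> simp only [hM', TM2.stepAux]
    · exact length_regStacks_le hs
    · exact Relation.ReflTransGen.refl
  | inc r s hr =>
    intro ι next hM hp hs v
    have hrm : r < m := hp
    have := inc_run (L := Nat.log 2 (B + 1)) (hM false) (hM true) (stackOf_ne_last hrm) _ v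
      (regStacks m s) (regStacks_stackOf hrm s) (length_regStacks_le hs)
      (by simpa [regStacks, bijRepr] using length_bijRepr_le (n := s r + 1) hr)
    refine ⟨none, ?_⟩
    rw [← regStacks_update hrm]
    change BReach M _ ⟨some (ι false), v, _⟩ _
    simpa [regStacks, bijRepr] using this
  | dec r s =>
    intro ι next hM hp hs v
    have hrm : r < m := hp
    have := dec_run (L := Nat.log 2 (B + 1)) (hM false) (hM true) (stackOf_ne_last hrm) _ v
      (regStacks m s) (regStacks_stackOf hrm s) (length_regStacks_le hs)
      (by simpa [regStacks] using length_bijRepr_le (hs r))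
    refine ⟨none, ?_⟩
    rw [← regStacks_update hrm, ← bijDec_bijRepr]
    change BReach M _ ⟨some (ι false), v, _⟩ _
    simpa [regStacks] using this
  | @seq p q s t u e1 e2 ih1 ih2 =>
    intro ι next hM hp hs v
    rw [regBound, max_le_iff] at hp
    obtain ⟨v1, h1⟩ := ih1 _ _ (fun l => hM (Sum.inl l)) hp.1 hs v
    obtain ⟨v2, h2⟩ := ih2 _ _ (fun l => hM (Sum.inr l)) hp.2 (e1.le hs) v1
    exact ⟨v2, h1.trans h2⟩
  | @ifz_zero r p q s t h0 e ih =>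
    intro ι next hM hp hs v
    simp only [regBound, max_le_iff] at hp
    obtain ⟨v1, h1⟩ := test_run hp.1 hs (hM none) v
    obtain ⟨v2, h2⟩ := ih _ _ (fun l => hM (some (Sum.inl l))) hp.2.1 hs v1
    rw [if_pos h0] at h1
    exact ⟨v2, h1.trans h2⟩
  | @ifz_pos r p q s t h0 e ih =>
    intro ι next hM hp hs v
    simp only [regBound, max_le_iff] at hp
    obtain ⟨v1, h1⟩ := test_run hp.1 hs (hM none) v
    obtain ⟨v2, h2⟩ := ih _ _ (fun l => hM (some (Sum.inr l))) hp.2.2 hs v1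
    rw [if_neg h0] at h1
    exact ⟨v2, h1.trans h2⟩
  | @loop_zero r p s h0 =>
    intro ι next hM hp hs v
    simp only [regBound, max_le_iff] at hp
    obtain ⟨v1, h1⟩ := test_run hp.1 hs (hM none) v
    rw [if_pos h0] at h1
    exact ⟨v1, h1⟩
  | @loop_pos r p s t u h0 e1 e2 ih1 ih2 =>
    intro ι next hM hp hs v
    have hp' := hp
    simp only [regBound, max_le_iff] at hp'
    obtain ⟨v1, h1⟩ := test_run hp'.1 hs (hM none) v
    obtain ⟨v2, h2⟩ := ih1 _ _ (fun l => hM (some l)) hp'.2 hs v1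
    obtain ⟨v3, h3⟩ := ih2 ι next hM hp (e1.le hs) v2
    rw [if_neg h0] at h1
    exact ⟨v3, (h1.trans h2).trans h3⟩

/-! ### The machine for a whole program -/

/-- The statements of the machine that runs a program and then halts. -/
def mainCode (p : Prog) (m : ℕ) : Option p.Lab → MStmt m (Option p.Lab)
  | none => .load (fun _ => none) .halt
  | some l => code p some none l

/-- The stack machine that runs a program on register `0`. -/
noncomputable def machine (p : Prog) (m : ℕ) : FinTM2 where
  K := Fin (m + 1)
  k₀ := 0
  k₁ := 0
  Γ _ := Bool
  Λ := Option p.Lab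
  main := some p.entry
  ΛFin := Fintype.ofFinite _
  σ := Option Bool
  initialState := none
  m := mainCode p m

/-- Registers with a single nonzero entry. -/
def single (x : ℕ) : ℕ → ℕ := update 0 0 x

theorem single_le {x B : ℕ} (h : x ≤ B) (r : ℕ) : single x r ≤ B := by
  by_cases hr : r = 0 <;> simp [single, hr, h]

/-- The initial configuration of the machine. -/
def initCfg (p : Prog) (m x : ℕ) : MCfg m (Option p.Lab) :=
  ⟨some (some p.entry), none, regStacks m (single x)⟩

/-- The final configuration of the machine. -/
def haltCfg (p : Prog) (m x : ℕ) : MCfg m (Option p.Lab) :=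
  ⟨none, none, regStacks m (single x)⟩

theorem initList_machine (p : Prog) {m : ℕ} (hm : 0 < m) (w : List Bool) :
    initList (p.machine m) w = initCfg p m (bijVal w) := by
  simp only [initList, machine, initCfg]
  congr 1
  funext k
  by_cases hk : k = 0
  · subst hk
    have : (0 : Fin (m + 1)) ≠ Fin.last m := by simp [Fin.ext_iff]; omega
    simp [regStacks, bijRepr_bijVal, this, single]
    rfl
  · have hk' : (k : ℕ) ≠ 0 := fun h => hk (Fin.ext h)
    simp [hk, regStacks, bijRepr, single]

theorem haltList_machine (p : Prog) {m : ℕ} (hm : 0 < m) (w : List Bool) :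
    haltList (p.machine m) w = haltCfg p m (bijVal w) := by
  simp only [haltList, machine, haltCfg]
  congr 1
  funext k
  by_cases hk : k = 0
  · subst hk
    have : (0 : Fin (m + 1)) ≠ Fin.last m := by simp [Fin.ext_iff]; omega
    simp [regStacks, bijRepr_bijVal, this, single]
    rfl
  · have hk' : (k : ℕ) ≠ 0 := fun h => hk (Fin.ext h)
    simp [hk, regStacks, bijRepr, single]

theorem BReach.reaches {M : Λ → MStmt m Λ} {L : ℕ} {a b : MCfg m Λ} (h : BReach M L a b) :
    StateTransition.Reaches (TM2.step M) a b :=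
  Relation.ReflTransGen.mono (fun _ _ h => h.1) _ _ h

/-- The machine is deterministic and `b` is halting, so every configuration reachable from `a` lies
on the bounded run from `a` to `b`. -/
theorem BReach.length_le {M : Λ → MStmt m Λ} {L : ℕ} {a b c : MCfg m Λ} (hab : BReach M L a b)
    (ha : ∀ k, (a.stk k).length ≤ L) (hb : TM2.step M b = none)
    (hac : StateTransition.Reaches (TM2.step M) a c) : ∀ k, (c.stk k).length ≤ L := by
  induction hab using Relation.ReflTransGen.head_induction_on with
  | refl =>
    rcases Relation.ReflTransGen.cases_head hac with rfl | ⟨d, hd, -⟩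
    · exact ha
    · rw [hb] at hd; simp at hd
  | head h1 h2 ih =>
    rcases Relation.ReflTransGen.cases_head hac with rfl | ⟨d, hd, hdc⟩
    · exact ha
    · exact ih h1.2 (Option.mem_unique hd h1.1 ▸ hdc)

theorem main_run {p : Prog} {m B x y : ℕ} (e : Exec B p (single x) (single y)) (hm : p.regBound ≤ m)
    (hx : x ≤ B) (hy : y ≤ B) :
    BReach (mainCode p m) (Nat.log 2 (B + 1)) (initCfg p m x) (haltCfg p m y) := by
  obtain ⟨v, hv⟩ := code_run (M := mainCode p m) e some none (fun l => rfl) hm (single_le hx) none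
  -- One more step resets the internal state, whose final value is prescribed by `haltList`.
  exact hv.trans (Relation.ReflTransGen.single ⟨rfl, length_regStacks_le (single_le hy)⟩)

end Prog

theorem exists_iterate_of_reaches {C : Type} {f : C → Option C} {a b : C}
    (h : StateTransition.Reaches f a b) : ∃ n, (flip bind f)^[n] (some a) = some b := by
  induction h using Relation.ReflTransGen.head_induction_on with
  | refl => exact ⟨0, rfl⟩
  | head h1 _ ih =>
    obtain ⟨n, hn⟩ := ih
    refine ⟨n + 1, ?_⟩
    rw [Function.iterate_succ_apply, ← hn]
    exact congrArg _ h1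

open Turing Prog in
/-- A language that is decided by a counter program whose registers are bounded by `M n` on inputs
of length `n` belongs to `EXPSPACE` if `M` grows at most doubly exponentially. -/
theorem mem_EXPSPACE_of_exec {A : Language Bool} [DecidablePred (· ∈ A)] (p : Prog) (M : ℕ → ℕ)
    (q : Polynomial ℕ) (hq : ∀ n, M n + 1 < 2 ^ 2 ^ q.eval n) (hM : ∀ n, 2 ≤ M n)
    (hA : ∀ w, bijVal w ≤ M w.length ∧
      Exec (M w.length) p (single (bijVal w)) (single (if w ∈ A then 2 else 1))) :
    A ∈ EXPSPACE := by
  -- The extra one makes `m` positive, so that the input stack `0` differs from the auxiliary stack.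
  set m := p.regBound + 1 with hm
  have hm0 : 0 < m := by omega
  have hval : ∀ w, bijVal [decide (w ∈ A)] = if w ∈ A then 2 else 1 := by
    intro w
    by_cases h : w ∈ A <;> simp [h, bijVal]
  have key : ∀ w : List Bool, BReach (mainCode p m) (Nat.log 2 (M w.length + 1))
      (initCfg p m (bijVal w)) (haltCfg p m (bijVal [decide (w ∈ A)])) := by
    intro w
    refine main_run (hval w ▸ (hA w).2) (by omega) (hA w).1 ?_
    have := hM w.length
    rw [hval]
    split_ifs <;> omega
  have hid : ∀ l : List Bool, l.map (Equiv.refl Bool).invFun = l := List.map_id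
  have hspace : ∀ (w : List Bool) (c : MCfg m (Option p.Lab)),
      StateTransition.Reaches (TM2.step (mainCode p m)) (initCfg p m (bijVal w)) c →
      spaceUsed (p.machine m) c ≤ (m + 1) * Nat.log 2 (M w.length + 1) := by
    intro w c hc
    have h1 := (key w).length_le (length_regStacks_le (single_le (hA w).1)) rfl hc
    unfold spaceUsed
    refine (Finset.sum_le_card_nsmul _ _ _ fun k _ => h1 k).trans ?_
    rw [smul_eq_mul]
    exact le_of_eq (congrArg (· * _) (Finset.card_fin (m + 1)))
  refine ⟨q + (m + 1 : ℕ), ⟨⟨⟨⟨p.machine m, Equiv.refl _, Equiv.refl _⟩, ?_⟩, ?_, ?_⟩⟩⟩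
  · intro w
    have h := exists_iterate_of_reaches (key w).reaches
    rw [← haltList_machine p hm0, ← initList_machine p hm0] at h
    refine ⟨h.choose, (congrArg (fun l => (flip bind (p.machine m).step)^[h.choose]
      (some (initList (p.machine m) l))) (hid w)).trans (h.choose_spec.trans ?_)⟩
    refine congrArg (fun l => some (haltList (p.machine m) l)) (Eq.trans ?_ (hid _).symm)
    simp only [Computability.encodeBool]
    congr
  · intro k
    exact inferInstanceAs (Finite Bool)
  · intro w c hc
    have hc' : StateTransition.Reaches (p.machine m).step (initList (p.machine m) w) c := by
      rw [← hid w]; exact hc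
    rw [initList_machine p hm0] at hc'
    refine (hspace w c hc').trans ?_
    have h1 : Nat.log 2 (M w.length + 1) ≤ 2 ^ q.eval w.length :=
      (Nat.log_lt_of_lt_pow (by omega) (hq w.length)).le
    have h2 : m + 1 ≤ 2 ^ (m + 1) := Nat.lt_two_pow_self.le
    calc (m + 1) * Nat.log 2 (M w.length + 1) ≤ 2 ^ (m + 1) * 2 ^ q.eval w.length :=
          Nat.mul_le_mul h2 h1
      _ = 2 ^ (q + (m + 1 : ℕ) : Polynomial ℕ).eval w.length := by
          rw [Polynomial.eval_add, Polynomial.eval_natCast, mul_comm, ← pow_add]; rfl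

end RegAbs

namespace RegAbs

/-! ### Straight-line reasoning about counter programs -/

open Function

namespace Prog

/-- Adds register `i` to register `j` and clears register `i`. -/
def move (i j : ℕ) : Prog := .loop i (.seq (.dec i) (.inc j))

/-- Adds register `i` to the registers `j` and `k` and clears register `i`. -/
def move₂ (i j k : ℕ) : Prog := .loop i (.seq (.dec i) (.seq (.inc j) (.inc k)))

theorem exec_move {M i j : ℕ} (hij : i ≠ j) (n : ℕ) : ∀ s : ℕ → ℕ, s i = n → s i + s j ≤ M →
    Exec M (move i j) s (update (update s i 0) j (s i + s j)) := by
  induction n with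
  | zero =>
    intro s hs _
    have : update (update s i 0) j (s i + s j) = s := by
      rw [← hs, update_eq_self, hs, zero_add, update_eq_self]
    rw [this]
    exact .loop_zero hs
  | succ n ih =>
    intro s hs hM
    refine .loop_pos (by omega) (.seq (.dec i s) (.inc j _ ?_)) ?_
    · simp only [ne_eq, hij.symm, not_false_eq_true, update_of_ne]; omega
    · change Exec M (move i j) _ _
      convert ih _ ?_ ?_ using 1
      · funext r
        by_cases h1 : r = j
        · subst h1; simp [hij, hij.symm]; omega
        · by_cases h2 : r = i
          · subst h2; simp [hij]
          · simp [h1, h2]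
      · simp [hij]; omega
      · simp [hij, hij.symm]; omega

theorem exec_move₂ {M i j k : ℕ} (hij : i ≠ j) (hik : i ≠ k) (hjk : j ≠ k) (n : ℕ) :
    ∀ s : ℕ → ℕ, s i = n → s i + s j ≤ M → s i + s k ≤ M →
    Exec M (move₂ i j k) s
      (update (update (update s i 0) j (s i + s j)) k (s i + s k)) := by
  induction n with
  | zero =>
    intro s hs _ _
    have : update (update (update s i 0) j (s i + s j)) k (s i + s k) = s := by
      rw [← hs, update_eq_self, hs, zero_add, update_eq_self, zero_add, update_eq_self]
    rw [this]
    exact .loop_zero hs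
  | succ n ih =>
    intro s hs hM hM'
    refine .loop_pos (by omega) (.seq (.dec i s) (.seq (.inc j _ ?_) (.inc k _ ?_))) ?_
    · simp only [ne_eq, hij.symm, not_false_eq_true, update_of_ne]; omega
    · simp only [ne_eq, hik.symm, hjk.symm, not_false_eq_true, update_of_ne]; omega
    · change Exec M (move₂ i j k) _ _
      convert ih _ ?_ ?_ ?_ using 1
      · funext r
        by_cases h1 : r = k
        · subst h1; simp [hik, hij, hik.symm, hjk.symm]; omega
        · by_cases h2 : r = j
          · subst h2; simp [hij, hik, hij.symm, hjk]; omega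
          · by_cases h3 : r = i
            · subst h3; simp [hij, hik]
            · simp [h1, h2, h3]
      · simp [hij, hik]; omega
      · simp [hij, hik, hij.symm, hjk]; omega
      · simp [hij, hik, hik.symm, hjk.symm]; omega

end Prog

/-- The registers from `d` on are given by a list, the ones below `d` by `s`. -/
def regs (s : ℕ → ℕ) (d : ℕ) (l : List ℕ) : ℕ → ℕ :=
  fun r => if r < d then s r else l.getD (r - d) 0

@[simp] theorem regs_add (s : ℕ → ℕ) (d i : ℕ) (l : List ℕ) : regs s d l (d + i) = l.getD i 0 := by
  simp [regs]

@[simp] theorem regs_self (s : ℕ → ℕ) (d : ℕ) (l : List ℕ) : regs s d l d = l.getD 0 0 := by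
  simp [regs]

@[simp] theorem update_regs_add (s : ℕ → ℕ) (d i v : ℕ) (l : List ℕ) (hi : i < l.length) :
    update (regs s d l) (d + i) v = regs s d (l.set i v) := by
  funext r
  by_cases h : r = d + i
  · subst h; simp [List.getD, hi]
  · rw [update_of_ne h]
    unfold regs
    split_ifs with h1
    · rfl
    · simp [List.getD, show i ≠ r - d by omega]

@[simp] theorem update_regs_self (s : ℕ → ℕ) (d v : ℕ) (l : List ℕ) (hl : 0 < l.length) :
    update (regs s d l) d v = regs s d (l.set 0 v) :=
  update_regs_add s d 0 v l hl

/-- Registers beyond the list count as zero. Scratch registers may therefore be added to a list,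
provided that they are cleared before they are dropped again. -/
theorem regs_append_zero (s : ℕ → ℕ) (d : ℕ) (l : List ℕ) : regs s d (l ++ [0]) = regs s d l := by
  funext r
  unfold regs
  split_ifs
  · rfl
  · simp only [List.getD, List.getElem?_append]
    split_ifs with h
    · rfl
    · rw [List.getElem?_eq_none (l := l) (by omega)]
      rcases Nat.lt_or_ge (r - d - l.length) 1 with h | h
      · simp [show r - d - l.length = 0 by omega]
      · simp [List.getElem?_eq_none (l := [0]) (by simpa using h)]

theorem regs_cons (s : ℕ → ℕ) (d a : ℕ) (l : List ℕ) :
    regs s d (a :: l) = regs (update s d a) (d + 1) l := by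
  funext r
  unfold regs
  rcases lt_trichotomy r d with h | h | h
  · simp [h, show r < d + 1 by omega, h.ne]
  · simp [h]
  · obtain ⟨k, rfl⟩ := Nat.exists_eq_add_of_lt h
    simp [show d + k + 1 - d = k + 1 by omega, show d + k + 1 - (d + 1) = k by omega]
    omega

/-- The program `p` turns the values `l` of the registers from `d` on into `l'`, without changing
the registers below `d` and without exceeding `M`. -/
def Runs (d M : ℕ) (p : Prog) (l l' : List ℕ) : Prop :=
  ∀ s, Exec M p (regs s d l) (regs s d l')

namespace Runs

variable {d M : ℕ} {p q : Prog} {l l' l'' : List ℕ}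

theorem seq (h1 : Runs d M p l l') (h2 : Runs d M q l' l'') : Runs d M (.seq p q) l l'' :=
  fun s => .seq (h1 s) (h2 s)

/-- The frame rule: a program that works from `d + 1` on leaves register `d` alone. -/
theorem cons (a : ℕ) (h : Runs (d + 1) M p l l') : Runs d M p (a :: l) (a :: l') := by
  intro s
  rw [regs_cons, regs_cons]
  exact h _

theorem of_append_zero_left (h : Runs d M p (l ++ [0]) l') : Runs d M p l l' := by
  intro s
  rw [← regs_append_zero]
  exact h s

theorem of_append_zero_right (h : Runs d M p l (l' ++ [0])) : Runs d M p l l' := by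
  intro s
  rw [← regs_append_zero _ _ l']
  exact h s

theorem inc {a : ℕ} (h : a + 1 ≤ M) : Runs d M (.inc d) (a :: l) ((a + 1) :: l) := by
  intro s
  have := Exec.inc (M := M) d (regs s d (a :: l)) (by simpa using h)
  simpa using this

theorem dec (a : ℕ) : Runs d M (.dec d) (a :: l) ((a - 1) :: l) := by
  intro s
  have := Exec.dec (M := M) d (regs s d (a :: l))
  simpa using this

theorem move {i j : ℕ} (hij : i ≠ j) (hi : i < l.length) (hj : j < l.length)
    (h : l.getD i 0 + l.getD j 0 ≤ M) : Runs d M (.move (d + i) (d + j)) l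
      ((l.set i 0).set j (l.getD i 0 + l.getD j 0)) := by
  intro s
  have := Prog.exec_move (M := M) (i := d + i) (j := d + j) (by omega) _ (regs s d l) rfl
    (by simpa using h)
  simpa [hi, hj] using this

theorem move₂ {i j k : ℕ} (hij : i ≠ j) (hik : i ≠ k) (hjk : j ≠ k) (hi : i < l.length)
    (hj : j < l.length) (hk : k < l.length) (h : l.getD i 0 + l.getD j 0 ≤ M)
    (h' : l.getD i 0 + l.getD k 0 ≤ M) : Runs d M (.move₂ (d + i) (d + j) (d + k)) l
      (((l.set i 0).set j (l.getD i 0 + l.getD j 0)).set k (l.getD i 0 + l.getD k 0)) := by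
  intro s
  have := Prog.exec_move₂ (M := M) (i := d + i) (j := d + j) (k := d + k) (by omega) (by omega)
    (by omega) _ (regs s d l) rfl (by simpa using h) (by simpa using h')
  simpa [hi, hj, hk] using this

/-- The loop invariant `g` is indexed by the number of rounds still to come, because the counter
runs down. -/
theorem loop {a : ℕ} {g : ℕ → List ℕ} (hg : ∀ i < a, Runs d M p ((i + 1) :: g (i + 1)) (i :: g i)) :
    Runs d M (.loop d p) (a :: g a) (0 :: g 0) := by
  induction a with
  | zero => exact fun s => .loop_zero (by simp)
  | succ a ih =>
    exact fun s => .loop_pos (by simp) (hg a (by omega) s) (ih (fun i hi => hg i (by omega)) s)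

end Runs

/-! ### The Cantor pairing function -/

/-- Triangular numbers. -/
def triangle : ℕ → ℕ
  | 0 => 0
  | n + 1 => triangle n + (n + 1)

/-- The Cantor pairing function. -/
def pack (a b : ℕ) : ℕ := a + triangle (a + b)

/-- The successor of a pair in the order of their codes. -/
def nextPair (p : ℕ × ℕ) : ℕ × ℕ := if p.2 = 0 then (0, p.1 + 1) else (p.1 + 1, p.2 - 1)

/-- The inverse of the Cantor pairing function. -/
def unpack (n : ℕ) : ℕ × ℕ := nextPair^[n] (0, 0)

theorem unpack_succ (n : ℕ) : unpack (n + 1) = nextPair (unpack n) :=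
  iterate_succ_apply' _ _ _

theorem pack_nextPair (p : ℕ × ℕ) : pack (nextPair p).1 (nextPair p).2 = pack p.1 p.2 + 1 := by
  obtain ⟨a, b⟩ := p
  unfold nextPair
  split_ifs with h
  · simp only at h; subst h; simp [pack, triangle]; omega
  · obtain ⟨b, rfl⟩ := Nat.exists_eq_succ_of_ne_zero h
    simp [pack, show a + 1 + b = a + (b + 1) by omega]; omega

theorem pack_unpack (n : ℕ) : pack (unpack n).1 (unpack n).2 = n := by
  induction n with
  | zero => rfl
  | succ n ih => rw [unpack_succ, pack_nextPair, ih]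

/-- The enumeration walks along diagonals of constant sum: diagonal `t` starts at step `triangle t`,
and its last pair `(t, 0)` is followed by the start of the next diagonal. -/
theorem unpack_add_triangle (t : ℕ) : ∀ a ≤ t, unpack (triangle t + a) = (a, t - a) := by
  induction t with
  | zero => intro a ha; obtain rfl : a = 0 := by omega
            rfl
  | succ t ih =>
    intro a
    induction a with
    | zero =>
      intro _
      rw [triangle, show triangle t + (t + 1) + 0 = (triangle t + t) + 1 by omega, unpack_succ,
        ih t le_rfl]
      simp [nextPair]
    | succ a iha =>
      intro ha
      rw [← add_assoc, unpack_succ, iha (by omega), nextPair,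
        if_neg (show ¬ t + 1 - a = 0 by omega)]
      simp; omega

@[simp] theorem unpack_pack (a b : ℕ) : unpack (pack a b) = (a, b) := by
  rw [pack, add_comm, unpack_add_triangle _ _ (by omega)]
  simp

theorem le_triangle (n : ℕ) : n ≤ triangle n := by
  cases n <;> simp [triangle]

theorem triangle_le (n : ℕ) : triangle n ≤ n * n := by
  induction n with
  | zero => simp [triangle]
  | succ n ih => simp only [triangle]; nlinarith

theorem triangle_mono {m n : ℕ} (h : m ≤ n) : triangle m ≤ triangle n := by
  induction h with
  | refl => rfl
  | step _ ih => rw [triangle]; omega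

theorem add_le_pack (a b : ℕ) : a + b ≤ pack a b := by
  have := le_triangle (a + b)
  unfold pack; omega

theorem pack_le (a b : ℕ) : pack a b ≤ (a + b + 1) ^ 2 := by
  have := triangle_le (a + b)
  unfold pack; nlinarith

theorem pack_mono {a b c d : ℕ} (h : a ≤ c) (h' : b ≤ d) : pack a b ≤ pack c d :=
  Nat.add_le_add h (triangle_mono (Nat.add_le_add h h'))

theorem unpack_snd_le (n : ℕ) : (unpack n).2 ≤ n := by
  have := add_le_pack (unpack n).1 (unpack n).2
  rw [pack_unpack] at this; omega

namespace Prog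

/-- Replaces a number by the two components of the pair that it codes. -/
def unpackProg (d : ℕ) : Prog :=
  .seq (.loop d (.seq (.dec d) (.ifz (d + 2) (.seq (move (d + 1) (d + 2)) (.inc (d + 2)))
    (.seq (.dec (d + 2)) (.inc (d + 1)))))) (.seq (move (d + 1) (d + 0)) (move (d + 2) (d + 1)))

/-- Replaces two numbers by the code of the pair. -/
def packProg (d : ℕ) : Prog :=
  .seq (.seq (move₂ (d + 0) (d + 1) (d + 2)) (move (d + 2) (d + 0)))
    (.loop (d + 1) (.seq (move₂ (d + 1) (d + 0) (d + 2))
      (.seq (move (d + 2) (d + 1)) (.dec (d + 1)))))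

/-! ### Correctness of the pairing programs -/

theorem runs_unpackProg {d M n : ℕ} (h : n ≤ M) :
    Runs d M (unpackProg d) [n] [(unpack n).1, (unpack n).2] := by
  have h1 : Runs d M (.loop d (.seq (.dec d) (.ifz (d + 2)
      (.seq (move (d + 1) (d + 2)) (.inc (d + 2))) (.seq (.dec (d + 2)) (.inc (d + 1))))))
      [n, 0, 0] [0, (unpack n).1, (unpack n).2] := by
    have := Runs.loop (d := d) (M := M) (a := n) (p := .seq (.dec d) (.ifz (d + 2)
      (.seq (move (d + 1) (d + 2)) (.inc (d + 2))) (.seq (.dec (d + 2)) (.inc (d + 1)))))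
      (g := fun i => [(unpack (n - i)).1, (unpack (n - i)).2]) ?_
    · simpa [unpack] using this
    · intro i hi
      rw [show n - i = (n - (i + 1)) + 1 by omega, unpack_succ]
      -- Both components together never exceed the code reached so far, which is below `n`; this
      -- keeps the registers within `M`.
      have hb := add_le_pack (unpack (n - (i + 1))).1 (unpack (n - (i + 1))).2
      rw [pack_unpack] at hb
      generalize unpack (n - (i + 1)) = p at hb
      obtain ⟨a, b⟩ := p
      refine (Runs.dec (i + 1)).seq ?_
      rw [Nat.add_sub_cancel]
      by_cases hb0 : b = 0
      · subst hb0
        have h2 : Runs d M (.seq (move (d + 1) (d + 2)) (.inc (d + 2))) [i, a, 0] [i, 0, a + 1] := by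
          refine Runs.seq (l' := [i, 0, a]) ?_
            (Runs.cons i (Runs.cons 0 (Runs.inc (d := d + 2) (by simp at hb; omega))))
          have := Runs.move (d := d) (M := M) (l := [i, a, 0]) (i := 1) (j := 2) (by simp)
            (by simp) (by simp) (by simp at hb ⊢; omega)
          simpa using this
        exact fun s => .ifz_zero (by simp) (by simpa [nextPair] using h2 s)
      · have h2 : Runs d M (.seq (.dec (d + 2)) (.inc (d + 1))) [i, a, b] [i, a + 1, b - 1] :=
          (Runs.cons i (Runs.cons a (Runs.dec (d := d + 2) b))).seq
            (Runs.cons i (Runs.inc (d := d + 1) (by simp at hb; omega)))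
        exact fun s => .ifz_pos (by simpa using hb0) (by simpa [nextPair, hb0] using h2 s)
  have hb := add_le_pack (unpack n).1 (unpack n).2
  rw [pack_unpack] at hb
  have h2 := Runs.move (d := d) (M := M) (l := [0, (unpack n).1, (unpack n).2]) (i := 1) (j := 0)
    (by simp) (by simp) (by simp) (by simp; omega)
  have h3 := Runs.move (d := d) (M := M) (l := [(unpack n).1, 0, (unpack n).2]) (i := 2) (j := 1)
    (by simp) (by simp) (by simp) (by simp; omega)
  refine Runs.of_append_zero_left (Runs.of_append_zero_left
    (Runs.of_append_zero_right (l' := [_, _]) ?_))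
  exact h1.seq (Runs.seq (by simpa using h2) (by simpa using h3))

theorem runs_packProg {d M a b : ℕ} (h : pack a b ≤ M) :
    Runs d M (packProg d) [a, b] [pack a b] := by
  have hab := add_le_pack a b
  have h1 := Runs.move₂ (d := d) (M := M) (l := [a, b, 0]) (i := 0) (j := 1) (k := 2)
    (by simp) (by simp) (by simp) (by simp) (by simp) (by simp) (by simp; omega) (by simp; omega)
  have h2 := Runs.move (d := d) (M := M) (l := [0, a + b, a]) (i := 2) (j := 0)
    (by simp) (by simp) (by simp) (by simp; omega)
  -- Each round adds the current `t` to the result and then lowers it, so the loop adds `t + (t - 1)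
  -- + ... + 1`.
  have h3 : ∀ t n, n + triangle t ≤ M → Runs d M (.loop (d + 1) (.seq (move₂ (d + 1) (d + 0) (d + 2))
      (.seq (move (d + 2) (d + 1)) (.dec (d + 1))))) [n, t, 0] [n + triangle t, 0, 0] := by
    intro t
    induction t with
    | zero => exact fun n _ s => .loop_zero (by simp)
    | succ t ih =>
      intro n hn
      have hle := le_triangle t
      simp only [triangle] at hn
      have h4 := Runs.move₂ (d := d) (M := M) (l := [n, t + 1, 0]) (i := 1) (j := 0) (k := 2)
        (by simp) (by simp) (by simp) (by simp) (by simp) (by simp) (by simp; omega)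
        (by simp; omega)
      have h5 := Runs.move (d := d) (M := M) (l := [t + 1 + n, 0, t + 1]) (i := 2) (j := 1)
        (by simp) (by simp) (by simp) (by simp; omega)
      have h6 := Runs.cons (t + 1 + n) (Runs.dec (d := d + 1) (M := M) (l := [0]) (t + 1))
      have h7 := ih (t + 1 + n) (by omega)
      simp only [triangle]
      rw [show n + (triangle t + (t + 1)) = t + 1 + n + triangle t by omega]
      exact fun s => .loop_pos (by simp) ((Runs.seq (by simpa using h4)
        (Runs.seq (by simpa using h5) (by simpa using h6))) s) (h7 s)
  refine Runs.of_append_zero_left (Runs.of_append_zero_right (l' := [_])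
    (Runs.of_append_zero_right (l' := [_, _]) ?_))
  refine Runs.seq (Runs.seq (by simpa using h1) (by simpa using h2)) ?_
  rw [pack]
  exact h3 (a + b) a h

end Prog
end RegAbs

namespace RegAbs

/-! ### Functions computed by counter programs -/

open Function

/-- Types whose elements are coded by numbers. -/
class Code (E : Type) where
  /-- the code of an element -/
  enc : E → ℕ

open Code

instance : Code ℕ := ⟨fun n => n⟩

open scoped Classical in
noncomputable instance : Code Prop := ⟨fun p => if p then 1 else 0⟩

instance {E F : Type} [Code E] [Code F] : Code (E × F) := ⟨fun p => pack (enc p.1) (enc p.2)⟩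

@[simp] theorem enc_nat (n : ℕ) : enc n = n := rfl

@[simp] theorem enc_prod {E F : Type} [Code E] [Code F] (p : E × F) :
    enc p = pack (enc p.1) (enc p.2) := rfl

theorem enc_of_true {p : Prop} (h : p) : enc p = 1 := if_pos h

theorem enc_of_false {p : Prop} (h : ¬p) : enc p = 0 := if_neg h

theorem enc_prop_le (p : Prop) : enc p ≤ 1 := by
  by_cases h : p
  · rw [enc_of_true h]
  · rw [enc_of_false h]; omega

/-- `f` is computed in place by counter programs that do not exceed `β e` on the argument `e`. -/
def Computes {E F : Type} [Code E] [Code F] (f : E → F) (β : E → ℕ) : Prop :=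
  ∀ d, ∃ p, ∀ e M, β e ≤ M → Runs d M p [enc e] [enc (f e)]

namespace Computes

variable {E F G : Type} [Code E] [Code F] [Code G] {f : E → F} {β γ : E → ℕ}

theorem mono (h : Computes f β) (hβ : ∀ x, β x ≤ γ x) : Computes f γ := by
  intro d
  obtain ⟨p, hp⟩ := h d
  exact ⟨p, fun x M hM => hp x M ((hβ x).trans hM)⟩

/-- The result stands in a register at the end of a run with bound `enc e + β e`. Hence a bound on
the computation bounds the value as well. -/
theorem le (h : Computes f β) (e : E) : enc (f e) ≤ enc e + β e := by
  obtain ⟨p, hp⟩ := h 0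
  have := (hp e (enc e + β e) (by omega) 0).le (by
    intro r
    rcases r with - | r <;> simp [regs]) 0
  simpa using this

theorem id : Computes (fun e : E => e) 0 := fun _ => ⟨.skip, fun _ _ _ _ => .skip _⟩

theorem succ : Computes (fun x : ℕ => x + 1) (fun x => x + 1) :=
  fun d => ⟨.inc d, fun _ _ h => Runs.inc h⟩

theorem pred : Computes (fun x : ℕ => x - 1) 0 := fun d => ⟨.dec d, fun x _ _ => Runs.dec x⟩

theorem zero : Computes (fun _ : E => 0) 0 := by
  intro d
  refine ⟨.loop d (.dec d), fun e M _ => ?_⟩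
  exact Runs.loop (a := enc e) (g := fun _ => []) fun i _ => by
    simpa using Runs.dec (d := d) (i + 1)

theorem comp {g : F → G} {δ : F → ℕ} (hg : Computes g δ) (hf : Computes f β) :
    Computes (fun e => g (f e)) (fun e => β e + δ (f e)) := by
  intro d
  obtain ⟨p, hp⟩ := hf d
  obtain ⟨q, hq⟩ := hg d
  refine ⟨.seq p q, fun x M hM => ?_⟩
  beta_reduce at hM
  exact (hp x M (by omega)).seq (hq _ M (by omega))

theorem fst : Computes (fun p : E × F => p.1) (fun p => enc p) := by
  intro d
  obtain ⟨p, hp⟩ := zero (E := F) (d + 1)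
  refine ⟨.seq (Prog.unpackProg d) p, fun x M hM => (Prog.runs_unpackProg hM).seq ?_⟩
  have := Runs.cons (enc x.1) (hp x.2 M (by simp))
  exact Runs.of_append_zero_right (l' := [_]) (by simpa using this)

theorem snd : Computes (fun p : E × F => p.2) (fun p => enc p) := by
  intro d
  refine ⟨.seq (Prog.unpackProg d) (.seq (.loop d (.dec d)) (Prog.move (d + 1) (d + 0))),
    fun x M hM => (Prog.runs_unpackProg hM).seq ?_⟩
  beta_reduce at hM
  have h1 := Runs.loop (d := d) (M := M) (p := .dec d) (a := enc x.1)
    (g := fun _ => [enc x.2]) fun i _ => by simpa using Runs.dec (d := d) (i + 1)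
  have h2 := Runs.move (d := d) (M := M) (l := [0, enc x.2]) (i := 1) (j := 0)
    (by simp) (by simp) (by simp) (by have := unpack_snd_le (enc x); simp at this hM ⊢; omega)
  exact Runs.of_append_zero_right (l' := [_]) (by simpa using h1.seq (by simpa using h2))

/-- Computation is in place and destroys its argument, so a copy of the argument is kept below while
`f` runs; the two registers are then exchanged, `g` runs on the copy, and the results are paired. -/
theorem prodMk {g : E → G} (hf : Computes f β) (hg : Computes g γ) :
    Computes (fun e => (f e, g e)) (fun e => enc e + β e + γ e + enc (f e, g e)) := by
  intro d
  obtain ⟨p, hp⟩ := hf (d + 1)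
  obtain ⟨q, hq⟩ := hg (d + 1)
  refine ⟨.seq (.seq (.seq (Prog.move₂ (d + 0) (d + 1) (d + 2)) (Prog.move (d + 2) (d + 0)))
    (.seq p (.seq (Prog.move (d + 0) (d + 2)) (.seq (Prog.move (d + 1) (d + 0))
      (Prog.move (d + 2) (d + 1))))))
    (.seq q (Prog.packProg d)), fun e M hM => ?_⟩
  beta_reduce at hM
  rw [enc_prod] at hM ⊢
  simp only at hM ⊢
  have hfx := add_le_pack (enc (f e)) (enc (g e))
  have h3 := Runs.cons (enc e) (hp e M (by omega))
  have h7 := Runs.cons (enc (f e)) (hq e M (by omega))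
  generalize enc (f e) = y at *
  generalize enc (g e) = z at *
  generalize enc e = x at *
  have h1 := Runs.move₂ (d := d) (M := M) (l := [x, 0, 0]) (i := 0) (j := 1) (k := 2)
    (by simp) (by simp) (by simp) (by simp) (by simp) (by simp) (by simp; omega) (by simp; omega)
  have h2 := Runs.move (d := d) (M := M) (l := [0, x, x]) (i := 2) (j := 0)
    (by simp) (by simp) (by simp) (by simp; omega)
  have h4 := Runs.move (d := d) (M := M) (l := [x, y, 0]) (i := 0) (j := 2)
    (by simp) (by simp) (by simp) (by simp; omega)
  have h5 := Runs.move (d := d) (M := M) (l := [0, y, x]) (i := 1) (j := 0)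
    (by simp) (by simp) (by simp) (by simp; omega)
  have h6 := Runs.move (d := d) (M := M) (l := [y, 0, x]) (i := 2) (j := 1)
    (by simp) (by simp) (by simp) (by simp; omega)
  refine Runs.seq (l' := [y, x]) (Runs.seq (l' := [x, x]) ?_ (h3.seq ?_))
    (h7.seq (Prog.runs_packProg (by omega)))
  · exact Runs.of_append_zero_left (Runs.of_append_zero_left (l := [x, 0])
      (Runs.of_append_zero_right (l' := [_, _]) (Runs.seq (by simpa using h1) (by simpa using h2))))
  · exact Runs.of_append_zero_left (l := [_, _]) (Runs.of_append_zero_right (l' := [_, _])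
      (Runs.seq (by simpa using h4) (Runs.seq (by simpa using h5) (by simpa using h6))))

/-- Iteration of a computable function. -/
theorem iterate {f : F → F} {δ : F → ℕ} (hf : Computes f δ) {n : E → ℕ} {a : E → F}
    (hna : Computes (fun e => (n e, a e)) β)
    (hγ : ∀ e, ∀ i ≤ n e, δ (f^[i] (a e)) ≤ γ e ∧ enc (f^[i] (a e)) ≤ γ e) :
    Computes (fun e => f^[n e] (a e)) (fun e => enc e + β e + γ e) := by
  intro d
  obtain ⟨q, hq⟩ := hna d
  obtain ⟨p, hp⟩ := hf (d + 1)
  refine ⟨.seq q (.seq (Prog.unpackProg d) (.seq (.loop d (.seq (.dec d) p))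
    (Prog.move (d + 1) (d + 0)))), fun e M hM => ?_⟩
  have hle := hna.le e
  beta_reduce at hM ⊢
  refine (hq e M (by omega)).seq ((Prog.runs_unpackProg (hle.trans (by omega))).seq ?_)
  simp only [enc_prod, unpack_pack, enc_nat]
  have hx := hγ e
  generalize n e = n at *
  generalize a e = y at *
  have h1 := Runs.loop (d := d) (M := M) (a := n) (p := .seq (.dec d) p)
    (g := fun i => [enc (f^[n - i] y)]) fun i hi => by
      refine (Runs.dec (i + 1)).seq (Runs.cons i ?_)
      rw [show n - i = (n - (i + 1)) + 1 by omega, iterate_succ_apply']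
      have := (hx (n - (i + 1)) (by omega)).1
      exact hp _ M (by omega)
  have h2 := Runs.move (d := d) (M := M) (l := [0, enc (f^[n] y)]) (i := 1) (j := 0)
    (by simp) (by simp) (by simp) (by have := (hx n le_rfl).2; simp; omega)
  exact Runs.of_append_zero_right (l' := [_]) (Runs.seq (by simpa using h1) (by simpa using h2))

end Computes

/-! ### Polynomially bounded computations -/

/-- Polynomially bounded functions. -/
def PolyBdd (β : ℕ → ℕ) : Prop := ∃ c, ∀ x, β x ≤ (x + 2) ^ c

namespace PolyBdd

variable {f g : ℕ → ℕ}

theorem mono (hf : PolyBdd f) (h : ∀ x, g x ≤ f x) : PolyBdd g := by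
  obtain ⟨c, hc⟩ := hf
  exact ⟨c, fun x => (h x).trans (hc x)⟩

theorem id : PolyBdd fun x => x := ⟨1, fun x => by simp⟩

/-- The base `x + 2` is at least two, so constants are absorbed by the exponent. -/
theorem const (k : ℕ) : PolyBdd fun _ => k :=
  ⟨k, fun x => Nat.lt_two_pow_self.le.trans (Nat.pow_le_pow_left (by omega) k)⟩

theorem mul (hf : PolyBdd f) (hg : PolyBdd g) : PolyBdd fun x => f x * g x := by
  obtain ⟨a, ha⟩ := hf
  obtain ⟨b, hb⟩ := hg
  exact ⟨a + b, fun x => by rw [pow_add]; exact Nat.mul_le_mul (ha x) (hb x)⟩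

theorem add (hf : PolyBdd f) (hg : PolyBdd g) : PolyBdd fun x => f x + g x := by
  obtain ⟨a, ha⟩ := hf
  obtain ⟨b, hb⟩ := hg
  refine ⟨a + b + 1, fun x => ?_⟩
  have h1 : (x + 2) ^ a ≤ (x + 2) ^ (a + b) := Nat.pow_le_pow_right (by omega) (by omega)
  have h2 : (x + 2) ^ b ≤ (x + 2) ^ (a + b) := Nat.pow_le_pow_right (by omega) (by omega)
  have h3 : 2 * (x + 2) ^ (a + b) ≤ (x + 2) ^ (a + b + 1) := by
    rw [pow_succ]; nlinarith [Nat.zero_le ((x + 2) ^ (a + b))]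
  exact (Nat.add_le_add (ha x) (hb x)).trans (by omega)

theorem pow (hf : PolyBdd f) (k : ℕ) : PolyBdd fun x => f x ^ k := by
  induction k with
  | zero => simpa using const 1
  | succ k ih => simpa [pow_succ] using ih.mul hf

theorem pack (hf : PolyBdd f) (hg : PolyBdd g) : PolyBdd fun x => pack (f x) (g x) :=
  (((hf.add hg).add (const 1)).pow 2).mono fun _ => pack_le _ _

end PolyBdd

/-- Functions between coded types that are computed with polynomially bounded registers. -/
@[fun_prop]
def Cmp {E F : Type} [Code E] [Code F] (f : E → F) : Prop :=
  ∃ γ, PolyBdd γ ∧ Computes f (fun e => γ (enc e))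

namespace Cmp

variable {E F G : Type} [Code E] [Code F] [Code G]

theorem exists_polyBdd {f : E → F} (hf : Cmp f) : ∃ γ, PolyBdd γ ∧ ∀ e, enc (f e) ≤ γ (enc e) := by
  obtain ⟨γ, h, hf⟩ := hf
  exact ⟨_, PolyBdd.id.add h, hf.le⟩

@[fun_prop]
theorem id : Cmp fun e : E => e := ⟨_, PolyBdd.const 0, Computes.id⟩

theorem succ : Cmp fun x : ℕ => x + 1 :=
  ⟨_, PolyBdd.id.add (PolyBdd.const 1), Computes.succ⟩

theorem pred : Cmp fun x : ℕ => x - 1 := ⟨_, PolyBdd.const 0, Computes.pred⟩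

@[fun_prop]
theorem comp {g : F → G} {f : E → F} (hg : Cmp g) (hf : Cmp f) : Cmp fun e => g (f e) := by
  obtain ⟨δ, h5, h6⟩ := hf.exists_polyBdd
  obtain ⟨β, h1, h2⟩ := hf
  obtain ⟨γ, ⟨c, hc⟩, h4⟩ := hg
  refine ⟨_, h1.add ((h5.add (PolyBdd.const 2)).pow c), (h4.comp h2).mono fun e => ?_⟩
  exact Nat.add_le_add_left ((hc _).trans (Nat.pow_le_pow_left (Nat.add_le_add_right (h6 e) 2) c)) _

@[fun_prop]
theorem prodMk {f : E → F} {g : E → G} (hf : Cmp f) (hg : Cmp g) : Cmp fun e => (f e, g e) := by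
  obtain ⟨δ, h5, h6⟩ := hf.exists_polyBdd
  obtain ⟨ε, h7, h8⟩ := hg.exists_polyBdd
  obtain ⟨β, h1, h2⟩ := hf
  obtain ⟨γ, h3, h4⟩ := hg
  refine ⟨_, ((PolyBdd.id.add h1).add h3).add (h5.pack h7), (h2.prodMk h4).mono fun e => ?_⟩
  exact Nat.add_le_add_left (pack_mono (h6 e) (h8 e)) _

@[fun_prop]
theorem const (b : F) : Cmp fun _ : E => b := by
  have : ∀ k : ℕ, Cmp fun _ : E => k := fun k => by
    induction k with
    | zero => exact ⟨_, PolyBdd.const 0, Computes.zero⟩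
    | succ k ih => exact succ.comp ih
  -- Computability refers to codes only, so the constant may be replaced by the number coding it.
  exact this (enc b)

@[fun_prop]
theorem fst {f : E → F × G} (hf : Cmp f) : Cmp fun e => (f e).1 :=
  comp (g := Prod.fst) ⟨_, PolyBdd.id, Computes.fst⟩ hf

@[fun_prop]
theorem snd {f : E → F × G} (hf : Cmp f) : Cmp fun e => (f e).2 :=
  comp (g := Prod.snd) ⟨_, PolyBdd.id, Computes.snd⟩ hf

/-- Codes may be used in place of the coded elements. -/
theorem of_enc {f : E → F} {g : E → G} (hf : Cmp f) (h : ∀ e, enc (g e) = enc (f e)) : Cmp g := by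
  obtain ⟨γ, h1, h2⟩ := hf
  refine ⟨γ, h1, fun d => ?_⟩
  obtain ⟨p, hp⟩ := h2 d
  exact ⟨p, fun e M hM => by rw [h]; exact hp e M hM⟩

@[fun_prop]
theorem enc {f : E → F} (hf : Cmp f) : Cmp fun e => Code.enc (f e) := hf

/-- Iteration, with a polynomial bound on the intermediate values. -/
theorem iterate {f : E → F → F} {n : E → ℕ} {a : E → F} (hf : Cmp fun p : E × F => f p.1 p.2)
    (hn : Cmp n) (ha : Cmp a) {γ : ℕ → ℕ} (hγ : PolyBdd γ)
    (h : ∀ e, ∀ i ≤ n e, Code.enc ((f e)^[i] (a e)) ≤ γ (Code.enc e)) :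
    Cmp fun e => (f e)^[n e] (a e) := by
  have hit : ∀ e i, (fun p : E × F => (p.1, f p.1 p.2))^[i] (e, a e) = (e, (f e)^[i] (a e)) := by
    intro e i
    induction i with
    | zero => rfl
    | succ i ih => simp only [iterate_succ_apply', ih]
  have h1 : Cmp fun p : E × F => (p.1, f p.1 p.2) := by fun_prop
  have h2 : Cmp fun e => (n e, (e, a e)) := by fun_prop
  obtain ⟨β, hβ, h2⟩ := h2
  obtain ⟨δ, ⟨c, hc⟩, h1⟩ := h1
  have h3 : Cmp fun e => (fun p : E × F => (p.1, f p.1 p.2))^[n e] (e, a e) := by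
    have hp : PolyBdd fun x => pack x (γ x) := PolyBdd.id.pack hγ
    refine ⟨_, (PolyBdd.id.add hβ).add (hp.add ((hp.add (PolyBdd.const 2)).pow c)),
      h1.iterate h2 fun e i hi => ?_⟩
    simp only [hit]
    have h4 : Code.enc (e, (f e)^[i] (a e)) ≤ pack (Code.enc e) (γ (Code.enc e)) :=
      pack_mono le_rfl (h e i hi)
    have h5 := (hc (Code.enc (e, (f e)^[i] (a e)))).trans
      (Nat.pow_le_pow_left (Nat.add_le_add_right h4 2) c)
    exact ⟨h5.trans (by omega), h4.trans (by omega)⟩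
  simp only [hit] at h3
  exact h3.snd

end Cmp
end RegAbs

namespace RegAbs

/-! ### Arithmetic, logic and bounded search -/

open Function Code

/-- Bounded existential quantification. -/
def ExB (b : ℕ) (P : ℕ → Prop) : Prop := ∃ x < b, P x

/-- Bounded universal quantification. -/
def AllB (b : ℕ) (P : ℕ → Prop) : Prop := ∀ x < b, P x

open scoped Classical in
/-- The least number below `b` with the property `P`, and `b` if there is none. -/
noncomputable def bfind (b : ℕ) (P : ℕ → Prop) : ℕ := (fun i => if P i then i else i + 1)^[b] 0

/-- Iteration that stops before the codes exceed `c`. -/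
def clampIter {F : Type} [Code F] (c : ℕ) (f : F → F) (n : ℕ) (a : F) : F :=
  (fun s => if enc (f s) ≤ c then f s else s)^[n] a

/-- The bit at position `i`, as a proposition. -/
def HasBit (n i : ℕ) : Prop := n.testBit i = true

theorem bfind_spec (P : ℕ → Prop) (b : ℕ) :
    bfind b P ≤ b ∧ (∀ j < bfind b P, ¬P j) ∧ (bfind b P < b → P (bfind b P)) := by
  classical
  induction b with
  | zero => simp [bfind]
  | succ b ih =>
    have : bfind (b + 1) P = if P (bfind b P) then bfind b P else bfind b P + 1 :=
      iterate_succ_apply' _ _ _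
    rw [this]
    obtain ⟨h1, h2, h3⟩ := ih
    split_ifs with h
    · exact ⟨by omega, h2, fun _ => h⟩
    · refine ⟨by omega, fun j hj => ?_, fun hb => absurd (h3 (by omega)) h⟩
      rcases Nat.lt_succ_iff_lt_or_eq.1 hj with hj | rfl
      · exact h2 j hj
      · exact h

theorem bfind_eq {P : ℕ → Prop} {b n : ℕ} (hn : n < b) (h : ∀ j < n, ¬P j) (hP : P n) :
    bfind b P = n := by
  obtain ⟨h1, h2, h3⟩ := bfind_spec P b
  rcases lt_trichotomy (bfind b P) n with hlt | heq | hgt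
  · exact absurd (h3 (by omega)) (h _ hlt)
  · exact heq
  · exact absurd hP (h2 _ hgt)

/-- Clamping bounds every iterate without any hypothesis on `f`, so the iteration is computable as
it stands; `clampIter_eq` removes the clamp where it is never active. -/
theorem clampIter_enc_le {F : Type} [Code F] (c : ℕ) (f : F → F) (n : ℕ) (a : F) :
    enc (clampIter c f n a) ≤ enc a + c := by
  induction n with
  | zero => exact Nat.le_add_right _ _
  | succ n ih =>
    have : clampIter c f (n + 1) a = if enc (f (clampIter c f n a)) ≤ c then f (clampIter c f n a)
      else clampIter c f n a := iterate_succ_apply' _ _ _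
    rw [this]
    split_ifs with h <;> omega

theorem clampIter_eq {F : Type} [Code F] {c : ℕ} {f : F → F} {n : ℕ} {a : F}
    (h : ∀ i < n, enc (f^[i + 1] a) ≤ c) : clampIter c f n a = f^[n] a := by
  induction n with
  | zero => rfl
  | succ n ih =>
    have : clampIter c f (n + 1) a = if enc (f (clampIter c f n a)) ≤ c then f (clampIter c f n a)
      else clampIter c f n a := iterate_succ_apply' _ _ _
    rw [this, ih fun i hi => h i (by omega), ← iterate_succ_apply' f, if_pos (h n (by omega))]

namespace Cmp

variable {E F : Type} [Code E] [Code F]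

@[fun_prop]
theorem add {f g : E → ℕ} (hf : Cmp f) (hg : Cmp g) : Cmp fun e => f e + g e := by
  have hit : ∀ n a : ℕ, (fun x => x + 1)^[n] a = a + n := fun n a => by
    induction n with
    | zero => rfl
    | succ n ih => rw [iterate_succ_apply', ih, add_assoc]
  have h : Cmp fun p : ℕ × ℕ => (fun x => x + 1)^[p.2] p.1 :=
    iterate (f := fun (_ : ℕ × ℕ) x => x + 1) (succ.comp (by fun_prop)) (by fun_prop)
      (by fun_prop) PolyBdd.id fun p i hi => by
        rw [hit, enc_prod]
        have := add_le_pack (Code.enc p.1) (Code.enc p.2)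
        simp only [enc_nat] at this ⊢
        omega
  simp only [hit] at h
  exact comp (g := fun p : ℕ × ℕ => p.1 + p.2) h (hf.prodMk hg)

@[fun_prop]
theorem sub {f g : E → ℕ} (hf : Cmp f) (hg : Cmp g) : Cmp fun e => f e - g e := by
  have hit : ∀ n a : ℕ, (fun x => x - 1)^[n] a = a - n := fun n a => by
    induction n with
    | zero => rfl
    | succ n ih => rw [iterate_succ_apply', ih, Nat.sub_sub]
  have h : Cmp fun p : ℕ × ℕ => (fun x => x - 1)^[p.2] p.1 :=
    iterate (f := fun (_ : ℕ × ℕ) x => x - 1) (pred.comp (by fun_prop)) (by fun_prop)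
      (by fun_prop) PolyBdd.id fun p i hi => by
        rw [hit, enc_prod]
        have := add_le_pack (Code.enc p.1) (Code.enc p.2)
        simp only [enc_nat] at this ⊢
        omega
  simp only [hit] at h
  exact comp (g := fun p : ℕ × ℕ => p.1 - p.2) h (hf.prodMk hg)

@[fun_prop]
theorem mul {f g : E → ℕ} (hf : Cmp f) (hg : Cmp g) : Cmp fun e => f e * g e := by
  have hit : ∀ n a : ℕ, (fun x => x + a)^[n] 0 = n * a := fun n a => by
    induction n with
    | zero => simp
    | succ n ih => rw [iterate_succ_apply', ih, Nat.succ_mul]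
  have h : Cmp fun p : ℕ × ℕ => (fun x => x + p.2)^[p.1] 0 :=
    iterate (f := fun (p : ℕ × ℕ) x => x + p.2) (by fun_prop) (by fun_prop)
      (by fun_prop) (PolyBdd.id.mul PolyBdd.id) fun p i hi => by
        rw [hit, enc_prod]
        have := add_le_pack (Code.enc p.1) (Code.enc p.2)
        simp only [enc_nat] at this ⊢
        exact Nat.mul_le_mul (by omega) (by omega)
  simp only [hit] at h
  exact comp (g := fun p : ℕ × ℕ => p.1 * p.2) h (hf.prodMk hg)

@[fun_prop]
theorem eq_zero {f : E → ℕ} (hf : Cmp f) : Cmp fun e => f e = 0 :=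
  of_enc (f := fun e => 1 - f e) (by fun_prop) fun e => by
    by_cases h : f e = 0
    · rw [enc_of_true h, h]; rfl
    · rw [enc_of_false h]; simp; omega

@[fun_prop]
theorem not {p : E → Prop} (hp : Cmp p) : Cmp fun e => ¬p e :=
  of_enc (f := fun e => 1 - Code.enc (p e)) (by fun_prop) fun e => by
    by_cases h : p e
    · rw [enc_of_true h, enc_of_false (not_not.2 h)]; rfl
    · rw [enc_of_false h, enc_of_true h]; rfl

@[fun_prop]
theorem and {p q : E → Prop} (hp : Cmp p) (hq : Cmp q) : Cmp fun e => p e ∧ q e :=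
  of_enc (f := fun e => Code.enc (p e) * Code.enc (q e)) (by fun_prop) fun e => by
    by_cases h : p e
    · by_cases h' : q e
      · rw [enc_of_true h, enc_of_true h', enc_of_true ⟨h, h'⟩]; rfl
      · rw [enc_of_false h', enc_of_false fun h => h' h.2]; rfl
    · rw [enc_of_false h, enc_of_false fun h' => h h'.1, zero_mul]; rfl

@[fun_prop]
theorem or {p q : E → Prop} (hp : Cmp p) (hq : Cmp q) : Cmp fun e => p e ∨ q e := by
  have : Cmp fun e => ¬(¬p e ∧ ¬q e) := by fun_prop
  simpa only [not_and_or, not_not] using this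

@[fun_prop]
theorem iff {p q : E → Prop} (hp : Cmp p) (hq : Cmp q) : Cmp fun e => p e ↔ q e := by
  have : Cmp fun e => (p e ∧ q e) ∨ (¬p e ∧ ¬q e) := by fun_prop
  simpa only [← iff_iff_and_or_not_and_not] using this

@[fun_prop]
theorem le {f g : E → ℕ} (hf : Cmp f) (hg : Cmp g) : Cmp fun e => f e ≤ g e := by
  have : Cmp fun e => f e - g e = 0 := by fun_prop
  simpa only [Nat.sub_eq_zero_iff_le] using this

@[fun_prop]
theorem lt {f g : E → ℕ} (hf : Cmp f) (hg : Cmp g) : Cmp fun e => f e < g e := by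
  have : Cmp fun e => f e + 1 ≤ g e := by fun_prop
  simpa only [Nat.succ_le_iff] using this

@[fun_prop]
theorem eq {f g : E → ℕ} (hf : Cmp f) (hg : Cmp g) : Cmp fun e => f e = g e := by
  have : Cmp fun e => f e ≤ g e ∧ g e ≤ f e := by fun_prop
  simpa only [← le_antisymm_iff] using this

-- Truth values are coded by `0` and `1`, so a case distinction is a sum of products of codes.
@[fun_prop]
theorem ite {p : E → Prop} [∀ e, Decidable (p e)] {f g : E → F} (hp : Cmp p) (hf : Cmp f)
    (hg : Cmp g) : Cmp fun e => if p e then f e else g e :=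
  of_enc (f := fun e => Code.enc (p e) * Code.enc (f e) + (1 - Code.enc (p e)) * Code.enc (g e))
    (by fun_prop) fun e => by
      by_cases h : p e
      · rw [enc_of_true h, if_pos h]; simp
      · rw [enc_of_false h, if_neg h]; simp

-- A loop over the pair of the next candidate and the disjunction so far. The number of rounds is
-- the value of `b`, which is harmless because only the size of the registers counts.
@[fun_prop]
theorem exB {b : E → ℕ} {P : E → ℕ → Prop} (hb : Cmp b) (hP : Cmp fun p : E × ℕ => P p.1 p.2) :
    Cmp fun e => ExB (b e) (P e) := by
  have hit : ∀ e n, (fun s : ℕ × Prop => (s.1 + 1, s.2 ∨ P e s.1))^[n] (0, False) =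
      (n, ExB n (P e)) := fun e n => by
    induction n with
    | zero => simp [ExB]
    | succ n ih => simp only [iterate_succ_apply', ih, ExB, Nat.exists_lt_succ_right]
  obtain ⟨γ, h1, h2⟩ := hb.exists_polyBdd
  have hP' : Cmp fun p : E × (ℕ × Prop) => P p.1 p.2.1 :=
    hP.comp (f := fun p : E × (ℕ × Prop) => (p.1, p.2.1)) (by fun_prop)
  have h : Cmp fun e => (fun s : ℕ × Prop => (s.1 + 1, s.2 ∨ P e s.1))^[b e] (0, False) :=
    iterate (f := fun e (s : ℕ × Prop) => (s.1 + 1, s.2 ∨ P e s.1)) (by fun_prop) hb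
      (by fun_prop) (h1.pack (PolyBdd.const 1)) fun e i hi => by
        rw [hit]
        exact pack_mono (hi.trans (h2 e)) (enc_prop_le _)
  simp only [hit] at h
  exact h.snd

@[fun_prop]
theorem allB {b : E → ℕ} {P : E → ℕ → Prop} (hb : Cmp b) (hP : Cmp fun p : E × ℕ => P p.1 p.2) :
    Cmp fun e => AllB (b e) (P e) := by
  have : Cmp fun e => ¬ExB (b e) fun x => ¬P e x := by fun_prop
  simpa [ExB, AllB] using this

@[fun_prop]
theorem find {b : E → ℕ} {P : E → ℕ → Prop} (hb : Cmp b) (hP : Cmp fun p : E × ℕ => P p.1 p.2) :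
    Cmp fun e => bfind (b e) (P e) := by
  classical
  obtain ⟨γ, h1, h2⟩ := hb.exists_polyBdd
  have h3 : Cmp fun e => (fun i => if P e i then i else i + 1)^[b e] 0 :=
    iterate (f := fun e i => if P e i then i else i + 1) (by fun_prop) hb (by fun_prop) h1
      fun e i hi => ((bfind_spec (P e) i).1.trans hi).trans (h2 e)
  exact h3

theorem clampIter {c n : E → ℕ} {f : E → F → F} {a : E → F} (hc : Cmp c)
    (hf : Cmp fun p : E × F => f p.1 p.2) (hn : Cmp n) (ha : Cmp a) :
    Cmp fun e => clampIter (c e) (f e) (n e) (a e) := by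
  obtain ⟨γ, h1, h2⟩ := ha.exists_polyBdd
  obtain ⟨δ, h3, h4⟩ := hc.exists_polyBdd
  refine iterate (f := fun e s => if Code.enc (f e s) ≤ c e then f e s else s) (by fun_prop) hn ha
    (h1.add h3) fun e i _ => (clampIter_enc_le (c e) (f e) i (a e)).trans ?_
  exact Nat.add_le_add (h2 e) (h4 e)

@[fun_prop]
theorem div {f g : E → ℕ} (hf : Cmp f) (hg : Cmp g) : Cmp fun e => f e / g e := by
  have : Cmp fun e => if g e = 0 then 0 else bfind (f e + 1) fun i => f e < (i + 1) * g e := by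
    fun_prop
  convert this using 2 with e
  split_ifs with h
  · simp [h]
  · refine (bfind_eq (Nat.lt_succ_of_le (Nat.div_le_self _ _)) (fun j hj => ?_) ?_).symm
    · rw [not_lt]
      exact (Nat.le_div_iff_mul_le (Nat.pos_of_ne_zero h)).1 hj
    · exact (Nat.div_lt_iff_lt_mul (Nat.pos_of_ne_zero h)).1 (Nat.lt_succ_self _)

@[fun_prop]
theorem mod {f g : E → ℕ} (hf : Cmp f) (hg : Cmp g) : Cmp fun e => f e % g e := by
  have : Cmp fun e => f e - g e * (f e / g e) := by fun_prop
  simpa only [← Nat.mod_eq_sub_mul_div] using this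

@[fun_prop]
theorem unpack {f : E → ℕ} (hf : Cmp f) : Cmp fun e => unpack (f e) :=
  of_enc hf fun _ => pack_unpack _

@[fun_prop]
theorem hasBit {f g : E → ℕ} (hf : Cmp f) (hg : Cmp g) : Cmp fun e => HasBit (f e) (g e) := by
  have hit : ∀ a n : ℕ, (fun x => x / 2)^[n] a = a / 2 ^ n := fun a n => by
    induction n with
    | zero => simp
    | succ n ih => rw [iterate_succ_apply', ih, Nat.div_div_eq_div_mul, pow_succ]
  obtain ⟨γ, h1, h2⟩ := hf.exists_polyBdd
  have h : Cmp fun e => (fun x => x / 2)^[g e] (f e) :=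
    iterate (f := fun _ x => x / 2) (by fun_prop) hg hf h1 fun e i _ => by
      rw [hit]; exact (Nat.div_le_self _ _).trans (h2 e)
  simp only [hit] at h
  have h' : Cmp fun e => f e / 2 ^ g e % 2 = 1 := by fun_prop
  simpa [HasBit, Nat.testBit_eq_decide_div_mod_eq] using h'

end Cmp
end RegAbs

namespace RegAbs

/-! ### Reachability in implicitly given graphs -/

open Function Code

/-- Reachability by a path of length at most `2 ^ k` through vertices below `B`. -/
def Within (R : ℕ → ℕ → Prop) (B : ℕ) : ℕ → ℕ → ℕ → Prop
  | 0, u, v => u = v ∨ R u v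
  | k + 1, u, v => ∃ w < B, Within R B k u w ∧ Within R B k w v

/-- A path of length `n` through vertices below `B`. -/
def IsPath (R : ℕ → ℕ → Prop) (B n : ℕ) (f : ℕ → ℕ) : Prop :=
  ∀ i < n, R (f i) (f (i + 1)) ∧ f (i + 1) < B

/-- Cuts the cycle between two visits to the same vertex. -/
theorem IsPath.shortcut {R : ℕ → ℕ → Prop} {B n : ℕ} {f : ℕ → ℕ} (hf : IsPath R B n f) {i j : ℕ}
    (hij : i < j) (hj : j ≤ n) (h : f i = f j) :
    ∃ g, g 0 = f 0 ∧ g (n - (j - i)) = f n ∧ IsPath R B (n - (j - i)) g := by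
  refine ⟨fun m => if m ≤ i then f m else f (m + (j - i)), by simp, ?_, fun m hm => ?_⟩
  · beta_reduce
    split_ifs with h1
    · rw [show n - (j - i) = i by omega, h, show n = j by omega]
    · congr 1; omega
  · beta_reduce
    rcases lt_trichotomy m i with h1 | h1 | h1
    · rw [if_pos h1.le, if_pos (by omega)]
      exact hf m (by omega)
    · subst h1
      rw [if_pos le_rfl, if_neg (by omega), h, show m + 1 + (j - m) = j + 1 by omega]
      exact hf j (by omega)
    · rw [if_neg (by omega), if_neg (by omega),
        show m + 1 + (j - i) = m + (j - i) + 1 by omega]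
      exact hf _ (by omega)

/-- By the pigeonhole principle a path of length at least `B` repeats a vertex and can be shortened.
-/
theorem IsPath.exists_lt {R : ℕ → ℕ → Prop} {B n : ℕ} {f : ℕ → ℕ} (hf : IsPath R B n f)
    (h0 : f 0 < B) : ∃ m g, m < B ∧ g 0 = f 0 ∧ g m = f n ∧ IsPath R B m g := by
  induction n using Nat.strong_induction_on generalizing f with
  | _ n ih =>
    rcases Nat.lt_or_ge n B with hn | hn
    · exact ⟨n, f, hn, rfl, rfl, hf⟩
    · have hlt : ∀ i ≤ n, f i < B := by
        intro i hi
        rcases i with - | i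
        · exact h0
        · exact (hf i (by omega)).2
      obtain ⟨i, hi, j, hj, hij, h⟩ := Finset.exists_ne_map_eq_of_card_lt_of_maps_to
        (s := Finset.range (n + 1)) (t := Finset.range B) (f := f) (by simpa using by omega)
        (fun i hi => by
          simp only [Finset.coe_range, Set.mem_Iio] at hi ⊢
          exact hlt i (by omega))
      wlog hlt' : i < j generalizing i j
      · exact this j hj i hi hij.symm h.symm (by omega)
      simp only [Finset.mem_range] at hi hj
      obtain ⟨g, h1, h2, h3⟩ := hf.shortcut hlt' (by omega) h
      obtain ⟨m, g', h4, h5, h6, h7⟩ := ih _ (by omega) h3 (h1 ▸ h0)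
      exact ⟨m, g', h4, h5.trans h1, h6.trans h2, h7⟩

theorem IsPath.within {R : ℕ → ℕ → Prop} {B : ℕ} (k : ℕ) : ∀ {n : ℕ} {f : ℕ → ℕ},
    IsPath R B n f → f 0 < B → n ≤ 2 ^ k → Within R B k (f 0) (f n) := by
  induction k with
  | zero =>
    intro n f hf _ hn
    rcases n with - | n
    · exact Or.inl rfl
    · obtain rfl : n = 0 := by simpa using hn
      exact Or.inr (hf 0 (by omega)).1
  | succ k ih =>
    intro n f hf h0 hn
    have hlt : ∀ i ≤ n, f i < B := by
      intro i hi
      rcases i with - | i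
      · exact h0
      · exact (hf i (by omega)).2
    have hm : n / 2 ≤ 2 ^ k ∧ n - n / 2 ≤ 2 ^ k := by rw [pow_succ] at hn; omega
    refine ⟨f (n / 2), hlt _ (by omega), ih (fun i hi => hf i (by omega)) h0 hm.1, ?_⟩
    have := ih (n := n - n / 2) (f := fun i => f (n / 2 + i)) (fun i hi => hf _ (by omega))
      (hlt _ (by omega)) hm.2
    simpa [show n / 2 + (n - n / 2) = n by omega] using this

theorem Within.exists_path {R : ℕ → ℕ → Prop} {B : ℕ} (k : ℕ) : ∀ {u v : ℕ}, v < B →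
    Within R B k u v → ∃ n f, f 0 = u ∧ f n = v ∧ IsPath R B n f := by
  induction k with
  | zero =>
    rintro u v hv (rfl | h)
    · exact ⟨0, fun _ => u, rfl, rfl, fun i hi => absurd hi (by omega)⟩
    · exact ⟨1, fun i => if i = 0 then u else v, rfl, rfl, fun i hi => by
        obtain rfl : i = 0 := by omega
        simpa using ⟨h, hv⟩⟩
  | succ k ih =>
    rintro u v hv ⟨w, hw, h1, h2⟩
    obtain ⟨n, f, rfl, rfl, hf⟩ := ih hw h1
    obtain ⟨m, g, hg0, rfl, hg⟩ := ih hv h2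
    refine ⟨n + m, fun i => if i ≤ n then f i else g (i - n), by simp, ?_, fun i hi => ?_⟩
    · rcases m with - | m
      · simp [hg0]
      · simp
    · beta_reduce
      rcases lt_trichotomy i n with h | h | h
      · rw [if_pos h.le, if_pos (by omega)]
        exact hf i h
      · subst h
        rw [if_pos le_rfl, if_neg (by omega), ← hg0, show i + 1 - i = 0 + 1 by omega]
        exact hg 0 (by omega)
      · rw [if_neg (by omega), if_neg (by omega), show i + 1 - n = i - n + 1 by omega]
        exact hg _ (by omega)

theorem within_iff_exists_path {R : ℕ → ℕ → Prop} {B k u v : ℕ} (hB : B ≤ 2 ^ k) (hu : u < B)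
    (hv : v < B) : Within R B k u v ↔ ∃ n f, f 0 = u ∧ f n = v ∧ IsPath R B n f := by
  refine ⟨Within.exists_path k hv, ?_⟩
  rintro ⟨n, f, rfl, rfl, hf⟩
  obtain ⟨m, g, h1, h2, h3, h4⟩ := hf.exists_lt hu
  rw [← h2, ← h3]
  exact h4.within k (h2 ▸ hu) (by omega)

/-! ### Savitch's algorithm -/

/-- Pushes a frame on a stack that is coded by a number. -/
def pushFrame (B st u v w ph : ℕ) : ℕ := (((st * B + u) * B + v) * B + w) * 2 + ph

/-- The states of Savitch's algorithm: the mode (`0` for a call, `1` and `2` for the return values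
false and true), the level, the endpoints and the stack. -/
abbrev SavState : Type := ℕ × ℕ × ℕ × ℕ × ℕ

open scoped Classical in
/-- One step of Savitch's algorithm. -/
noncomputable def savStep (R : ℕ → ℕ → Prop) (B K : ℕ) (s : SavState) : SavState :=
  let m := s.1
  let k := s.2.1
  let u := s.2.2.1
  let v := s.2.2.2.1
  let st := s.2.2.2.2
  if m = 0 then
    if k = 0 then (if u = v ∨ R u v then 2 else 1, 0, 0, 0, st)
    else (0, k - 1, u, 0, pushFrame B st u v 0 0)
  else if k = K then s
  else if m = 2 then
    if st % 2 = 0 then (0, k, st / 2 % B, st / 2 / B % B, st + 1)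
    else (2, k + 1, 0, 0, st / 2 / B / B / B)
  else if st / 2 % B + 1 < B then
    (0, k, st / 2 / B / B % B, st / 2 % B + 1, st / 2 * 2 + 2)
  else (1, k + 1, 0, 0, st / 2 / B / B / B)

/-- The return mode for a truth value. -/
noncomputable def retMode (p : Prop) : ℕ := enc p + 1

theorem retMode_of_true {p : Prop} (h : p) : retMode p = 2 := by rw [retMode, enc_of_true h]

theorem retMode_of_false {p : Prop} (h : ¬p) : retMode p = 1 := by rw [retMode, enc_of_false h]

/-! ### Correctness and cost of Savitch's algorithm -/

/-- Bounds on the states of Savitch's algorithm. -/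
def SavOk (B K C : ℕ) (s : SavState) : Prop :=
  s.1 ≤ 2 ∧ s.2.1 ≤ K ∧ s.2.2.1 ≤ B ∧ s.2.2.2.1 ≤ B ∧ s.2.2.2.2 ≤ C

section

variable {R : ℕ → ℕ → Prop} {B K C : ℕ}

/-- The algorithm passes from `a` to `b` in at most `T` steps through bounded states. -/
def SavRun (R : ℕ → ℕ → Prop) (B K C T : ℕ) (a b : SavState) : Prop :=
  ∃ t ≤ T, (savStep R B K)^[t] a = b ∧ ∀ i ≤ t, SavOk B K C ((savStep R B K)^[i] a)

theorem SavRun.trans {T T' : ℕ} {a b c : SavState} (h : SavRun R B K C T a b)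
    (h' : SavRun R B K C T' b c) : SavRun R B K C (T + T') a c := by
  obtain ⟨t, h1, h2, h3⟩ := h
  obtain ⟨t', h1', h2', h3'⟩ := h'
  refine ⟨t + t', by omega, by rw [add_comm, iterate_add_apply, h2, h2'], fun i hi => ?_⟩
  rcases Nat.lt_or_ge i t with hit | hit
  · exact h3 i hit.le
  · obtain ⟨j, rfl⟩ := Nat.exists_eq_add_of_le hit
    rw [add_comm t j, iterate_add_apply, h2]
    exact h3' j (by omega)

theorem SavRun.step {a : SavState} (ha : SavOk B K C a) (hb : SavOk B K C (savStep R B K a)) :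
    SavRun R B K C 1 a (savStep R B K a) := by
  refine ⟨1, le_rfl, rfl, fun i hi => ?_⟩
  rcases i with - | i
  · exact ha
  · obtain rfl : i = 0 := by omega
    exact hb

theorem SavRun.mono {T T' : ℕ} (h : T ≤ T') {a b : SavState} (hr : SavRun R B K C T a b) :
    SavRun R B K C T' a b := by
  obtain ⟨t, h1, h2⟩ := hr
  exact ⟨t, h1.trans h, h2⟩

theorem pushFrame_div_two (st u v w : ℕ) {ph : ℕ} (h : ph < 2) :
    pushFrame B st u v w ph / 2 = ((st * B + u) * B + v) * B + w := by
  unfold pushFrame; omega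

theorem pushFrame_mod_two (st u v w : ℕ) {ph : ℕ} (h : ph < 2) :
    pushFrame B st u v w ph % 2 = ph := by
  unfold pushFrame; omega

theorem mul_add_div_eq {B a w : ℕ} (hw : w < B) : (a * B + w) / B = a := by
  rw [mul_comm, Nat.mul_add_div (by omega), Nat.div_eq_of_lt hw, add_zero]

theorem mul_add_mod_eq {B a w : ℕ} (hw : w < B) : (a * B + w) % B = w := by
  rw [mul_comm, Nat.mul_add_mod, Nat.mod_eq_of_lt hw]

theorem pushFrame_lt {st u v w ph : ℕ} (hu : u < B) (hv : v < B) (hw : w < B) (hph : ph < 2) :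
    pushFrame B st u v w ph < (st + 1) * (2 * B ^ 3) := by
  have h1 : st * B + u + 1 ≤ (st + 1) * B := by nlinarith
  have h2 : (st * B + u) * B + v + 1 ≤ (st + 1) * B * B := by nlinarith
  have h3 : ((st * B + u) * B + v) * B + w + 1 ≤ (st + 1) * B * B * B := by nlinarith
  have h4 : (st + 1) * (2 * B ^ 3) = ((st + 1) * B * B * B) * 2 := by ring
  unfold pushFrame
  omega

/-- Induction on the level. A call tries every midpoint, with at most two calls one level down for
each, so its time `T` satisfies `T (k + 1) ≤ 1 + B * (2 * T k + 2)`, whence `(5 * B) ^ k`. Pushing a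
frame multiplies `st + 1` by at most `2 * B ^ 3`, which gives the stack bound for `k` nested frames.
-/
theorem savRun_call (k : ℕ) : ∀ {u v st : ℕ}, k ≤ K → u < B → v < B →
    (st + 1) * (2 * B ^ 3) ^ k ≤ C →
    SavRun R B K C ((5 * B) ^ k) (0, k, u, v, st) (retMode (Within R B k u v), k, 0, 0, st) := by
  induction k with
  | zero =>
    intro u v st _ hu hv hC
    have hst : st ≤ C := by simp at hC; omega
    have hs : savStep R B K (0, 0, u, v, st) = (retMode (Within R B 0 u v), 0, 0, 0, st) := by
      by_cases h : u = v ∨ R u v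
      · rw [retMode_of_true (show Within R B 0 u v from h)]; simp [savStep, h]
      · rw [retMode_of_false (show ¬Within R B 0 u v from h)]; simp [savStep, h]
    rw [← hs, pow_zero]
    refine SavRun.step ⟨by simp, by simp, hu.le, hv.le, hst⟩ ?_
    rw [hs]
    exact ⟨by have := enc_prop_le (Within R B 0 u v); simp [retMode]; omega, by simp, by simp,
      by simp, hst⟩
  | succ k ih =>
    intro u v st hk hu hv hC
    have hB0 : 0 < B := by omega
    set D := 2 * B ^ 3 with hD
    have hD0 : 0 < D := by positivity
    have hpow : 0 < D ^ k := by positivity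
    have hpush : ∀ {w ph : ℕ}, w < B → ph < 2 →
        (pushFrame B st u v w ph + 1) * D ^ k ≤ C := fun hw hph => by
      refine le_trans ?_ hC
      rw [pow_succ', ← mul_assoc]
      exact Nat.mul_le_mul_right _ (pushFrame_lt hu hv hw hph)
    have hpushC : ∀ {w ph : ℕ}, w < B → ph < 2 → pushFrame B st u v w ph ≤ C := fun hw hph => by
      have := hpush hw hph
      nlinarith
    have hstC : st ≤ C := by
      refine le_trans ?_ hC
      rw [pow_succ]
      nlinarith [Nat.mul_le_mul (Nat.le_refl (st + 1)) (Nat.mul_le_mul hpow hD0)]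
    have hret : ∀ p, SavOk B K C (retMode p, k + 1, 0, 0, st) := fun p =>
      ⟨by have := enc_prop_le p; simp [retMode]; omega, hk, by simp, by simp, hstC⟩
    have hretk : ∀ p {w ph : ℕ}, w < B → ph < 2 →
        SavOk B K C (retMode p, k, 0, 0, pushFrame B st u v w ph) := fun p w ph hw hph =>
      ⟨by have := enc_prop_le p; simp [retMode]; omega, by simp; omega, by simp, by simp,
        hpushC hw hph⟩
    have hcall : ∀ {u' v' w ph : ℕ}, w < B → ph < 2 → u' < B → v' < B →
        SavOk B K C (0, k, u', v', pushFrame B st u v w ph) := fun hw hph hu' hv' =>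
      ⟨by simp, by simp; omega, hu'.le, hv'.le, hpushC hw hph⟩
    -- Induction on the number `n` of midpoints not yet refuted, beginning with `w`.
    have htry : ∀ n w, w < B → B - w = n → SavRun R B K C (n * (2 * (5 * B) ^ k + 2))
        (0, k, u, w, pushFrame B st u v w 0)
        (retMode (∃ w' < B, w ≤ w' ∧ Within R B k u w' ∧ Within R B k w' v), k + 1, 0, 0, st) := by
      intro n
      induction n with
      | zero => intro w hw hn; omega
      | succ n ihn =>
        intro w hw hn
        have hsucc : (n + 1) * (2 * (5 * B) ^ k + 2) =
            n * (2 * (5 * B) ^ k + 2) + (2 * (5 * B) ^ k + 2) := Nat.succ_mul _ _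
        -- Either half may fail, so the frame can have either phase; in both cases the search passes
        -- to `w + 1`, or returns false when the midpoints are used up.
        have hfail : ∀ ph < 2, ¬(Within R B k u w ∧ Within R B k w v) →
            SavRun R B K C (n * (2 * (5 * B) ^ k + 2) + 1)
              (1, k, 0, 0, pushFrame B st u v w ph)
              (retMode (∃ w' < B, w ≤ w' ∧ Within R B k u w' ∧ Within R B k w' v),
                k + 1, 0, 0, st) := by
          intro ph hph hno
          have hiff : (∃ w' < B, w ≤ w' ∧ Within R B k u w' ∧ Within R B k w' v) ↔
              ∃ w' < B, w + 1 ≤ w' ∧ Within R B k u w' ∧ Within R B k w' v := by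
            refine exists_congr fun w' => and_congr_right fun _ => ⟨?_, fun h => ⟨by omega, h.2⟩⟩
            rintro ⟨h1, h2⟩
            refine ⟨lt_of_le_of_ne h1 ?_, h2⟩
            rintro rfl
            exact hno h2
          have hok := hretk False hw hph
          rw [retMode_of_false (fun h => h)] at hok
          by_cases hw1 : w + 1 < B
          · have hs : savStep R B K (1, k, 0, 0, pushFrame B st u v w ph) =
                (0, k, u, w + 1, pushFrame B st u v (w + 1) 0) := by
              -- The midpoint is the lowest digit above the phase bit: adding two increases it, and
              -- halving and doubling first clears the phase.
              have hx : pushFrame B st u v (w + 1) 0 = pushFrame B st u v w ph / 2 * 2 + 2 := by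
                rw [pushFrame_div_two _ _ _ _ hph]; unfold pushFrame; ring
              simp only [savStep, hx, pushFrame_div_two st u v w hph, mul_add_div_eq hw,
                mul_add_div_eq hv, mul_add_mod_eq hw, mul_add_mod_eq hu]
              simp [hw1, show k ≠ K by omega]
            have h1 := SavRun.step hok (R := R) (by
              rw [hs]; exact hcall hw1 (by omega) hu hw1)
            rw [hs] at h1
            have hn' : B - (w + 1) = n := by rw [← Nat.sub_sub, hn]; rfl
            rw [hiff, add_comm]
            exact h1.trans (ihn (w + 1) hw1 hn')
          · have hs : savStep R B K (1, k, 0, 0, pushFrame B st u v w ph) =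
                (1, k + 1, 0, 0, st) := by
              simp only [savStep, pushFrame_div_two st u v w hph, mul_add_div_eq hw,
                mul_add_div_eq hv, mul_add_div_eq hu, mul_add_mod_eq hw]
              simp [hw1, show k ≠ K by omega]
            have hn0 : ¬∃ w' < B, w + 1 ≤ w' ∧ Within R B k u w' ∧ Within R B k w' v := by
              rintro ⟨w', h1, h2, -⟩; omega
            rw [hiff]
            have hok' := hret (∃ w' < B, w + 1 ≤ w' ∧ Within R B k u w' ∧ Within R B k w' v)
            rw [retMode_of_false hn0] at hok' ⊢
            have h1 := SavRun.step hok (R := R) (by rw [hs]; exact hok')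
            rw [hs] at h1
            exact h1.mono (by omega)
        have h1 := ih (u := u) (v := w) (by omega) hu hw (hpush hw (by omega : 0 < 2))
        by_cases hw1 : Within R B k u w
        · rw [retMode_of_true hw1] at h1
          have hs : savStep R B K (2, k, 0, 0, pushFrame B st u v w 0) =
              (0, k, w, v, pushFrame B st u v w 1) := by
            have hx : pushFrame B st u v w 1 = pushFrame B st u v w 0 + 1 := by
              unfold pushFrame; ring
            simp only [savStep, hx, pushFrame_div_two st u v w (by omega : 0 < 2),
              pushFrame_mod_two st u v w (by omega : 0 < 2), mul_add_div_eq hw, mul_add_mod_eq hw,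
              mul_add_mod_eq hv]
            simp [show k ≠ K by omega]
          have h2 := SavRun.step (R := R) (B := B) (K := K) (C := C)
            (a := (2, k, 0, 0, pushFrame B st u v w 0))
            (by rw [← retMode_of_true hw1]; exact hretk _ hw (by omega))
            (by rw [hs]; exact hcall hw (by omega) hw hv)
          rw [hs] at h2
          have h3 := ih (u := w) (v := v) (by omega) hw hv (hpush hw (by omega : 1 < 2))
          by_cases hw2 : Within R B k w v
          · rw [retMode_of_true hw2] at h3
            rw [retMode_of_true ⟨w, hw, le_rfl, hw1, hw2⟩]
            have hs : savStep R B K (2, k, 0, 0, pushFrame B st u v w 1) =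
                (2, k + 1, 0, 0, st) := by
              simp only [savStep, pushFrame_div_two st u v w (by omega : 1 < 2),
                pushFrame_mod_two st u v w (by omega : 1 < 2), mul_add_div_eq hw,
                mul_add_div_eq hv, mul_add_div_eq hu]
              simp [show k ≠ K by omega]
            have h4 := SavRun.step (R := R) (B := B) (K := K) (C := C)
              (a := (2, k, 0, 0, pushFrame B st u v w 1))
              (by rw [← retMode_of_true hw2]; exact hretk _ hw (by omega))
              (by rw [hs, ← retMode_of_true hw2]; exact hret _)
            rw [hs] at h4
            exact (((h1.trans h2).trans h3).trans h4).mono (by rw [hsucc]; omega)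
          · rw [retMode_of_false hw2] at h3
            exact (((h1.trans h2).trans h3).trans (hfail 1 (by omega) fun h => hw2 h.2)).mono
              (by rw [hsucc]; omega)
        · rw [retMode_of_false hw1] at h1
          exact (h1.trans (hfail 0 (by omega) fun h => hw1 h.1)).mono
            (by rw [hsucc]; omega)
    have hs : savStep R B K (0, k + 1, u, v, st) = (0, k, u, 0, pushFrame B st u v 0 0) := by
      simp [savStep]
    have h1 := SavRun.step (R := R) (B := B) (K := K) (C := C) (a := (0, k + 1, u, v, st))
      ⟨by simp, hk, hu.le, hv.le, hstC⟩ (by rw [hs]; exact hcall hB0 (by omega) hu hB0)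
    rw [hs] at h1
    have h2 := h1.trans (htry B 0 hB0 (by omega))
    have hiff : (∃ w' < B, 0 ≤ w' ∧ Within R B k u w' ∧ Within R B k w' v) ↔
        Within R B (k + 1) u v := by simp [Within]
    rw [hiff] at h2
    refine h2.mono ?_
    have h3 : 1 ≤ (5 * B) ^ k := Nat.one_le_pow _ _ (by omega)
    rw [pow_succ]
    nlinarith

/-- Savitch's algorithm, with a bound on the codes of its states and on its running time. -/
def SavReach (R : ℕ → ℕ → Prop) (B K cap u v : ℕ) : Prop :=
  (clampIter cap (savStep R B K) cap (0, K, u, v, 0)).1 = 2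

/-- The number `cap` serves both as the clamp on the codes of states and as the number of steps.
Running for too long does no harm, since a return at the top level is a fixed point. -/
theorem savReach_iff {cap u v : ℕ} (hu : u < B) (hv : v < B) (h1 : (5 * B) ^ K ≤ cap)
    (h2 : pack 2 (pack K (pack B (pack B ((2 * B ^ 3) ^ K)))) ≤ cap) :
    SavReach R B K cap u v ↔ Within R B K u v := by
  obtain ⟨t, ht, hrun, hok⟩ := savRun_call (R := R) (K := K) (C := (2 * B ^ 3) ^ K) K
    (st := 0) le_rfl hu hv (by simp)
  have hfix : ∀ p : Prop, savStep R B K (retMode p, K, 0, 0, 0) = (retMode p, K, 0, 0, 0) := by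
    intro p
    have : retMode p ≠ 0 := by simp [retMode]
    simp [savStep, this]
  have hstay : ∀ i, t ≤ i → (savStep R B K)^[i] (0, K, u, v, 0) =
      (retMode (Within R B K u v), K, 0, 0, 0) := by
    intro i hi
    obtain ⟨j, rfl⟩ := Nat.exists_eq_add_of_le hi
    rw [add_comm, iterate_add_apply, hrun]
    exact iterate_fixed (hfix _) j
  have hall : ∀ i, SavOk B K ((2 * B ^ 3) ^ K) ((savStep R B K)^[i] (0, K, u, v, 0)) := by
    intro i
    rcases Nat.lt_or_ge i t with hi | hi
    · exact hok i hi.le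
    · rw [hstay i hi, ← hrun]; exact hok t le_rfl
  unfold SavReach
  rw [clampIter_eq fun i _ => ?_, hstay cap (by omega)]
  · by_cases h : Within R B K u v
    · exact ⟨fun _ => h, fun _ => retMode_of_true h⟩
    · rw [retMode_of_false h]; simp [h]
  · obtain ⟨h3, h4, h5, h6, h7⟩ := hall (i + 1)
    exact le_trans (pack_mono h3 (pack_mono h4 (pack_mono h5 (pack_mono h6 h7)))) h2

end

@[fun_prop]
theorem Cmp.savReach {E : Type} [Code E] {R : E → ℕ → ℕ → Prop} {B K cap u v : E → ℕ}
    (hR : Cmp fun p : E × (ℕ × ℕ) => R p.1 p.2.1 p.2.2) (hB : Cmp B) (hK : Cmp K) (hc : Cmp cap)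
    (hu : Cmp u) (hv : Cmp v) : Cmp fun e => SavReach (R e) (B e) (K e) (cap e) (u e) (v e) := by
  classical
  have hR' : Cmp fun p : E × SavState => R p.1 p.2.2.2.1 p.2.2.2.2.1 :=
    hR.comp (f := fun p : E × SavState => (p.1, (p.2.2.2.1, p.2.2.2.2.1))) (by fun_prop)
  have : Cmp fun e => RegAbs.clampIter (cap e) (savStep (R e) (B e) (K e)) (cap e)
      (0, K e, u e, v e, 0) := by
    refine Cmp.clampIter hc ?_ hc (by fun_prop)
    unfold savStep pushFrame
    fun_prop
  unfold SavReach
  fun_prop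

end RegAbs

namespace RegAbs

/-! ### Runs of automata on padded words -/

open Function

/-- The number of a padded letter; the padding symbol has number `0`. -/
def letterNum {n : ℕ} : Option (Fin n) → ℕ
  | none => 0
  | some a => a + 1

theorem letterNum_injective {n : ℕ} : Injective (letterNum (n := n)) := by
  rintro (_ | a) (_ | b) h <;> simp [letterNum, Fin.ext_iff] at h ⊢
  exact h

/-- The number of the letter at position `i`, and `0` beyond the end of the word. -/
def letterAt {n : ℕ} (u : List (Fin n)) (i : ℕ) : ℕ := letterNum u[i]?

theorem letterAt_eq_zero {n : ℕ} {u : List (Fin n)} {i : ℕ} : letterAt u i = 0 ↔ u.length ≤ i := by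
  unfold letterAt
  cases h : u[i]? with
  | none => simpa [letterNum] using h
  | some a =>
    obtain ⟨h, -⟩ := List.getElem?_eq_some_iff.1 h
    simp [letterNum, h]

theorem letterAt_le {n : ℕ} (u : List (Fin n)) (i : ℕ) : letterAt u i ≤ n := by
  unfold letterAt
  cases u[i]? with
  | none => simp [letterNum]
  | some a => simp [letterNum]

/-- A sequence of numbers of padded letters is given by a word. -/
theorem exists_letterAt {n m : ℕ} {a : ℕ → ℕ} (h1 : ∀ i < m, a i ≤ n)
    (h2 : ∀ i, i + 1 < m → a i = 0 → a (i + 1) = 0) :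
    ∃ u : List (Fin n), u.length ≤ m ∧ ∀ i < m, letterAt u i = a i := by
  induction m generalizing a with
  | zero => exact ⟨[], by simp, by simp⟩
  | succ m ih =>
    obtain ⟨u, hu, hua⟩ := ih (a := fun i => a (i + 1)) (fun i hi => h1 _ (by omega))
      (fun i hi => h2 _ (by omega))
    by_cases h0 : a 0 = 0
    · refine ⟨[], by simp, fun i hi => ?_⟩
      have : ∀ i < m + 1, a i = 0 := by
        intro i
        induction i with
        | zero => exact fun _ => h0
        | succ i ih => exact fun hi => h2 i hi (ih (by omega))
      rw [this i hi]
      simp [letterAt, letterNum]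
    · have := h1 0 (by omega)
      refine ⟨⟨a 0 - 1, by omega⟩ :: u, by simpa using hu, fun i hi => ?_⟩
      rcases i with - | i
      · simp [letterAt, letterNum]; omega
      · rw [← hua i (by omega)]
        simp [letterAt]

/-- Runs may be prolonged beyond the word by standing still. This lets automata on words of
different lengths run in lockstep over a common length `L`. -/
theorem mem_acceptsFrom_iff {α : Type} {n : ℕ} (M : NFA α (Fin n)) (v : List α) :
    ∀ (S : Set (Fin n)) (L : ℕ), v.length ≤ L → ((∃ q ∈ M.accept, q ∈ M.evalFrom S v) ↔
      ∃ r : ℕ → ℕ, (∃ q ∈ S, r 0 = q) ∧ (∀ i < L, (v[i]? = none ∧ r i = r (i + 1)) ∨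
        ∃ a, v[i]? = some a ∧ ∃ q q' : Fin n, r i = q ∧ r (i + 1) = q' ∧ q' ∈ M.step q a) ∧
      ∃ q ∈ M.accept, r L = q) := by
  induction v with
  | nil =>
    intro S L _
    constructor
    · rintro ⟨q, h1, h2⟩
      exact ⟨fun _ => q, ⟨q, h2, rfl⟩, fun i _ => Or.inl ⟨by simp, rfl⟩, q, h1, rfl⟩
    · rintro ⟨r, ⟨q, hq, h0⟩, hr, q', hq', hL⟩
      have : ∀ i ≤ L, r i = r 0 := by
        intro i
        induction i with
        | zero => simp
        | succ i ih =>
          intro hi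
          rcases hr i (by omega) with h | ⟨a, h, -⟩
          · rw [← h.2, ih (by omega)]
          · simp at h
      have hqq : q = q' := Fin.ext (by rw [← h0, ← hL, this L le_rfl])
      exact ⟨q, hqq ▸ hq', hq⟩
  | cons a v ih =>
    intro S L hL
    obtain ⟨L, rfl⟩ : ∃ L', L = L' + 1 := ⟨L - 1, by simp at hL; omega⟩
    rw [NFA.evalFrom_cons, ih _ L (by simpa using hL)]
    constructor
    · rintro ⟨r, ⟨q, hq, h0⟩, hr, hacc⟩
      obtain ⟨q0, hq0, hq⟩ := NFA.mem_stepSet.1 hq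
      refine ⟨fun i => i.casesOn q0 r, ⟨q0, hq0, rfl⟩, fun i hi => ?_, hacc⟩
      rcases i with - | i
      · exact Or.inr ⟨a, rfl, q0, q, rfl, h0, hq⟩
      · simpa using hr i (by omega)
    · rintro ⟨r, ⟨q, hq, h0⟩, hr, hacc⟩
      refine ⟨fun i => r (i + 1), ?_, fun i hi => by simpa using hr (i + 1) (by omega), hacc⟩
      rcases hr 0 (by omega) with h | ⟨b, hb, q1, q2, h1, h2, h3⟩
      · simp at h
      · obtain rfl : a = b := by simpa using hb
        obtain rfl : q = q1 := Fin.ext (by rw [← h0, h1])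
        exact ⟨q2, NFA.mem_stepSet.2 ⟨q, hq, h3⟩, h2⟩

/-- The padded transition relation of a transducer, which stays in its state on two padding
symbols. -/
def pad₂ (d : ℕ → ℕ → ℕ → ℕ → Prop) (q a b r : ℕ) : Prop :=
  (a = 0 ∧ b = 0 ∧ q = r) ∨ (¬(a = 0 ∧ b = 0) ∧ d q a b r)

/-- The padded transition relation of an automaton, which stays in its state on the padding
symbol. -/
def pad₁ (d : ℕ → ℕ → ℕ → Prop) (q a r : ℕ) : Prop :=
  (a = 0 ∧ q = r) ∨ (a ≠ 0 ∧ d q a r)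

/-- The states in a set, as numbers. -/
def stateNum {n : ℕ} (S : Set (Fin n)) (q : ℕ) : Prop := ∃ r ∈ S, q = (r : ℕ)

/-- The transition relation of a transducer, in terms of the numbers of states and letters. -/
def stepNum₂ {k l n : ℕ} (M : NFA (Option (Fin k) × Option (Fin l)) (Fin n))
    (q a b q' : ℕ) : Prop :=
  ∃ (p p' : Fin n) (x : Option (Fin k)) (y : Option (Fin l)), q = p ∧ a = letterNum x ∧
    b = letterNum y ∧ q' = p' ∧ p' ∈ M.step p (x, y)

/-- The transition relation of an automaton, in terms of the numbers of states and letters. -/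
def stepNum₁ {k n : ℕ} (M : NFA (Fin k) (Fin n)) (q a q' : ℕ) : Prop :=
  ∃ (p p' : Fin n) (x : Fin k), q = p ∧ a = letterNum (some x) ∧ q' = p' ∧ p' ∈ M.step p x

/-- A run of length `L` of a transducer on two sequences of letters. -/
def Run₂ (d : ℕ → ℕ → ℕ → ℕ → Prop) (s : ℕ → Prop) (L : ℕ) (a b r : ℕ → ℕ) : Prop :=
  s (r 0) ∧ ∀ i < L, pad₂ d (r i) (a i) (b i) (r (i + 1))

/-- A run of length `L` of an automaton on a sequence of letters. -/
def Run₁ (d : ℕ → ℕ → ℕ → Prop) (s : ℕ → Prop) (L : ℕ) (a r : ℕ → ℕ) : Prop :=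
  s (r 0) ∧ ∀ i < L, pad₁ d (r i) (a i) (r (i + 1))

theorem getElem?_convolution {α β : Type} (u : List α) (w : List β) (i : ℕ) :
    (convolution u w)[i]? = if u[i]? = none ∧ w[i]? = none then none else some (u[i]?, w[i]?) := by
  unfold convolution
  induction u generalizing w i with
  | nil => cases h : w[i]? <;> simp [List.zipWithAll, h]
  | cons a u ih =>
    cases w with
    | nil =>
      rw [List.zipWithAll_nil, List.getElem?_map]
      cases (a :: u)[i]? <;> simp
    | cons b w =>
      cases i with
      | zero => simp [List.zipWithAll]
      | succ i => simpa [List.zipWithAll] using ih w i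

theorem length_convolution_le {α β : Type} {u : List α} {w : List β} {L : ℕ} (hu : u.length ≤ L)
    (hw : w.length ≤ L) : (convolution u w).length ≤ L := by
  by_contra h
  have := getElem?_convolution u w L
  rw [List.getElem?_eq_none hu, List.getElem?_eq_none hw] at this
  simp at this
  omega

theorem convolution_mem_accepts_iff {k l n : ℕ}
    (M : NFA (Option (Fin k) × Option (Fin l)) (Fin n)) {u : List (Fin k)} {w : List (Fin l)}
    {L : ℕ} (hu : u.length ≤ L) (hw : w.length ≤ L) :
    convolution u w ∈ M.accepts ↔ ∃ r, Run₂ (stepNum₂ M) (stateNum M.start) L (letterAt u)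
      (letterAt w) r ∧ stateNum M.accept (r L) := by
  rw [NFA.mem_accepts, mem_acceptsFrom_iff M _ _ L (length_convolution_le hu hw)]
  refine exists_congr fun r => ?_
  rw [← and_assoc]
  refine and_congr (and_congr Iff.rfl (forall₂_congr fun i _ => ?_)) Iff.rfl
  rw [getElem?_convolution]
  unfold pad₂ letterAt
  by_cases h : u[i]? = none ∧ w[i]? = none
  · simp [h.1, h.2, letterNum]
  · have h' : ¬(letterNum u[i]? = 0 ∧ letterNum w[i]? = 0) := by
      rintro ⟨h1, h2⟩
      -- Only a pair of two padding symbols lies beyond the convolution; a single one is a genuine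
      -- letter.
      exact h ⟨letterNum_injective (a₂ := none) h1, letterNum_injective (a₂ := none) h2⟩
    rw [if_neg h]
    constructor
    · rintro (⟨h1, -⟩ | ⟨a, ha, q, q', h1, h2, h3⟩)
      · simp at h1
      · refine Or.inr ⟨h', q, q', u[i]?, w[i]?, h1, rfl, rfl, h2, ?_⟩
        rw [Option.some.injEq] at ha
        rwa [ha]
    · rintro (⟨h1, h2, -⟩ | ⟨-, q, q', x, y, h1, h2, h3, h4, h5⟩)
      · exact absurd ⟨h1, h2⟩ h'
      · rw [letterNum_injective h2, letterNum_injective h3]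
        exact Or.inr ⟨_, rfl, q, q', h1, h4, h5⟩

theorem mem_accepts_iff_run {k n : ℕ} (M : NFA (Fin k) (Fin n)) {u : List (Fin k)} {L : ℕ}
    (hu : u.length ≤ L) : u ∈ M.accepts ↔ ∃ r, Run₁ (stepNum₁ M) (stateNum M.start) L
      (letterAt u) r ∧ stateNum M.accept (r L) := by
  rw [NFA.mem_accepts, mem_acceptsFrom_iff M _ _ L hu]
  refine exists_congr fun r => ?_
  rw [← and_assoc]
  refine and_congr (and_congr Iff.rfl (forall₂_congr fun i _ => ?_)) Iff.rfl
  unfold pad₁ letterAt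
  cases h : u[i]? with
  | none => simp [letterNum]
  | some a =>
    constructor
    · rintro (⟨h1, -⟩ | ⟨b, hb, q, q', h1, h2, h3⟩)
      · simp at h1
      · obtain rfl : a = b := by simpa using hb
        exact Or.inr ⟨by simp [letterNum], q, q', a, h1, rfl, h2, h3⟩
    · rintro (⟨h1, -⟩ | ⟨-, q, q', x, h1, h2, h3, h4⟩)
      · simp [letterNum] at h1
      · obtain rfl : a = x := by simpa using letterNum_injective h2
        exact Or.inr ⟨_, rfl, q, q', h1, h3, h4⟩

/-- Here determinism of the interpretation enters: complementing the final states complements the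
language, so rejection too is the existence of a run. -/
theorem convolution_not_mem_accepts_iff {k l n : ℕ}
    (M : DFA (Option (Fin k) × Option (Fin l)) (Fin n)) {u : List (Fin k)} {w : List (Fin l)}
    {L : ℕ} (hu : u.length ≤ L) (hw : w.length ≤ L) :
    convolution u w ∉ M.toNFA.accepts ↔ ∃ r, Run₂ (stepNum₂ M.toNFA) (stateNum M.toNFA.start) L
      (letterAt u) (letterAt w) r ∧ stateNum M.acceptᶜ (r L) := by
  have h := convolution_mem_accepts_iff
    (⟨M.step, M.start, M.acceptᶜ⟩ : DFA _ (Fin n)).toNFA hu hw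
  rw [DFA.toNFA_correct] at h ⊢
  exact h

/-! ### Sets of numbers as bit vectors -/

theorem exists_hasBit_iff (m : ℕ) (P : ℕ → Prop) : ∃ X < 2 ^ m, ∀ i < m, HasBit X i ↔ P i := by
  classical
  refine ⟨Nat.ofBits (n := m) fun i => decide (P i), Nat.ofBits_lt_two_pow _, fun i hi => ?_⟩
  simp [HasBit, Nat.testBit_ofBits_lt _ _ hi]

/-- The set with bit vector `Y` contains the successors of the set with bit vector `X`. -/
def ClosedBits (m : ℕ) (R : ℕ → ℕ → Prop) (X Y : ℕ) : Prop :=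
  AllB m fun t => AllB m fun u => ¬(HasBit X t ∧ R t u ∧ ¬HasBit Y u)

/-- The set with bit vector `X` contains all numbers with the property `P`. -/
def CoversBits (m : ℕ) (P : ℕ → Prop) (X : ℕ) : Prop := AllB m fun t => ¬(P t ∧ ¬HasBit X t)

/-- The set with bit vector `X` contains no number with the property `P`. -/
def AvoidsBits (m : ℕ) (P : ℕ → Prop) (X : ℕ) : Prop := AllB m fun t => ¬(HasBit X t ∧ P t)

/-- A sequence of sets of numbers below `m`, given by bit vectors, that contain the initial states
of a nondeterministic system, are closed under its transitions, and contain no bad state at time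
`L` or later. -/
def IsCertificate (m L : ℕ) (init : ℕ → Prop) (step : ℕ → ℕ → ℕ → Prop) (tail : ℕ → ℕ → Prop)
    (bad : ℕ → Prop) (X : ℕ → ℕ) : Prop :=
  CoversBits m init (X 0) ∧ (∀ i < L, ClosedBits m (step i) (X i) (X (i + 1))) ∧
    ClosedBits m tail (X L) (X L) ∧ AvoidsBits m bad (X L)

section

variable {m L : ℕ} {init bad : ℕ → Prop} {step : ℕ → ℕ → ℕ → Prop} {tail : ℕ → ℕ → Prop}
  (htail : ∀ i, L ≤ i → ∀ t t', step i t t' ↔ tail t t')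

include htail

/-- If there is a certificate then no run ends in a bad state. -/
theorem IsCertificate.not_bad {X : ℕ → ℕ} (hX : IsCertificate m L init step tail bad X) {n : ℕ}
    (hn : L ≤ n) {r : ℕ → ℕ} (hr0 : init (r 0)) (hr : ∀ i < n, step i (r i) (r (i + 1)))
    (hm : ∀ i ≤ n, r i < m) : ¬bad (r n) := by
  simp only [IsCertificate, CoversBits, ClosedBits, AvoidsBits, AllB, not_and, not_not] at hX
  obtain ⟨h1, h2, h3, h4⟩ := hX
  -- From time `L` on all steps are tail steps, and the run stays inside the last set.
  have key : ∀ i ≤ n, HasBit (X (min i L)) (r i) := by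
    intro i
    induction i with
    | zero => intro _; simpa using h1 _ (hm 0 (by omega)) hr0
    | succ i ih =>
      intro hi
      have hi' := ih (by omega)
      have hs := hr i (by omega)
      rcases Nat.lt_or_ge i L with hL | hL
      · rw [min_eq_left (by omega)] at hi' ⊢
        exact h2 i hL _ (hm i (by omega)) _ (hm _ hi) hi' hs
      · rw [min_eq_right (by omega)] at hi' ⊢
        exact h3 _ (hm i (by omega)) _ (hm _ hi) hi' ((htail i hL _ _).1 hs)
  have := key n le_rfl
  rw [min_eq_right hn] at this
  exact h4 _ (hm n le_rfl) this

/-- If no run ends in a bad state then there is a certificate. -/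
theorem exists_isCertificate (h : ∀ n, L ≤ n → ∀ r : ℕ → ℕ, init (r 0) →
    (∀ i < n, step i (r i) (r (i + 1))) → (∀ i ≤ n, r i < m) → ¬bad (r n)) :
    ∃ X : ℕ → ℕ, (∀ i, X i < 2 ^ m) ∧ IsCertificate m L init step tail bad X := by
  simp only [IsCertificate, CoversBits, ClosedBits, AvoidsBits, AllB, not_and, not_not]
  set P : ℕ → ℕ → Prop := fun n t => ∃ r : ℕ → ℕ, init (r 0) ∧
    (∀ i < n, step i (r i) (r (i + 1))) ∧ (∀ i ≤ n, r i < m) ∧ r n = t with hP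
  have hsucc : ∀ n t t', P n t → t' < m → step n t t' → P (n + 1) t' := by
    rintro n t t' ⟨r, h1, h2, h3, rfl⟩ ht' hs
    refine ⟨fun i => if i ≤ n then r i else t', by simpa using h1, fun i hi => ?_, fun i hi => ?_,
      by simp⟩
    · rcases Nat.lt_succ_iff_lt_or_eq.1 hi with hi | rfl
      · simpa [hi.le, show i + 1 ≤ n by omega] using h2 i hi
      · simpa using hs
    · beta_reduce
      split_ifs with h
      · exact h3 i h
      · exact ht'
  -- Before `L` the set consists of the states reachable in exactly `i` steps. At `L` it collects
  -- the states reachable at any later time too, because the runs to be excluded have no bound on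
  -- their length.
  choose X hX1 hX2 using fun i => exists_hasBit_iff m fun t =>
    (i < L ∧ P i t) ∨ (L ≤ i ∧ ∃ n, L ≤ n ∧ P n t)
  refine ⟨X, hX1, fun t ht hi => ?_, fun i hi t ht t' ht' hb hs => ?_,
    fun t ht t' ht' hb hs => ?_, fun t ht hb => ?_⟩
  · have hP0 : P 0 t := ⟨fun _ => t, hi, by simp, fun _ _ => ht, rfl⟩
    rw [hX2 _ _ ht]
    rcases Nat.eq_zero_or_pos L with hL | hL
    · exact Or.inr ⟨by omega, 0, by omega, hP0⟩
    · exact Or.inl ⟨hL, hP0⟩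
  · rw [hX2 _ _ ht] at hb
    rw [hX2 _ _ ht']
    rcases hb with ⟨-, hb⟩ | hb
    · have := hsucc i t t' hb ht' hs
      rcases Nat.lt_or_ge (i + 1) L with hL | hL
      · exact Or.inl ⟨hL, this⟩
      · exact Or.inr ⟨hL, _, hL, this⟩
    · omega
  · rw [hX2 _ _ ht] at hb
    rw [hX2 _ _ ht']
    rcases hb with hb | ⟨-, n, hn, hb⟩
    · omega
    · exact Or.inr ⟨le_rfl, n + 1, by omega, hsucc n t t' hb ht' ((htail n hn _ _).2 hs)⟩
  · rw [hX2 _ _ ht] at hb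
    rcases hb with hb | ⟨-, n, hn, r, h1, h2, h3, rfl⟩
    · omega
    · exact h n hn r h1 h2 h3

end

end RegAbs

namespace RegAbs

/-! ### Reading bit strings -/

open Function

/-- The number of the word that remains when `i` letters are dropped. -/
def dropNum (x i : ℕ) : ℕ := clampIter x (fun y => (y - 1) / 2) i x

/-- The letter at position `i` is `true`. -/
def BitAt (x i : ℕ) : Prop := dropNum x i ≠ 0 ∧ dropNum x i % 2 = 0

/-- The length of the word with number `x`. -/
noncomputable def lenNum (x : ℕ) : ℕ := bfind (x + 1) fun i => dropNum x i = 0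

theorem dropNum_bijVal (w : List Bool) (i : ℕ) : dropNum (bijVal w) i = bijVal (w.drop i) := by
  have h1 : ∀ l : List Bool, (bijVal l - 1) / 2 = bijVal l.tail := by
    rintro (_ | ⟨b, l⟩)
    · simp [bijVal]
    · cases b <;> simp [bijVal]; omega
  have h2 : ∀ i, (fun y => (y - 1) / 2)^[i] (bijVal w) = bijVal (w.drop i) := by
    intro i
    induction i with
    | zero => simp
    | succ i ih => rw [iterate_succ_apply', ih, h1, List.tail_drop]
  have h3 : ∀ i, bijVal (w.drop i) ≤ bijVal w := by
    intro i
    induction i with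
    | zero => simp
    | succ i ih => rw [← List.tail_drop, ← h1]; omega
  unfold dropNum
  rw [clampIter_eq fun i _ => ?_, h2]
  rw [h2]
  exact h3 _

/-- The first letter of a nonempty word is `true`, the digit two, iff its number is even; zero is
even as well but stands for the empty word. -/
theorem bitAt_bijVal {w : List Bool} {i : ℕ} : BitAt (bijVal w) i ↔ w[i]? = some true := by
  unfold BitAt
  rw [dropNum_bijVal]
  have h : w[i]? = (w.drop i)[0]? := by simp
  rw [h]
  rcases w.drop i with _ | ⟨b, l⟩
  · simp [bijVal]
  · cases b <;> simp [bijVal]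

theorem lenNum_bijVal (w : List Bool) : lenNum (bijVal w) = w.length := by
  have h : ∀ l : List Bool, bijVal l = 0 ↔ l = [] := by
    rintro (_ | ⟨b, l⟩)
    · simp [bijVal]
    · cases b <;> simp [bijVal]
  refine bfind_eq ?_ (fun j hj => ?_) ?_
  · have := two_pow_length_le_bijVal w
    have := Nat.lt_two_pow_self (n := w.length)
    omega
  · rw [dropNum_bijVal, h, List.drop_eq_nil_iff]; omega
  · rw [dropNum_bijVal, h, List.drop_eq_nil_iff]

theorem append_prefix_drop_iff {α : Type} {u v w : List α} {o : ℕ} :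
    u ++ v <+: w.drop o ↔ u <+: w.drop o ∧ v <+: w.drop (o + u.length) := by
  constructor
  · rintro ⟨t, ht⟩
    refine ⟨⟨v ++ t, by simpa using ht⟩, t, ?_⟩
    rw [← List.drop_drop, ← ht, List.append_assoc, List.drop_left]
  · rintro ⟨⟨t, ht⟩, s, hs⟩
    rw [← List.drop_drop, ← ht, List.drop_left] at hs
    exact ⟨s, by rw [List.append_assoc, hs, ht]⟩

theorem map_prefix_drop_iff {α : Type} {l : List α} {f : α → Bool} {w : List Bool} {o : ℕ}
    (h : o + l.length ≤ w.length) :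
    l.map f <+: w.drop o ↔ ∀ i a, l[i]? = some a → (BitAt (bijVal w) (o + i) ↔ f a = true) := by
  rw [List.prefix_iff_getElem?]
  simp only [bitAt_bijVal, List.getElem?_drop, List.length_map, List.getElem_map]
  constructor
  · intro h' i a hi
    obtain ⟨hl, rfl⟩ := List.getElem?_eq_some_iff.1 hi
    rw [h' i hl]
    simp
  · intro h' i hi
    have := h' i _ (List.getElem?_eq_getElem hi)
    rw [List.getElem?_eq_getElem (show o + i < w.length by omega)] at this ⊢
    rw [Option.some.injEq] at this ⊢
    exact Bool.eq_iff_iff.2 this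

/-- The word has a number in unary at position `o`. -/
def UnaryAt (x o n : ℕ) : Prop := AllB n (fun i => BitAt x (o + i)) ∧ ¬BitAt x (o + n)

theorem length_encodeUnary (n : ℕ) : (encodeUnary n).length = n + 1 := by simp [encodeUnary]

theorem encodeUnary_prefix_drop_iff {n o : ℕ} {w : List Bool} (h : o + (n + 1) ≤ w.length) :
    encodeUnary n <+: w.drop o ↔ UnaryAt (bijVal w) o n := by
  have h1 : List.replicate n true = (List.replicate n ()).map fun _ => true := by simp
  have h2 : [false] = [()].map fun _ => false := rfl
  unfold encodeUnary UnaryAt AllB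
  rw [append_prefix_drop_iff, h1, h2, map_prefix_drop_iff (by simp; omega),
    map_prefix_drop_iff (by simp; omega)]
  refine and_congr ?_ ?_
  · simp [List.getElem?_replicate]
  · constructor
    · intro h
      simpa using h 0 () rfl
    · rintro h (_ | i) a ha
      · simpa using h
      · simp at ha

/-- The letters of a list are numbered by their positions. -/
def IsIndex {α : Type} (l : List α) (f : α → ℕ) : Prop := ∀ i a, l[i]? = some a ↔ i = f a

theorem isIndex_finRange (n : ℕ) : IsIndex (List.finRange n) fun q => (q : ℕ) := by
  intro i q
  rw [List.getElem?_eq_some_iff]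
  constructor
  · rintro ⟨h, rfl⟩; simp
  · rintro rfl; exact ⟨by simp, by simp⟩

theorem isIndex_paddedLetters (n : ℕ) : IsIndex (paddedLetters n) letterNum := by
  rintro (_ | i) a
  · cases a <;> simp [paddedLetters, letterNum]
  · have := isIndex_finRange n i
    cases a with
    | none => simp [paddedLetters, letterNum]
    | some a => simpa [paddedLetters, letterNum] using this a

theorem getElem?_product {α β : Type} (l₁ : List α) {l₂ : List β} (h : 0 < l₂.length) :
    ∀ (i : ℕ) (p : α × β), (l₁ ×ˢ l₂)[i]? = some p ↔
      l₁[i / l₂.length]? = some p.1 ∧ l₂[i % l₂.length]? = some p.2 := by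
  induction l₁ with
  | nil => simp
  | cons a l₁ ih =>
    rintro i ⟨b, c⟩
    rw [List.product_cons]
    rcases Nat.lt_or_ge i l₂.length with hi | hi
    · rw [List.getElem?_append_left (by simpa using hi), Nat.div_eq_of_lt hi, Nat.mod_eq_of_lt hi]
      simp [List.getElem?_map, List.getElem?_eq_getElem hi]
    · obtain ⟨i, rfl⟩ := Nat.exists_eq_add_of_le hi
      rw [List.getElem?_append_right (by simp), List.length_map, Nat.add_sub_cancel_left, ih,
        Nat.add_div_left _ h, Nat.add_mod_left]
      simp

theorem IsIndex.product {α β : Type} {l₁ : List α} {l₂ : List β} {f : α → ℕ} {g : β → ℕ}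
    (hf : IsIndex l₁ f) (hg : IsIndex l₂ g) :
    IsIndex (l₁ ×ˢ l₂) fun p => f p.1 * l₂.length + g p.2 := by
  rintro i ⟨a, b⟩
  obtain ⟨h, -⟩ := List.getElem?_eq_some_iff.1 ((hg (g b) b).2 rfl)
  rw [getElem?_product l₁ (by omega), hf, hg]
  constructor
  · rintro ⟨h1, h2⟩
    beta_reduce
    dsimp only at h1 h2 ⊢
    rw [← h1, ← h2]
    exact (Nat.div_add_mod' _ _).symm
  · rintro rfl
    exact ⟨mul_add_div_eq h, mul_add_mod_eq h⟩

/-- The length of the code of an automaton with `n` states and `m` letters. -/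
def tableLen (n m : ℕ) : ℕ := n * (m * n) + (n + n)

theorem length_encodeNFA {α : Type} {n : ℕ} (l : List α) (M : NFA α (Fin n)) :
    (encodeNFA l M).length = tableLen n l.length := by
  simp [encodeNFA, tableLen, List.length_product]

/-- The word has the tables of the automaton at position `o`. -/
def TableAt (x o m : ℕ) {α : Type} {n : ℕ} (f : α → ℕ) (M : NFA α (Fin n)) : Prop :=
  (∀ (q : Fin n) a (q' : Fin n), BitAt x (o + (q * (m * n) + (f a * n + q'))) ↔ q' ∈ M.step q a) ∧
    (∀ q : Fin n, BitAt x (o + n * (m * n) + q) ↔ q ∈ M.start) ∧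
    ∀ q : Fin n, BitAt x (o + n * (m * n) + n + q) ↔ q ∈ M.accept

theorem encodeNFA_prefix_drop_iff {α : Type} {n : ℕ} {l : List α} {f : α → ℕ} (hf : IsIndex l f)
    {M : NFA α (Fin n)} {w : List Bool} {o : ℕ} (h : o + tableLen n l.length ≤ w.length) :
    encodeNFA l M <+: w.drop o ↔ TableAt (bijVal w) o l.length f M := by
  classical
  unfold tableLen at h
  have hi := (isIndex_finRange n).product (hf.product (isIndex_finRange n))
  unfold encodeNFA TableAt
  rw [append_prefix_drop_iff, append_prefix_drop_iff,
    map_prefix_drop_iff (by simp [List.length_product]; omega),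
    map_prefix_drop_iff (by simp [List.length_product]; omega),
    map_prefix_drop_iff (by simp [List.length_product]; omega)]
  unfold IsIndex at hi
  simp only [hi, isIndex_finRange n _ _, List.length_product, List.length_map, List.length_finRange,
    decide_eq_true_eq, Prod.forall]
  refine and_congr ⟨fun h q a q' => h _ q a q' rfl, ?_⟩ (and_congr ⟨fun h q => h _ q rfl, ?_⟩
    ⟨fun h q => h _ q rfl, ?_⟩)
  · rintro h i q a q' rfl; exact h q a q'
  · rintro h i q rfl; exact h q
  · rintro h i q rfl; exact h q

/-! ### Codes of instances -/

/-- A number that stands for a word, and the sizes of an instance. -/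
abbrev Env : Type := ℕ × ℕ × ℕ × ℕ × ℕ × ℕ × ℕ

namespace Env

/-- the number of the word -/
def word (e : Env) : ℕ := e.1
/-- the size of the alphabet of the configurations -/
def sym (e : Env) : ℕ := e.2.1
/-- the size of the alphabet of the constraints -/
def constr (e : Env) : ℕ := e.2.2.1
/-- the number of states of the transducer for the transition relation -/
def nD (e : Env) : ℕ := e.2.2.2.1
/-- the number of states of the automaton for the initial configurations -/
def nI (e : Env) : ℕ := e.2.2.2.2.1
/-- the number of states of the automaton for the unsafe configurations -/
def nU (e : Env) : ℕ := e.2.2.2.2.2.1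
/-- the number of states of the transducer for the interpretation -/
def nV (e : Env) : ℕ := e.2.2.2.2.2.2
/-- the position of the tables for the transition relation -/
def posD (e : Env) : ℕ := e.sym + 1 + (e.constr + 1) + (e.nD + 1) + (e.nI + 1) + (e.nU + 1) +
  (e.nV + 1)
/-- the position of the tables for the initial configurations -/
def posI (e : Env) : ℕ := e.posD + tableLen e.nD ((e.sym + 1) * (e.sym + 1))
/-- the position of the tables for the unsafe configurations -/
def posU (e : Env) : ℕ := e.posI + tableLen e.nI e.sym
/-- the position of the tables for the interpretation -/
def posV (e : Env) : ℕ := e.posU + tableLen e.nU e.sym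
/-- the end of the tables -/
def total (e : Env) : ℕ := e.posV + tableLen e.nV ((e.constr + 1) * (e.sym + 1))

/-- The code has the right length and begins with the sizes. -/
def HasSizes (e : Env) : Prop := lenNum e.word = e.total ∧ UnaryAt e.word 0 e.sym ∧
  UnaryAt e.word (e.sym + 1) e.constr ∧ UnaryAt e.word (e.sym + 1 + (e.constr + 1)) e.nD ∧
  UnaryAt e.word (e.sym + 1 + (e.constr + 1) + (e.nD + 1)) e.nI ∧
  UnaryAt e.word (e.sym + 1 + (e.constr + 1) + (e.nD + 1) + (e.nI + 1)) e.nU ∧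
  UnaryAt e.word (e.sym + 1 + (e.constr + 1) + (e.nD + 1) + (e.nI + 1) + (e.nU + 1)) e.nV

/-- The tables for the interpretation are those of a deterministic transducer. -/
def IsDet (e : Env) : Prop :=
  (AllB e.nV fun q => AllB ((e.constr + 1) * (e.sym + 1)) fun i => ExB e.nV fun p =>
    AllB e.nV fun q' => (BitAt e.word
      (e.posV + (q * ((e.constr + 1) * (e.sym + 1) * e.nV) + (i * e.nV + q'))) ↔ q' = p)) ∧
  ExB e.nV fun p => AllB e.nV fun q =>
    (BitAt e.word (e.posV + e.nV * ((e.constr + 1) * (e.sym + 1) * e.nV) + q) ↔ q = p)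

end Env

/-- The sizes of an instance, together with the number of a word. -/
def Instance.env (x : Instance) (w : List Bool) : Env :=
  (bijVal w, x.numSym, x.numConstr, x.nΔ, x.nI, x.nU, x.nV)

theorem length_paddedLetters (n : ℕ) : (paddedLetters n).length = n + 1 := by simp [paddedLetters]

/-- The position of a pair of padded letters. -/
def pairNum {k l : ℕ} (p : Option (Fin k) × Option (Fin l)) : ℕ :=
  letterNum p.1 * (l + 1) + letterNum p.2

theorem isIndex_pairs (k l : ℕ) :
    IsIndex (paddedLetters k ×ˢ paddedLetters l) (pairNum (k := k) (l := l)) := by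
  have := (isIndex_paddedLetters k).product (isIndex_paddedLetters l)
  rwa [length_paddedLetters] at this

/-- Comparing lengths and then testing single bits at computed positions suffices: a word equals the
code iff it has the same length and the code is a prefix of it, and prefixes split along
concatenations. -/
theorem Instance.encode_eq_iff (x : Instance) (w : List Bool) :
    x.encode = w ↔ (x.env w).HasSizes ∧
      TableAt (bijVal w) (x.env w).posD ((x.numSym + 1) * (x.numSym + 1)) pairNum x.autΔ ∧
      TableAt (bijVal w) (x.env w).posI x.numSym Fin.val x.autI ∧
      TableAt (bijVal w) (x.env w).posU x.numSym Fin.val x.autU ∧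
      TableAt (bijVal w) (x.env w).posV ((x.numConstr + 1) * (x.numSym + 1)) pairNum
        x.autV.toNFA := by
  have h0 : x.encode = w ↔ w.length = x.encode.length ∧ x.encode <+: w.drop 0 :=
    ⟨fun h => by subst h; simp, fun h => h.2.eq_of_length (by simpa using h.1.symm)⟩
  have h1 : x.encode.length = (x.env w).total := by
    simp only [Instance.encode, List.length_append, length_encodeUnary, length_encodeNFA,
      List.length_product, length_paddedLetters, List.length_finRange]
    simp only [Instance.env, Env.total, Env.posV, Env.posU, Env.posI, Env.posD, Env.sym, Env.constr,
      Env.nD, Env.nI, Env.nU, Env.nV]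
    omega
  have h2 : lenNum (x.env w).word = w.length := lenNum_bijVal w
  rw [h0, h1, Env.HasSizes, h2, and_assoc]
  refine and_congr_right fun hw => ?_
  have hp := isIndex_pairs x.numSym x.numSym
  have hq := isIndex_pairs x.numConstr x.numSym
  have hr := isIndex_finRange x.numSym
  simp only [Env.total, Env.posV, Env.posU, Env.posI, Env.posD, Env.sym, Env.constr, Env.nD, Env.nI,
    Env.nU, Env.nV, Env.word, Instance.env] at hw ⊢
  simp only [Instance.encode, append_prefix_drop_iff, length_encodeUnary, length_encodeNFA,
    List.length_product, length_paddedLetters, List.length_finRange, zero_add]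
  rw [encodeUnary_prefix_drop_iff (by omega), encodeUnary_prefix_drop_iff (by omega),
    encodeUnary_prefix_drop_iff (by omega), encodeUnary_prefix_drop_iff (by omega),
    encodeUnary_prefix_drop_iff (by omega), encodeUnary_prefix_drop_iff (by omega),
    encodeNFA_prefix_drop_iff hp, encodeNFA_prefix_drop_iff hr,
    encodeNFA_prefix_drop_iff hr, encodeNFA_prefix_drop_iff hq]
  · simp only [List.length_product, length_paddedLetters, List.length_finRange, and_assoc]
  all_goals
    simp only [List.length_product, length_paddedLetters, List.length_finRange]
    omega

end RegAbs

namespace RegAbs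

/-! ### The automata of an instance, read from its code -/

open Function

/-- The transition relation of a transducer, read from the tables at position `o`. -/
def Rel₂ (x o k l n q a b r : ℕ) : Prop :=
  (q < n ∧ a < k + 1 ∧ b < l + 1 ∧ r < n) ∧
    BitAt x (o + (q * ((k + 1) * (l + 1) * n) + ((a * (l + 1) + b) * n + r)))

/-- The transition relation of an automaton, read from the tables at position `o`. -/
def Rel₁ (x o k n q a r : ℕ) : Prop :=
  (q < n ∧ a ≠ 0 ∧ a < k + 1 ∧ r < n) ∧ BitAt x (o + (q * (k * n) + ((a - 1) * n + r)))

/-- A set of states, read from the bit vector at position `o`. -/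
def SetAt (x o n q : ℕ) : Prop := q < n ∧ BitAt x (o + q)

theorem letterNum_lt {k : ℕ} (a : Option (Fin k)) : letterNum a < k + 1 := by
  cases a <;> simp [letterNum]

theorem exists_letterNum {k a : ℕ} (h : a < k + 1) : ∃ x : Option (Fin k), letterNum x = a := by
  rcases a with - | a
  · exact ⟨none, rfl⟩
  · exact ⟨some ⟨a, by omega⟩, rfl⟩

namespace TableAt

theorem rel₂ {x o k l n : ℕ} {M : NFA (Option (Fin k) × Option (Fin l)) (Fin n)}
    (h : TableAt x o ((k + 1) * (l + 1)) pairNum M) : Rel₂ x o k l n = stepNum₂ M := by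
  funext q a b q'
  refine propext ⟨?_, ?_⟩
  · rintro ⟨⟨h1, h2, h3, h4⟩, h5⟩
    obtain ⟨y, rfl⟩ := exists_letterNum h2
    obtain ⟨z, rfl⟩ := exists_letterNum h3
    exact ⟨⟨q, h1⟩, ⟨q', h4⟩, y, z, rfl, rfl, rfl, rfl, (h.1 ⟨q, h1⟩ (y, z) ⟨q', h4⟩).1 h5⟩
  · rintro ⟨p, p', y, z, rfl, rfl, rfl, rfl, h5⟩
    exact ⟨⟨p.2, letterNum_lt _, letterNum_lt _, p'.2⟩, (h.1 p (y, z) p').2 h5⟩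

theorem rel₁ {x o k n : ℕ} {M : NFA (Fin k) (Fin n)} (h : TableAt x o k Fin.val M) :
    Rel₁ x o k n = stepNum₁ M := by
  funext q a q'
  refine propext ⟨?_, ?_⟩
  · rintro ⟨⟨h1, h2, h3, h4⟩, h5⟩
    refine ⟨⟨q, h1⟩, ⟨q', h4⟩, ⟨a - 1, by omega⟩, rfl, ?_, rfl,
      (h.1 ⟨q, h1⟩ ⟨a - 1, by omega⟩ ⟨q', h4⟩).1 h5⟩
    simp only [letterNum]
    omega
  · rintro ⟨p, p', y, rfl, rfl, rfl, h5⟩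
    exact ⟨⟨p.2, by simp [letterNum], letterNum_lt _, p'.2⟩, (h.1 p y p').2 h5⟩

theorem start {x o m n : ℕ} {α : Type} {f : α → ℕ} {M : NFA α (Fin n)} (h : TableAt x o m f M) :
    SetAt x (o + n * (m * n)) n = stateNum M.start := by
  funext q
  refine propext ⟨fun h1 => ⟨⟨q, h1.1⟩, (h.2.1 ⟨q, h1.1⟩).1 h1.2, rfl⟩, ?_⟩
  rintro ⟨q, hq, rfl⟩
  exact ⟨q.2, (h.2.1 q).2 hq⟩

theorem accept {x o m n : ℕ} {α : Type} {f : α → ℕ} {M : NFA α (Fin n)} (h : TableAt x o m f M) :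
    SetAt x (o + n * (m * n) + n) n = stateNum M.accept := by
  funext q
  refine propext ⟨fun h1 => ⟨⟨q, h1.1⟩, (h.2.2 ⟨q, h1.1⟩).1 h1.2, rfl⟩, ?_⟩
  rintro ⟨q, hq, rfl⟩
  exact ⟨q.2, (h.2.2 q).2 hq⟩

end TableAt

theorem stateNum_compl {n : ℕ} (S : Set (Fin n)) :
    stateNum Sᶜ = fun q => q < n ∧ ¬stateNum S q := by
  funext q
  refine propext ⟨?_, fun h => ⟨⟨q, h.1⟩, fun h' => h.2 ⟨_, h', rfl⟩, rfl⟩⟩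
  rintro ⟨q, hq, rfl⟩
  refine ⟨q.2, ?_⟩
  rintro ⟨q', hq', h⟩
  exact hq (Fin.ext h ▸ hq')

namespace Env

/-- transitions of the transducer for the transition relation -/
def dD (e : Env) (q a b r : ℕ) : Prop := Rel₂ e.word e.posD e.sym e.sym e.nD q a b r
/-- initial states of the transducer for the transition relation -/
def sD (e : Env) (q : ℕ) : Prop :=
  SetAt e.word (e.posD + e.nD * ((e.sym + 1) * (e.sym + 1) * e.nD)) e.nD q
/-- final states of the transducer for the transition relation -/
def fD (e : Env) (q : ℕ) : Prop :=
  SetAt e.word (e.posD + e.nD * ((e.sym + 1) * (e.sym + 1) * e.nD) + e.nD) e.nD q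
/-- transitions of the automaton for the initial configurations -/
def dI (e : Env) (q a r : ℕ) : Prop := Rel₁ e.word e.posI e.sym e.nI q a r
/-- initial states of the automaton for the initial configurations -/
def sI (e : Env) (q : ℕ) : Prop := SetAt e.word (e.posI + e.nI * (e.sym * e.nI)) e.nI q
/-- final states of the automaton for the initial configurations -/
def fI (e : Env) (q : ℕ) : Prop := SetAt e.word (e.posI + e.nI * (e.sym * e.nI) + e.nI) e.nI q
/-- transitions of the automaton for the unsafe configurations -/
def dU (e : Env) (q a r : ℕ) : Prop := Rel₁ e.word e.posU e.sym e.nU q a r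
/-- initial states of the automaton for the unsafe configurations -/
def sU (e : Env) (q : ℕ) : Prop := SetAt e.word (e.posU + e.nU * (e.sym * e.nU)) e.nU q
/-- final states of the automaton for the unsafe configurations -/
def fU (e : Env) (q : ℕ) : Prop := SetAt e.word (e.posU + e.nU * (e.sym * e.nU) + e.nU) e.nU q
/-- transitions of the transducer for the interpretation -/
def dV (e : Env) (q a b r : ℕ) : Prop := Rel₂ e.word e.posV e.constr e.sym e.nV q a b r
/-- initial states of the transducer for the interpretation -/
def sV (e : Env) (q : ℕ) : Prop :=
  SetAt e.word (e.posV + e.nV * ((e.constr + 1) * (e.sym + 1) * e.nV)) e.nV q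
/-- final states of the transducer for the interpretation -/
def fV (e : Env) (q : ℕ) : Prop :=
  SetAt e.word (e.posV + e.nV * ((e.constr + 1) * (e.sym + 1) * e.nV) + e.nV) e.nV q
/-- nonfinal states of the transducer for the interpretation -/
def gV (e : Env) (q : ℕ) : Prop := q < e.nV ∧ ¬e.fV q

/-- The tables are those of the instance. -/
structure Reads (e : Env) (x : Instance) : Prop where
  dD : e.dD = stepNum₂ x.autΔ
  sD : e.sD = stateNum x.autΔ.start
  fD : e.fD = stateNum x.autΔ.accept
  dI : e.dI = stepNum₁ x.autI
  sI : e.sI = stateNum x.autI.start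
  fI : e.fI = stateNum x.autI.accept
  dU : e.dU = stepNum₁ x.autU
  sU : e.sU = stateNum x.autU.start
  fU : e.fU = stateNum x.autU.accept
  dV : e.dV = stepNum₂ x.autV.toNFA
  sV : e.sV = stateNum x.autV.toNFA.start
  fV : e.fV = stateNum x.autV.toNFA.accept
  gV : e.gV = stateNum x.autV.acceptᶜ

end Env

theorem Instance.env_reads {x : Instance} {w : List Bool} (h : x.encode = w) :
    (x.env w).Reads x := by
  obtain ⟨-, h1, h2, h3, h4⟩ := (x.encode_eq_iff w).1 h
  refine ⟨h1.rel₂, h1.start, h1.accept, h2.rel₁, h2.start, h2.accept, h3.rel₁, h3.start,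
    h3.accept, h4.rel₂, h4.start, h4.accept, ?_⟩
  rw [stateNum_compl]
  funext q
  exact congrArg (fun p => q < x.nV ∧ ¬p) (congrFun h4.accept q)

theorem pairNum_lt {k l : ℕ} (p : Option (Fin k) × Option (Fin l)) :
    pairNum p < (k + 1) * (l + 1) := by
  have h1 := letterNum_lt p.1
  have h2 := letterNum_lt p.2
  unfold pairNum
  nlinarith

theorem exists_pairNum {k l i : ℕ} (h : i < (k + 1) * (l + 1)) :
    ∃ p : Option (Fin k) × Option (Fin l), pairNum p = i := by
  obtain ⟨a, ha⟩ := exists_letterNum (Nat.div_lt_of_lt_mul (by rwa [mul_comm] at h))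
  obtain ⟨b, hb⟩ := exists_letterNum (Nat.mod_lt i (Nat.succ_pos l))
  exact ⟨(a, b), by rw [pairNum, ha, hb]; exact Nat.div_add_mod' _ _⟩

theorem Instance.env_isDet {x : Instance} {w : List Bool} (h : x.encode = w) :
    (x.env w).IsDet := by
  obtain ⟨-, -, -, -, h1, h2, -⟩ := (x.encode_eq_iff w).1 h
  refine ⟨fun q hq i hi => ?_, ?_⟩
  · obtain ⟨a, rfl⟩ := exists_pairNum hi
    refine ⟨x.autV.step ⟨q, hq⟩ a, (x.autV.step ⟨q, hq⟩ a).2, fun q' hq' => ?_⟩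
    refine (h1 ⟨q, hq⟩ a ⟨q', hq'⟩).trans ?_
    rw [DFA.toNFA, Set.mem_singleton_iff, Fin.ext_iff]
  · refine ⟨x.autV.start, x.autV.start.2, fun q hq => (h2 ⟨q, hq⟩).trans ?_⟩
    rw [DFA.toNFA, Set.mem_singleton_iff, Fin.ext_iff]

/-! ### Admissible tables are codes of instances -/

/-- The automaton given by the tables at position `o`. -/
def tableNFA (x o m n : ℕ) {α : Type} (f : α → ℕ) : NFA α (Fin n) where
  step q a := {q' | BitAt x (o + (q * (m * n) + (f a * n + q')))}
  start := {q | BitAt x (o + n * (m * n) + q)}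
  accept := {q | BitAt x (o + n * (m * n) + n + q)}

theorem tableNFA_tableAt (x o m n : ℕ) {α : Type} (f : α → ℕ) :
    TableAt x o m f (tableNFA x o m n f) := ⟨fun _ _ _ => Iff.rfl, fun _ => Iff.rfl, fun _ => Iff.rfl⟩

/-- Any bits of the right number form the tables of an NFA, so beyond the sizes only determinism of
the interpretation has to be checked to recognise a code. -/
theorem Env.exists_instance {e : Env} {w : List Bool} (hw : e.word = bijVal w) (h1 : e.HasSizes)
    (h2 : e.IsDet) : ∃ x : Instance, x.encode = w ∧ x.env w = e := by
  obtain ⟨h3, p, hp, h4⟩ := h2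
  choose! t ht1 ht2 using h3
  let x : Instance :=
    { numSym := e.sym, numConstr := e.constr, nΔ := e.nD, nI := e.nI, nU := e.nU, nV := e.nV
      autΔ := tableNFA e.word e.posD ((e.sym + 1) * (e.sym + 1)) e.nD pairNum
      autI := tableNFA e.word e.posI e.sym e.nI Fin.val
      autU := tableNFA e.word e.posU e.sym e.nU Fin.val
      autV := ⟨fun q a => ⟨t q (pairNum a), ht1 q q.2 _ (pairNum_lt a)⟩, ⟨p, hp⟩,
        (tableNFA e.word e.posV ((e.constr + 1) * (e.sym + 1)) e.nV
          (pairNum (k := e.constr) (l := e.sym))).accept⟩ }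
  have he : x.env w = e := by
    unfold Instance.env
    rw [← hw]
    rfl
  refine ⟨x, ?_, he⟩
  rw [Instance.encode_eq_iff, he, ← hw]
  refine ⟨h1, tableNFA_tableAt _ _ _ _ _, tableNFA_tableAt _ _ _ _ _, tableNFA_tableAt _ _ _ _ _,
    fun q a q' => ?_, fun q => ?_, fun _ => Iff.rfl⟩
  · refine (ht2 q q.2 _ (pairNum_lt a) q' q'.2).trans ?_
    rw [DFA.toNFA, Set.mem_singleton_iff, Fin.ext_iff]
  · refine (h4 q q.2).trans ?_
    rw [DFA.toNFA, Set.mem_singleton_iff, Fin.ext_iff]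

/-! ### The tables are read within polynomial bounds -/

namespace Cmp

variable {E : Type} [Code E]

@[fun_prop]
theorem bitAt {x i : E → ℕ} (hx : Cmp x) (hi : Cmp i) : Cmp fun e => BitAt (x e) (i e) := by
  have : Cmp fun e => dropNum (x e) (i e) :=
    clampIter (f := fun _ y => (y - 1) / 2) hx (by fun_prop) hi hx
  unfold BitAt
  fun_prop

@[fun_prop]
theorem lenNum {x : E → ℕ} (hx : Cmp x) : Cmp fun e => lenNum (x e) := by
  have : Cmp fun p : E × ℕ => dropNum (x p.1) p.2 :=
    clampIter (f := fun _ y => (y - 1) / 2) (by fun_prop) (by fun_prop) (by fun_prop) (by fun_prop)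
  unfold RegAbs.lenNum
  fun_prop

@[fun_prop]
theorem unaryAt {x o n : E → ℕ} (hx : Cmp x) (ho : Cmp o) (hn : Cmp n) :
    Cmp fun e => UnaryAt (x e) (o e) (n e) := by
  unfold UnaryAt
  fun_prop

@[fun_prop]
theorem tableLen {n m : E → ℕ} (hn : Cmp n) (hm : Cmp m) : Cmp fun e => tableLen (n e) (m e) := by
  unfold RegAbs.tableLen
  fun_prop

@[fun_prop]
theorem rel₂ {x o k l n q a b q' : E → ℕ} (hx : Cmp x) (ho : Cmp o) (hk : Cmp k) (hl : Cmp l)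
    (hn : Cmp n) (hq : Cmp q) (ha : Cmp a) (hb : Cmp b) (hq' : Cmp q') :
    Cmp fun e => Rel₂ (x e) (o e) (k e) (l e) (n e) (q e) (a e) (b e) (q' e) := by
  unfold Rel₂
  fun_prop

@[fun_prop]
theorem rel₁ {x o k n q a q' : E → ℕ} (hx : Cmp x) (ho : Cmp o) (hk : Cmp k) (hn : Cmp n)
    (hq : Cmp q) (ha : Cmp a) (hq' : Cmp q') :
    Cmp fun e => Rel₁ (x e) (o e) (k e) (n e) (q e) (a e) (q' e) := by
  unfold Rel₁
  fun_prop

@[fun_prop]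
theorem setAt {x o n q : E → ℕ} (hx : Cmp x) (ho : Cmp o) (hn : Cmp n) (hq : Cmp q) :
    Cmp fun e => SetAt (x e) (o e) (n e) (q e) := by
  unfold SetAt
  fun_prop

section

variable {f : E → Env}

@[fun_prop]
theorem env_word (hf : Cmp f) : Cmp fun e => (f e).word := by unfold Env.word; fun_prop

@[fun_prop]
theorem env_sym (hf : Cmp f) : Cmp fun e => (f e).sym := by unfold Env.sym; fun_prop

@[fun_prop]
theorem env_constr (hf : Cmp f) : Cmp fun e => (f e).constr := by unfold Env.constr; fun_prop

@[fun_prop]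
theorem env_nD (hf : Cmp f) : Cmp fun e => (f e).nD := by unfold Env.nD; fun_prop

@[fun_prop]
theorem env_nI (hf : Cmp f) : Cmp fun e => (f e).nI := by unfold Env.nI; fun_prop

@[fun_prop]
theorem env_nU (hf : Cmp f) : Cmp fun e => (f e).nU := by unfold Env.nU; fun_prop

@[fun_prop]
theorem env_nV (hf : Cmp f) : Cmp fun e => (f e).nV := by unfold Env.nV; fun_prop

@[fun_prop]
theorem env_posD (hf : Cmp f) : Cmp fun e => (f e).posD := by unfold Env.posD; fun_prop

@[fun_prop]
theorem env_posI (hf : Cmp f) : Cmp fun e => (f e).posI := by unfold Env.posI; fun_prop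

@[fun_prop]
theorem env_posU (hf : Cmp f) : Cmp fun e => (f e).posU := by unfold Env.posU; fun_prop

@[fun_prop]
theorem env_posV (hf : Cmp f) : Cmp fun e => (f e).posV := by unfold Env.posV; fun_prop

@[fun_prop]
theorem env_total (hf : Cmp f) : Cmp fun e => (f e).total := by unfold Env.total; fun_prop

@[fun_prop]
theorem env_hasSizes (hf : Cmp f) : Cmp fun e => (f e).HasSizes := by unfold Env.HasSizes; fun_prop

@[fun_prop]
theorem env_isDet (hf : Cmp f) : Cmp fun e => (f e).IsDet := by unfold Env.IsDet; fun_prop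

variable {q a b q' : E → ℕ}

@[fun_prop]
theorem env_dD (hf : Cmp f) (hq : Cmp q) (ha : Cmp a) (hb : Cmp b) (hq' : Cmp q') :
    Cmp fun e => (f e).dD (q e) (a e) (b e) (q' e) := by unfold Env.dD; fun_prop

@[fun_prop]
theorem env_dV (hf : Cmp f) (hq : Cmp q) (ha : Cmp a) (hb : Cmp b) (hq' : Cmp q') :
    Cmp fun e => (f e).dV (q e) (a e) (b e) (q' e) := by unfold Env.dV; fun_prop

@[fun_prop]
theorem env_dI (hf : Cmp f) (hq : Cmp q) (ha : Cmp a) (hq' : Cmp q') :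
    Cmp fun e => (f e).dI (q e) (a e) (q' e) := by unfold Env.dI; fun_prop

@[fun_prop]
theorem env_dU (hf : Cmp f) (hq : Cmp q) (ha : Cmp a) (hq' : Cmp q') :
    Cmp fun e => (f e).dU (q e) (a e) (q' e) := by unfold Env.dU; fun_prop

@[fun_prop]
theorem env_sD (hf : Cmp f) (hq : Cmp q) : Cmp fun e => (f e).sD (q e) := by
  unfold Env.sD; fun_prop

@[fun_prop]
theorem env_fD (hf : Cmp f) (hq : Cmp q) : Cmp fun e => (f e).fD (q e) := by
  unfold Env.fD; fun_prop

@[fun_prop]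
theorem env_sI (hf : Cmp f) (hq : Cmp q) : Cmp fun e => (f e).sI (q e) := by
  unfold Env.sI; fun_prop

@[fun_prop]
theorem env_fI (hf : Cmp f) (hq : Cmp q) : Cmp fun e => (f e).fI (q e) := by
  unfold Env.fI; fun_prop

@[fun_prop]
theorem env_sU (hf : Cmp f) (hq : Cmp q) : Cmp fun e => (f e).sU (q e) := by
  unfold Env.sU; fun_prop

@[fun_prop]
theorem env_fU (hf : Cmp f) (hq : Cmp q) : Cmp fun e => (f e).fU (q e) := by
  unfold Env.fU; fun_prop

@[fun_prop]
theorem env_sV (hf : Cmp f) (hq : Cmp q) : Cmp fun e => (f e).sV (q e) := by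
  unfold Env.sV; fun_prop

@[fun_prop]
theorem env_fV (hf : Cmp f) (hq : Cmp q) : Cmp fun e => (f e).fV (q e) := by
  unfold Env.fV; fun_prop

@[fun_prop]
theorem env_gV (hf : Cmp f) (hq : Cmp q) : Cmp fun e => (f e).gV (q e) := by
  unfold Env.gV; fun_prop

end

end Cmp
end RegAbs

namespace RegAbs

/-! ### Certificates for inductive constraints and for potential reachability -/

open Function

/-- the first of several packed numbers -/
def fieldA (t : ℕ) : ℕ := (unpack t).1
/-- the second of several packed numbers -/
def fieldB (t : ℕ) : ℕ := (unpack (unpack t).2).1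
/-- the third of several packed numbers -/
def fieldC (t : ℕ) : ℕ := (unpack (unpack (unpack t).2).2).1
/-- the fourth of four packed numbers -/
def lastD (t : ℕ) : ℕ := (unpack (unpack (unpack t).2).2).2
/-- the fourth of five packed numbers -/
def fieldD (t : ℕ) : ℕ := (unpack (lastD t)).1
/-- the fifth of five packed numbers -/
def lastE (t : ℕ) : ℕ := (unpack (lastD t)).2

/-- four packed numbers -/
def pack₄ (a b c d : ℕ) : ℕ := pack a (pack b (pack c d))

section

variable (a b c d x : ℕ)

@[simp] theorem fieldA_pack₄ : fieldA (pack₄ a b c d) = a := by simp [fieldA, pack₄]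
@[simp] theorem fieldB_pack₄ : fieldB (pack₄ a b c d) = b := by simp [fieldB, pack₄]
@[simp] theorem fieldC_pack₄ : fieldC (pack₄ a b c d) = c := by simp [fieldC, pack₄]
@[simp] theorem lastD_pack₄ : lastD (pack₄ a b c d) = d := by simp [lastD, pack₄]
@[simp] theorem fieldD_pack₄ : fieldD (pack₄ a b c (pack d x)) = d := by simp [fieldD]
@[simp] theorem lastE_pack₄ : lastE (pack₄ a b c (pack d x)) = x := by simp [lastE]

end

/-- a bound for pairs of numbers below `k` -/
def pairBound (k : ℕ) : ℕ := 4 * k ^ 2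

theorem pack_lt {a b k : ℕ} (ha : a < k) (hb : b < k) : pack a b < pairBound k := by
  have := pack_le a b
  unfold pairBound
  nlinarith

theorem le_pairBound (k : ℕ) : k ≤ pairBound k := by
  unfold pairBound
  nlinarith [Nat.zero_le k, Nat.le_self_pow two_ne_zero k]

theorem pack₄_lt {a b c d k : ℕ} (ha : a < k) (hb : b < k) (hc : c < k) (hd : d < k) :
    pack₄ a b c d < pairBound (pairBound (pairBound k)) := by
  have h1 := le_pairBound k
  have h2 := le_pairBound (pairBound k)
  exact pack_lt (by omega) (pack_lt (by omega) (pack_lt hc hd))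

/-- The letters of a word, with a nonzero number in front. -/
def flagSeq {n : ℕ} (u : List (Fin n)) : ℕ → ℕ
  | 0 => 1
  | i + 1 => letterAt u i

theorem flagSeq_mono {n : ℕ} {u : List (Fin n)} {i : ℕ} (h : flagSeq u i = 0) :
    letterAt u i = 0 := by
  rcases i with - | i
  · simp [flagSeq] at h
  · rw [flagSeq, letterAt_eq_zero] at h
    rw [letterAt_eq_zero]
    omega

theorem flagSeq_le {n : ℕ} (u : List (Fin n)) (i : ℕ) : flagSeq u i ≤ n + 1 := by
  rcases i with - | i
  · simp [flagSeq]
  · have := letterAt_le u i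
    simp only [flagSeq]
    omega

/-- Padded steps force their letters into the alphabet and preserve the range of the states, so the
searches need no separate test that guessed letters are legal. -/
theorem pad₂_stepNum₂ {k l n : ℕ} {M : NFA (Option (Fin k) × Option (Fin l)) (Fin n)}
    {q a b q' : ℕ} (h : pad₂ (stepNum₂ M) q a b q') : a ≤ k ∧ b ≤ l ∧ (q < n → q' < n) := by
  rcases h with ⟨rfl, rfl, rfl⟩ | ⟨-, p, p', y, z, rfl, rfl, rfl, rfl, -⟩
  · simp
  · have := letterNum_lt y
    have := letterNum_lt z
    exact ⟨by omega, by omega, fun _ => p'.2⟩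

theorem pad₁_stepNum₁ {k n : ℕ} {M : NFA (Fin k) (Fin n)} {q a q' : ℕ}
    (h : pad₁ (stepNum₁ M) q a q') : a ≤ k ∧ (q < n → q' < n) := by
  rcases h with ⟨rfl, rfl⟩ | ⟨-, p, p', y, rfl, rfl, rfl, -⟩
  · simp
  · have := letterNum_lt (some y)
    exact ⟨by omega, fun _ => p'.2⟩

theorem stateNum_lt {n q : ℕ} {S : Set (Fin n)} (h : stateNum S q) : q < n := by
  obtain ⟨p, -, rfl⟩ := h
  exact p.2

theorem Run₂.lt {k l n L : ℕ} {M : NFA (Option (Fin k) × Option (Fin l)) (Fin n)}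
    {S : Set (Fin n)} {a b r : ℕ → ℕ} (h : Run₂ (stepNum₂ M) (stateNum S) L a b r) :
    ∀ i ≤ L, r i < n := by
  intro i
  induction i with
  | zero => exact fun _ => stateNum_lt h.1
  | succ i ih => exact fun hi => (pad₂_stepNum₂ (h.2 i (by omega))).2.2 (ih (by omega))

theorem Run₁.lt {k n L : ℕ} {M : NFA (Fin k) (Fin n)} {S : Set (Fin n)} {a r : ℕ → ℕ}
    (h : Run₁ (stepNum₁ M) (stateNum S) L a r) : ∀ i ≤ L, r i < n := by
  intro i
  induction i with
  | zero => exact fun _ => stateNum_lt h.1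
  | succ i ih => exact fun hi => (pad₁_stepNum₁ (h.2 i (by omega))).2 (ih (by omega))

namespace Env

variable (e : Env)

/-- A step of three automata that search for two configurations violating the inductivity of a
constraint with the letter `z`. -/
def step₁ (z t u : ℕ) : Prop :=
  ¬(fieldD t = 0 ∧ fieldD u ≠ 0) ∧ ¬(lastE t = 0 ∧ lastE u ≠ 0) ∧
    pad₂ e.dV (fieldA t) z (fieldD u) (fieldA u) ∧
    pad₂ e.dV (fieldB t) z (lastE u) (fieldB u) ∧
    pad₂ e.dD (fieldC t) (fieldD u) (lastE u) (fieldC u)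

/-- initial states of the search for a violation of inductivity -/
def init₁ (t : ℕ) : Prop :=
  e.sV (fieldA t) ∧ e.sV (fieldB t) ∧ e.sD (fieldC t) ∧ fieldD t = 1 ∧ lastE t = 1

/-- final states of the search for a violation of inductivity -/
def bad₁ (t : ℕ) : Prop := e.fV (fieldA t) ∧ e.gV (fieldB t) ∧ e.fD (fieldC t)

/-- A step of a search for a constraint that separates two configurations with the letters `a` and
`b`, together with a certificate of inductivity. -/
def step₂ (m a b t u : ℕ) : Prop :=
  ¬(lastD t = 0 ∧ lastD u ≠ 0) ∧
    ClosedBits m (e.step₁ (lastD u)) (fieldA t) (fieldA u) ∧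
    pad₂ e.dV (fieldB t) (lastD u) a (fieldB u) ∧
    pad₂ e.dV (fieldC t) (lastD u) b (fieldC u)

/-- initial states of the search for a separating constraint -/
def init₂ (m t : ℕ) : Prop :=
  CoversBits m e.init₁ (fieldA t) ∧ e.sV (fieldB t) ∧ e.sV (fieldC t) ∧ lastD t = 1

/-- final states of the search for a separating constraint -/
def bad₂ (m t : ℕ) : Prop :=
  (ClosedBits m (e.step₁ 0) (fieldA t) (fieldA t) ∧ AvoidsBits m e.bad₁ (fieldA t)) ∧
    e.fV (fieldB t) ∧ e.gV (fieldC t)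

/-- A step of a search for an initial and an unsafe configuration, together with a certificate that
no inductive constraint separates them. -/
def step₃ (m m' t u : ℕ) : Prop :=
  ¬(fieldD t = 0 ∧ fieldD u ≠ 0) ∧ ¬(lastE t = 0 ∧ lastE u ≠ 0) ∧
    ClosedBits m' (e.step₂ m (fieldD u) (lastE u)) (fieldA t) (fieldA u) ∧
    pad₁ e.dI (fieldB t) (fieldD u) (fieldB u) ∧
    pad₁ e.dU (fieldC t) (lastE u) (fieldC u)

/-- initial states of the search for an unsafe configuration -/
def init₃ (m m' t : ℕ) : Prop :=
  CoversBits m' (e.init₂ m) (fieldA t) ∧ e.sI (fieldB t) ∧ e.sU (fieldC t) ∧ fieldD t = 1 ∧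
    lastE t = 1

/-- final states of the search for an unsafe configuration -/
def final₃ (m m' t : ℕ) : Prop :=
  (ClosedBits m' (e.step₂ m 0 0) (fieldA t) (fieldA t) ∧ AvoidsBits m' (e.bad₂ m) (fieldA t)) ∧
    e.fI (fieldB t) ∧ e.fU (fieldC t)

end Env

/-! ### Correctness of the three searches -/

/-- A sequence of flags and letters along a run is given by a word. -/
theorem exists_flagSeq {n m : ℕ} {a : ℕ → ℕ} (h1 : ∀ i < m, a (i + 1) ≤ n)
    (h2 : ∀ i < m, ¬(a i = 0 ∧ a (i + 1) ≠ 0)) :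
    ∃ u : List (Fin n), u.length ≤ m ∧ ∀ i < m, a (i + 1) = letterAt u i := by
  obtain ⟨u, hu, hua⟩ := exists_letterAt (m := m) (a := fun i => a (i + 1)) h1 fun i hi h => by
    by_contra h'
    exact h2 (i + 1) hi ⟨h, h'⟩
  exact ⟨u, hu, fun i hi => (hua i hi).symm⟩

theorem mem_Ind_iff {y : Instance} {A : List (Fin y.numConstr)} :
    A ∈ Ind y.Δ y.V ↔ ∀ u v, convolution A u ∈ y.autV.toNFA.accepts →
      convolution u v ∈ y.autΔ.accepts → ¬convolution A v ∉ y.autV.toNFA.accepts := by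
  simp only [Ind, IsInductiveSet, satisfying, SetRel.image, Set.subset_def, Instance.Δ, Instance.V,
    transducerRel, Set.mem_ofPred_eq, Set.mem_singleton_iff, exists_eq_left, not_not]
  constructor
  · exact fun h u v h1 h2 => h v ⟨u, h1, h2⟩
  · rintro h v ⟨u, h1, h2⟩
    exact h u v h1 h2

theorem mem_PReach_iff {y : Instance} {u v : List (Fin y.numSym)} :
    (u, v) ∈ PReach y.Δ y.V ↔ ∀ A, A ∈ Ind y.Δ y.V → convolution A u ∈ y.autV.toNFA.accepts →
      ¬convolution A v ∉ y.autV.toNFA.accepts := by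
  simp only [PReach, satisfying, SetRel.image, Instance.V,
    transducerRel, Set.mem_ofPred_eq, Set.mem_singleton_iff, exists_eq_left, not_not]

/-- `k` bounds the sizes of the instance. -/
structure Instance.Bounded (y : Instance) (k : ℕ) : Prop where
  sym : y.numSym + 1 < k
  constr : y.numConstr + 1 < k
  nD : y.nΔ ≤ k
  nI : y.nI ≤ k
  nU : y.nU ≤ k
  nV : y.nV ≤ k

section

variable {e : Env} {y : Instance} (h : e.Reads y) {k m m' : ℕ} (hk : y.Bounded k)
  (hm : pairBound (pairBound (pairBound (pairBound k))) ≤ m)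
  (hm' : pairBound (pairBound (pairBound (2 ^ m))) ≤ m')

include h hk hm

/-- A level 1 run is a counterexample to inductivity, read letter by letter. Its states also carry
the last letters guessed: these communicate the letters to the automata and forbid a letter after
padding, so that the guesses form words. The run length `n` is arbitrary beyond `L`, since
counterexamples may be longer than `A`. -/
theorem mem_Ind_iff_run {A : List (Fin y.numConstr)} {L : ℕ} (hA : A.length ≤ L) :
    A ∈ Ind y.Δ y.V ↔ ∀ n, L ≤ n → ∀ r : ℕ → ℕ, e.init₁ (r 0) →
      (∀ i < n, e.step₁ (letterAt A i) (r i) (r (i + 1))) → (∀ i ≤ n, r i < m) →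
      ¬e.bad₁ (r n) := by
  rw [mem_Ind_iff]
  simp only [Env.init₁, Env.step₁, Env.bad₁, h.dV, h.sV, h.fV, h.gV, h.dD, h.sD, h.fD]
  constructor
  · rintro hind n hn r ⟨h1, h2, h3, -, -⟩ hr - ⟨h4, h5, h6⟩
    obtain ⟨u, hu, hu'⟩ := exists_flagSeq (a := fun i => fieldD (r i)) (m := n)
      (fun i hi => (pad₂_stepNum₂ (hr i hi).2.2.1).2.1) fun i hi => (hr i hi).1
    obtain ⟨v, hv, hv'⟩ := exists_flagSeq (a := fun i => lastE (r i)) (m := n)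
      (fun i hi => (pad₂_stepNum₂ (hr i hi).2.2.2.1).2.1) fun i hi => (hr i hi).2.1
    refine hind u v ((convolution_mem_accepts_iff _ (L := n) (by omega) hu).2
        ⟨fun i => fieldA (r i), ⟨h1, ?_⟩, h4⟩)
      ((convolution_mem_accepts_iff _ (L := n) hu hv).2 ⟨fun i => fieldC (r i), ⟨h3, ?_⟩, h6⟩)
      ((convolution_not_mem_accepts_iff _ (L := n) (by omega) hv).2
        ⟨fun i => fieldB (r i), ⟨h2, ?_⟩, h5⟩)
    · intro i hi
      rw [← hu' i hi]
      exact (hr i hi).2.2.1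
    · intro i hi
      rw [← hu' i hi, ← hv' i hi]
      exact (hr i hi).2.2.2.2
    · intro i hi
      rw [← hv' i hi]
      exact (hr i hi).2.2.2.1
  · intro hrun u v h1 h2 h3
    obtain ⟨n, hn, hu, hv⟩ : ∃ n, L ≤ n ∧ u.length ≤ n ∧ v.length ≤ n :=
      ⟨L + u.length + v.length, by omega, by omega, by omega⟩
    obtain ⟨r, hr, hr'⟩ := (convolution_mem_accepts_iff _ (L := n) (by omega) hu).1 h1
    obtain ⟨s, hs, hs'⟩ := (convolution_mem_accepts_iff _ (L := n) hu hv).1 h2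
    obtain ⟨t, ht, ht'⟩ := (convolution_not_mem_accepts_iff _ (L := n) (by omega) hv).1 h3
    -- The letter read in step `i` sits in the state after that step; the initial flag `1` says that
    -- padding has not yet begun.
    refine hrun n hn (fun i => pack₄ (r i) (t i) (s i) (pack (flagSeq u i) (flagSeq v i)))
      ?_ (fun i hi => ?_) (fun i hi => ?_) ?_
    · simpa [flagSeq] using ⟨hr.1, ht.1, hs.1⟩
    · simp only [fieldA_pack₄, fieldB_pack₄, fieldC_pack₄, fieldD_pack₄, lastE_pack₄]
      exact ⟨fun h => h.2 (flagSeq_mono h.1), fun h => h.2 (flagSeq_mono h.1), hr.2 i hi, ht.2 i hi,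
        hs.2 i hi⟩
    · have h1 := hr.lt i hi
      have h2 := hs.lt i hi
      have h3 := ht.lt i hi
      have h4 := flagSeq_le u i
      have h5 := flagSeq_le v i
      have h6 := le_pairBound k
      have := hk.sym
      have := hk.nD
      have := hk.nV
      exact lt_of_lt_of_le (pack₄_lt (by omega) (by omega) (by omega)
        (pack_lt (by omega) (by omega))) hm
    · simpa using ⟨hr', ht', hs'⟩

theorem mem_Ind_of_isCertificate {A : List (Fin y.numConstr)} {L : ℕ} (hA : A.length ≤ L)
    {X : ℕ → ℕ}
    (hX : IsCertificate m L e.init₁ (fun i => e.step₁ (letterAt A i)) (e.step₁ 0) e.bad₁ X) :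
    A ∈ Ind y.Δ y.V :=
  (mem_Ind_iff_run h hk hm hA).2 fun _ hn _ => hX.not_bad
    (fun i hi t t' => by rw [letterAt_eq_zero.2 (hA.trans hi)]) hn

theorem exists_isCertificate_of_mem_Ind {A : List (Fin y.numConstr)} {L : ℕ} (hA : A.length ≤ L)
    (hind : A ∈ Ind y.Δ y.V) : ∃ X : ℕ → ℕ, (∀ i, X i < 2 ^ m) ∧
      IsCertificate m L e.init₁ (fun i => e.step₁ (letterAt A i)) (e.step₁ 0) e.bad₁ X :=
  exists_isCertificate (fun i hi t t' => by rw [letterAt_eq_zero.2 (hA.trans hi)])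
    ((mem_Ind_iff_run h hk hm hA).1 hind)

include hm'

/-- A level 2 run that ends badly is a separating constraint together with a certificate of its
inductivity. The certificate is spread over the run, one set for each position. -/
theorem mem_PReach_iff_run {u v : List (Fin y.numSym)} {L : ℕ} (hu : u.length ≤ L)
    (hv : v.length ≤ L) :
    (u, v) ∈ PReach y.Δ y.V ↔ ∀ n, L ≤ n → ∀ r : ℕ → ℕ, e.init₂ m (r 0) →
      (∀ i < n, e.step₂ m (letterAt u i) (letterAt v i) (r i) (r (i + 1))) → (∀ i ≤ n, r i < m') →
      ¬e.bad₂ m (r n) := by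
  rw [mem_PReach_iff]
  simp only [Env.init₂, Env.step₂, Env.bad₂, h.dV, h.sV, h.fV, h.gV]
  constructor
  · rintro hsep n hn r ⟨h0, h1, h2, -⟩ hr hlt ⟨h3, h4, h5⟩
    obtain ⟨A, hA, hA'⟩ := exists_flagSeq (a := fun i => lastD (r i)) (m := n)
      (fun i hi => (pad₂_stepNum₂ (hr i hi).2.2.1).1) fun i hi => (hr i hi).1
    refine hsep A ?_ ((convolution_mem_accepts_iff _ hA (by omega)).2
        ⟨fun i => fieldB (r i), ⟨h1, ?_⟩, h4⟩)
      ((convolution_not_mem_accepts_iff _ hA (by omega)).2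
        ⟨fun i => fieldC (r i), ⟨h2, ?_⟩, h5⟩)
    · refine mem_Ind_of_isCertificate h hk hm hA (X := fun i => fieldA (r i))
        ⟨h0, fun i hi => ?_, h3⟩
      beta_reduce
      rw [← hA' i hi]
      exact (hr i hi).2.1
    · intro i hi
      rw [← hA' i hi]
      exact (hr i hi).2.2.1
    · intro i hi
      rw [← hA' i hi]
      exact (hr i hi).2.2.2
  · intro hrun A h0 h1 h2
    obtain ⟨n, hn, hA⟩ : ∃ n, L ≤ n ∧ A.length ≤ n := ⟨L + A.length, by omega, by omega⟩
    obtain ⟨r, hr, hr'⟩ := (convolution_mem_accepts_iff _ hA (by omega)).1 h1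
    obtain ⟨t, ht, ht'⟩ := (convolution_not_mem_accepts_iff _ hA (by omega)).1 h2
    obtain ⟨X, hX, hX0, hX1, hX2⟩ := exists_isCertificate_of_mem_Ind h hk hm hA h0
    refine hrun n hn (fun i => pack₄ (X i) (r i) (t i) (flagSeq A i))
      ?_ (fun i hi => ?_) (fun i hi => ?_) ?_
    · simpa [flagSeq] using ⟨hX0, hr.1, ht.1⟩
    · simp only [fieldA_pack₄, fieldB_pack₄, fieldC_pack₄, lastD_pack₄]
      exact ⟨fun h => h.2 (flagSeq_mono h.1), hX1 i hi, hr.2 i hi, ht.2 i hi⟩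
    · have h1 := hr.lt i hi
      have h3 := ht.lt i hi
      have h4 := flagSeq_le A i
      -- The sets of level 1 states dominate the other fields, so `2 ^ m` bounds all four.
      have h5 : k ≤ 2 ^ m := (((le_pairBound _).trans ((le_pairBound _).trans ((le_pairBound _).trans
        (le_pairBound _)))).trans hm).trans Nat.lt_two_pow_self.le
      have := hk.constr
      have := hk.nV
      exact lt_of_lt_of_le (pack₄_lt (hX i) (by omega) (by omega) (by omega)) hm'
    · simpa using ⟨hX2, hr', ht'⟩

theorem mem_PReach_of_isCertificate {u v : List (Fin y.numSym)} {L : ℕ} (hu : u.length ≤ L)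
    (hv : v.length ≤ L) {X : ℕ → ℕ} (hX : IsCertificate m' L (e.init₂ m)
      (fun i => e.step₂ m (letterAt u i) (letterAt v i)) (e.step₂ m 0 0) (e.bad₂ m) X) :
    (u, v) ∈ PReach y.Δ y.V :=
  (mem_PReach_iff_run h hk hm hm' hu hv).2 fun _ hn _ => hX.not_bad
    (fun i hi t t' => by rw [letterAt_eq_zero.2 (hu.trans hi), letterAt_eq_zero.2 (hv.trans hi)]) hn

theorem exists_isCertificate_of_mem_PReach {u v : List (Fin y.numSym)} {L : ℕ}
    (hu : u.length ≤ L) (hv : v.length ≤ L) (huv : (u, v) ∈ PReach y.Δ y.V) :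
    ∃ X : ℕ → ℕ, (∀ i, X i < 2 ^ m') ∧ IsCertificate m' L (e.init₂ m)
      (fun i => e.step₂ m (letterAt u i) (letterAt v i)) (e.step₂ m 0 0) (e.bad₂ m) X :=
  exists_isCertificate
    (fun i hi t t' => by rw [letterAt_eq_zero.2 (hu.trans hi), letterAt_eq_zero.2 (hv.trans hi)])
    ((mem_PReach_iff_run h hk hm hm' hu hv).1 huv)

/-- With both universal quantifiers turned into certificates, the existence of a potentially
reachable unsafe configuration becomes plain reachability among numbers below `B`. A path yields the
two words, their accepting runs and the level 2 certificate at once. -/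
theorem exists_mem_PReach_iff {B : ℕ}
    (hB : pairBound (pairBound (pairBound (pairBound (2 ^ m')))) ≤ B) :
    (∃ u v, u ∈ y.CI ∧ v ∈ y.CU ∧ (u, v) ∈ PReach y.Δ y.V) ↔
      ∃ s < B, ∃ t < B, e.init₃ m m' s ∧ e.final₃ m m' t ∧
        ∃ n r, r 0 = s ∧ r n = t ∧ IsPath (e.step₃ m m') B n r := by
  simp only [Env.init₃, Env.step₃, Env.final₃, h.dI, h.sI, h.fI, h.dU, h.sU, h.fU, IsPath]
  constructor
  · rintro ⟨u, v, hu, hv, huv⟩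
    obtain ⟨n, hun, hvn⟩ : ∃ n, u.length ≤ n ∧ v.length ≤ n :=
      ⟨u.length + v.length, by omega, by omega⟩
    obtain ⟨X, hX, hX0, hX1, hX2⟩ := exists_isCertificate_of_mem_PReach h hk hm hm' hun hvn huv
    obtain ⟨r, hr, hr'⟩ := (mem_accepts_iff_run _ hun).1 hu
    obtain ⟨s, hs, hs'⟩ := (mem_accepts_iff_run _ hvn).1 hv
    obtain ⟨R, hR⟩ : ∃ R : ℕ → ℕ, ∀ i,
        R i = pack₄ (X i) (r i) (s i) (pack (flagSeq u i) (flagSeq v i)) := ⟨_, fun _ => rfl⟩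
    have hlt : ∀ i ≤ n, R i < B := by
      intro i hi
      rw [hR]
      have h1 := hr.lt i hi
      have h2 := hs.lt i hi
      have h4 := flagSeq_le u i
      have h5 := flagSeq_le v i
      have h6 : k ≤ 2 ^ m' := by
        have a1 := le_pairBound k
        have a2 := le_pairBound (pairBound k)
        have a3 := le_pairBound (pairBound (pairBound k))
        have a4 := le_pairBound (pairBound (pairBound (pairBound k)))
        have a5 := le_pairBound (2 ^ m)
        have a6 := le_pairBound (pairBound (2 ^ m))
        have a7 := le_pairBound (pairBound (pairBound (2 ^ m)))
        have a8 := Nat.lt_two_pow_self (n := m)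
        have a9 := Nat.lt_two_pow_self (n := m')
        omega
      have h7 := le_pairBound (2 ^ m')
      have := hX i
      have := hk.sym
      have := hk.nI
      have := hk.nU
      exact lt_of_lt_of_le (pack₄_lt (by omega) (by omega) (by omega)
        (pack_lt (by omega) (by omega))) hB
    refine ⟨R 0, hlt 0 (Nat.zero_le n), R n, hlt n le_rfl, ?_, ?_, n, R, rfl, rfl,
      fun i hi => ⟨?_, hlt (i + 1) hi⟩⟩ <;> simp only [hR]
    · simpa [flagSeq] using ⟨hX0, hr.1, hs.1⟩
    · simpa using ⟨hX2, hr', hs'⟩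
    · simp only [fieldA_pack₄, fieldB_pack₄, fieldC_pack₄, fieldD_pack₄, lastE_pack₄]
      exact ⟨fun h => h.2 (flagSeq_mono h.1), fun h => h.2 (flagSeq_mono h.1), hX1 i hi, hr.2 i hi,
        hs.2 i hi⟩
  · rintro ⟨-, -, -, -, ⟨h1, h2, h3, -⟩, ⟨h4, h5, h6⟩, n, r, rfl, rfl, hr⟩
    obtain ⟨u, hu, hu'⟩ := exists_flagSeq (a := fun i => fieldD (r i)) (m := n)
      (fun i hi => (pad₁_stepNum₁ (hr i hi).1.2.2.2.1).1) fun i hi => (hr i hi).1.1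
    obtain ⟨v, hv, hv'⟩ := exists_flagSeq (a := fun i => lastE (r i)) (m := n)
      (fun i hi => (pad₁_stepNum₁ (hr i hi).1.2.2.2.2).1) fun i hi => (hr i hi).1.2.1
    refine ⟨u, v, (mem_accepts_iff_run _ hu).2 ⟨fun i => fieldB (r i), ⟨h2, fun i hi => ?_⟩, h5⟩,
      (mem_accepts_iff_run _ hv).2 ⟨fun i => fieldC (r i), ⟨h3, fun i hi => ?_⟩, h6⟩,
      mem_PReach_of_isCertificate h hk hm hm' hu hv (X := fun i => fieldA (r i))
        ⟨h1, fun i hi => ?_, h4⟩⟩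
    · rw [← hu' i hi]
      exact (hr i hi).1.2.2.2.1
    · rw [← hv' i hi]
      exact (hr i hi).1.2.2.2.2
    · beta_reduce
      rw [← hu' i hi, ← hv' i hi]
      exact (hr i hi).1.2.2.1

end

end RegAbs

namespace RegAbs

/-! ### The decision procedure -/

open Function Code

namespace Cmp

variable {E : Type} [Code E]

@[fun_prop]
theorem closedBits {m X X' : E → ℕ} {R : E → ℕ → ℕ → Prop} (hm : Cmp m)
    (hR : Cmp fun p : E × (ℕ × ℕ) => R p.1 p.2.1 p.2.2) (hX : Cmp X) (hX' : Cmp X') :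
    Cmp fun e => ClosedBits (m e) (R e) (X e) (X' e) := by
  have : Cmp fun p : (E × ℕ) × ℕ => R p.1.1 p.1.2 p.2 :=
    hR.comp (f := fun p : (E × ℕ) × ℕ => (p.1.1, (p.1.2, p.2))) (by fun_prop)
  unfold ClosedBits
  fun_prop

@[fun_prop]
theorem coversBits {m X : E → ℕ} {P : E → ℕ → Prop} (hm : Cmp m)
    (hP : Cmp fun p : E × ℕ => P p.1 p.2) (hX : Cmp X) :
    Cmp fun e => CoversBits (m e) (P e) (X e) := by
  unfold CoversBits
  fun_prop

@[fun_prop]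
theorem avoidsBits {m X : E → ℕ} {P : E → ℕ → Prop} (hm : Cmp m)
    (hP : Cmp fun p : E × ℕ => P p.1 p.2) (hX : Cmp X) :
    Cmp fun e => AvoidsBits (m e) (P e) (X e) := by
  unfold AvoidsBits
  fun_prop

section

variable {t : E → ℕ}

@[fun_prop]
theorem fieldA (ht : Cmp t) : Cmp fun e => fieldA (t e) := by unfold RegAbs.fieldA; fun_prop

@[fun_prop]
theorem fieldB (ht : Cmp t) : Cmp fun e => fieldB (t e) := by unfold RegAbs.fieldB; fun_prop

@[fun_prop]
theorem fieldC (ht : Cmp t) : Cmp fun e => fieldC (t e) := by unfold RegAbs.fieldC; fun_prop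

@[fun_prop]
theorem lastD (ht : Cmp t) : Cmp fun e => lastD (t e) := by unfold RegAbs.lastD; fun_prop

@[fun_prop]
theorem fieldD (ht : Cmp t) : Cmp fun e => fieldD (t e) := by unfold RegAbs.fieldD; fun_prop

@[fun_prop]
theorem lastE (ht : Cmp t) : Cmp fun e => lastE (t e) := by unfold RegAbs.lastE; fun_prop

@[fun_prop]
theorem pairBound (ht : Cmp t) : Cmp fun e => pairBound (t e) := by
  unfold RegAbs.pairBound
  simp only [sq]
  fun_prop

end

variable {f : E → Env} {m m' a b z t t' : E → ℕ}

@[fun_prop]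
theorem step₁ (hf : Cmp f) (hz : Cmp z) (ht : Cmp t) (ht' : Cmp t') :
    Cmp fun e => (f e).step₁ (z e) (t e) (t' e) := by
  unfold Env.step₁ pad₂
  fun_prop

@[fun_prop]
theorem init₁ (hf : Cmp f) (ht : Cmp t) : Cmp fun e => (f e).init₁ (t e) := by
  unfold Env.init₁
  fun_prop

@[fun_prop]
theorem bad₁ (hf : Cmp f) (ht : Cmp t) : Cmp fun e => (f e).bad₁ (t e) := by
  unfold Env.bad₁
  fun_prop

@[fun_prop]
theorem step₂ (hf : Cmp f) (hm : Cmp m) (ha : Cmp a) (hb : Cmp b) (ht : Cmp t) (ht' : Cmp t') :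
    Cmp fun e => (f e).step₂ (m e) (a e) (b e) (t e) (t' e) := by
  unfold Env.step₂ pad₂
  fun_prop

@[fun_prop]
theorem init₂ (hf : Cmp f) (hm : Cmp m) (ht : Cmp t) : Cmp fun e => (f e).init₂ (m e) (t e) := by
  unfold Env.init₂
  fun_prop

@[fun_prop]
theorem bad₂ (hf : Cmp f) (hm : Cmp m) (ht : Cmp t) : Cmp fun e => (f e).bad₂ (m e) (t e) := by
  unfold Env.bad₂
  fun_prop

@[fun_prop]
theorem step₃ (hf : Cmp f) (hm : Cmp m) (hm' : Cmp m') (ht : Cmp t) (ht' : Cmp t') :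
    Cmp fun e => (f e).step₃ (m e) (m' e) (t e) (t' e) := by
  unfold Env.step₃ pad₁
  fun_prop

@[fun_prop]
theorem init₃ (hf : Cmp f) (hm : Cmp m) (hm' : Cmp m') (ht : Cmp t) :
    Cmp fun e => (f e).init₃ (m e) (m' e) (t e) := by
  unfold Env.init₃
  fun_prop

@[fun_prop]
theorem final₃ (hf : Cmp f) (hm : Cmp m) (hm' : Cmp m') (ht : Cmp t) :
    Cmp fun e => (f e).final₃ (m e) (m' e) (t e) := by
  unfold Env.final₃
  fun_prop

end Cmp

/-! ### Size parameters and correctness of the decision procedure -/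

/-- the number of codes of states of the search for a violation of inductivity -/
def numCodes₁ (n : ℕ) : ℕ := pairBound (pairBound (pairBound (pairBound (n + 2))))

/-- the number of codes of states of the search for a separating constraint -/
def numCodes₂ (N : ℕ) : ℕ := pairBound (pairBound (pairBound N))

/-- the binary logarithm of the number of codes of states of the search for an unsafe
configuration -/
def logCodes₃ (N : ℕ) : ℕ := 16 * numCodes₂ N + 30

/-- the binary logarithm of the bound for the computation -/
def logCap (N : ℕ) : ℕ := 16 * ((3 * logCodes₃ N + 1) * logCodes₃ N + 1) + 30

theorem pairBound_two_pow (j : ℕ) : pairBound (2 ^ j) = 2 ^ (2 * j + 2) := by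
  rw [pairBound, pow_add, pow_mul', ← pow_mul, mul_comm j 2, pow_mul]
  ring

theorem pairBound₄_two_pow (j : ℕ) :
    pairBound (pairBound (pairBound (pairBound (2 ^ j)))) = 2 ^ (16 * j + 30) := by
  simp only [pairBound_two_pow]
  congr 1
  ring

/-- The search for an unsafe configuration is successful. -/
def Env.Unsafe (e : Env) (N N' cap : ℕ) : Prop :=
  ExB (pairBound (pairBound (pairBound (pairBound N')))) fun s =>
    ExB (pairBound (pairBound (pairBound (pairBound N')))) fun t =>
      e.init₃ (numCodes₁ (lenNum e.word)) (numCodes₂ N) s ∧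
      e.final₃ (numCodes₁ (lenNum e.word)) (numCodes₂ N) t ∧
      SavReach (e.step₃ (numCodes₁ (lenNum e.word)) (numCodes₂ N))
        (pairBound (pairBound (pairBound (pairBound N')))) (logCodes₃ N) cap s t

/-- The word with number `x` is the code of a positive instance. -/
def IsPositiveCode (x N N' cap : ℕ) : Prop :=
  ExB (lenNum x + 1) fun k => ExB (lenNum x + 1) fun g => ExB (lenNum x + 1) fun nD =>
    ExB (lenNum x + 1) fun nI => ExB (lenNum x + 1) fun nU => ExB (lenNum x + 1) fun nV =>
      (Env.HasSizes (x, k, g, nD, nI, nU, nV) ∧ Env.IsDet (x, k, g, nD, nI, nU, nV)) ∧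
        ¬Env.Unsafe (x, k, g, nD, nI, nU, nV) N N' cap

namespace Cmp

variable {E : Type} [Code E]

@[fun_prop]
theorem numCodes₁ {n : E → ℕ} (hn : Cmp n) : Cmp fun e => numCodes₁ (n e) := by
  unfold RegAbs.numCodes₁
  fun_prop

@[fun_prop]
theorem numCodes₂ {n : E → ℕ} (hn : Cmp n) : Cmp fun e => numCodes₂ (n e) := by
  unfold RegAbs.numCodes₂
  fun_prop

@[fun_prop]
theorem logCodes₃ {n : E → ℕ} (hn : Cmp n) : Cmp fun e => logCodes₃ (n e) := by
  unfold RegAbs.logCodes₃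
  fun_prop

@[fun_prop]
theorem logCap {n : E → ℕ} (hn : Cmp n) : Cmp fun e => logCap (n e) := by
  unfold RegAbs.logCap
  fun_prop

@[fun_prop]
theorem env_unsafe {f : E → Env} {N N' cap : E → ℕ} (hf : Cmp f) (hN : Cmp N) (hN' : Cmp N')
    (hc : Cmp cap) : Cmp fun e => (f e).Unsafe (N e) (N' e) (cap e) := by
  unfold Env.Unsafe
  fun_prop

@[fun_prop]
theorem isPositiveCode {x N N' cap : E → ℕ} (hx : Cmp x) (hN : Cmp N) (hN' : Cmp N')
    (hc : Cmp cap) : Cmp fun e => IsPositiveCode (x e) (N e) (N' e) (cap e) := by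
  unfold IsPositiveCode
  fun_prop

end Cmp

/-- Depth `K = log B` suffices for all paths, and the cap has room for running time and states. -/
theorem savReach_iff_exists_path {N : ℕ} {R : ℕ → ℕ → Prop} {B s t : ℕ}
    (hB : B = 2 ^ logCodes₃ N) (hs : s < B) (ht : t < B) :
    SavReach R B (logCodes₃ N) (2 ^ logCap N) s t ↔
      ∃ n r, r 0 = s ∧ r n = t ∧ IsPath R B n r := by
  have hK : 30 ≤ logCodes₃ N := by unfold logCodes₃; omega
  unfold logCap
  generalize logCodes₃ N = K at *
  rw [savReach_iff hs ht, within_iff_exists_path hB.le hs ht]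
  -- The running time: five is rounded up to eight.
  · calc (5 * B) ^ K ≤ (2 ^ 3 * 2 ^ K) ^ K := by
          rw [hB]; exact Nat.pow_le_pow_left (Nat.mul_le_mul_right _ (by norm_num)) _
      _ = 2 ^ ((3 + K) * K) := by rw [← pow_add, ← pow_mul]
      _ ≤ _ := Nat.pow_le_pow_right (by norm_num) (by nlinarith)
  · have h1 : (2 * B ^ 3) ^ K = 2 ^ ((3 * K + 1) * K) := by
      rw [hB, ← pow_mul, ← pow_succ', ← pow_mul]
      congr 2
      ring
    rw [h1, ← pairBound₄_two_pow]
    -- The stack, with `K` frames of `3 * K + 1` bits, is the largest field of a state; four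
    -- pairings then turn `2 ^ j` into `2 ^ (16 * j + 30)`, which is the cap.
    set j := (3 * K + 1) * K + 1
    have h2 : B < 2 ^ j := by
      rw [hB]; exact Nat.pow_lt_pow_right (by norm_num) (by simp only [j]; nlinarith)
    have h3 : K < 2 ^ j := lt_of_le_of_lt (by rw [hB] at *; exact Nat.lt_two_pow_self.le) h2
    have h4 : 2 ^ ((3 * K + 1) * K) < 2 ^ j := Nat.pow_lt_pow_right (by norm_num) (by simp [j])
    have h5 := le_pairBound (2 ^ j)
    have h6 := le_pairBound (pairBound (2 ^ j))
    have h7 := le_pairBound (pairBound (pairBound (2 ^ j)))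
    exact (pack_lt (by omega) (pack_lt (by omega) (pack_lt (by omega) (pack_lt h2 h4)))).le

theorem Instance.env_bounded {y : Instance} {w : List Bool} (h : y.encode = w) :
    y.numSym < w.length ∧ y.numConstr < w.length ∧ y.nΔ < w.length ∧ y.nI < w.length ∧
      y.nU < w.length ∧ y.nV < w.length := by
  rw [← h]
  simp only [Instance.encode, List.length_append, length_encodeUnary]
  omega

theorem Instance.unsafe_iff {y : Instance} {w : List Bool} (h : y.encode = w) {N : ℕ}
    (hN : N = 2 ^ numCodes₁ w.length) :
    (y.env w).Unsafe N (2 ^ numCodes₂ N) (2 ^ logCap N) ↔ ¬y.IsAbstractlySafe := by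
  have hlen : lenNum (y.env w).word = w.length := lenNum_bijVal w
  have hb := Instance.env_bounded h
  have hk : y.Bounded (w.length + 2) := by constructor <;> omega
  unfold Env.Unsafe ExB
  rw [hlen]
  have := exists_mem_PReach_iff (Instance.env_reads h) hk (m := numCodes₁ w.length)
    (m' := numCodes₂ N) le_rfl (by rw [hN]; exact le_rfl) le_rfl
  have hB : pairBound (pairBound (pairBound (pairBound (2 ^ numCodes₂ N)))) = 2 ^ logCodes₃ N :=
    pairBound₄_two_pow _
  trans ∃ u v, u ∈ y.CI ∧ v ∈ y.CU ∧ (u, v) ∈ PReach y.Δ y.V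
  · rw [this]
    refine exists_congr fun s => and_congr_right fun hs => exists_congr fun t =>
      and_congr_right fun ht => and_congr_right fun _ => and_congr_right fun _ => ?_
    exact savReach_iff_exists_path hB hs ht
  · rw [Instance.IsAbstractlySafe, ← ne_eq, ← Set.nonempty_iff_ne_empty]
    constructor
    · rintro ⟨u, v, hu, hv, huv⟩
      exact ⟨v, ⟨u, hu, huv⟩, hv⟩
    · rintro ⟨v, ⟨u, hu, huv⟩, hv⟩
      exact ⟨u, v, hu, hv, huv⟩

/-- The sizes are found by exhaustive search, as each of them is less than the length of a valid
code. -/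
theorem isPositiveCode_iff (w : List Bool) {N : ℕ} (hN : N = 2 ^ numCodes₁ w.length) :
    IsPositiveCode (bijVal w) N (2 ^ numCodes₂ N) (2 ^ logCap N) ↔ w ∈ AbstractSafety := by
  unfold IsPositiveCode
  simp only [ExB, lenNum_bijVal]
  constructor
  · rintro ⟨k, -, g, -, nD, -, nI, -, nU, -, nV, -, ⟨h1, h2⟩, h3⟩
    obtain ⟨y, hy, he⟩ := Env.exists_instance (w := w) rfl h1 h2
    rw [← he, Instance.unsafe_iff hy hN, not_not] at h3
    exact ⟨y, hy, h3⟩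
  · rintro ⟨y, hy, hs⟩
    obtain ⟨h1, h2, h3, h4, h5, h6⟩ := Instance.env_bounded hy
    refine ⟨_, h1.trans_le (Nat.le_succ _), _, h2.trans_le (Nat.le_succ _), _,
      h3.trans_le (Nat.le_succ _), _, h4.trans_le (Nat.le_succ _), _, h5.trans_le (Nat.le_succ _),
      _, h6.trans_le (Nat.le_succ _), ⟨((y.encode_eq_iff w).1 hy).1, Instance.env_isDet hy⟩, ?_⟩
    exact fun h => (Instance.unsafe_iff hy hN).1 h hs

/-! ### Computations with exponential bounds -/

/-- Functions that are computed with registers bounded by a polynomial in `σ`. -/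
def CmpIn {E F : Type} [Code E] [Code F] (σ : E → ℕ) (f : E → F) : Prop :=
  ∃ γ, PolyBdd γ ∧ Computes f (fun e => γ (σ e))

namespace CmpIn

variable {E F G : Type} [Code E] [Code F] [Code G] {σ : E → ℕ} {f : E → F}

theorem exists_polyBdd (hσ : ∀ e, enc e ≤ σ e) (hf : CmpIn σ f) :
    ∃ γ, PolyBdd γ ∧ ∀ e, enc (f e) ≤ γ (σ e) := by
  obtain ⟨γ, h, hf⟩ := hf
  exact ⟨_, PolyBdd.id.add h, fun e => (hf.le e).trans (Nat.add_le_add_right (hσ e) _)⟩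

theorem cmp_comp (hσ : ∀ e, enc e ≤ σ e) {g : F → G} (hg : Cmp g) (hf : CmpIn σ f) :
    CmpIn σ fun e => g (f e) := by
  obtain ⟨δ, h5, h6⟩ := hf.exists_polyBdd hσ
  obtain ⟨β, h1, h2⟩ := hf
  obtain ⟨γ, ⟨c, hc⟩, h4⟩ := hg
  refine ⟨_, h1.add ((h5.add (PolyBdd.const 2)).pow c), (h4.comp h2).mono fun e => ?_⟩
  exact Nat.add_le_add_left ((hc _).trans (Nat.pow_le_pow_left (Nat.add_le_add_right (h6 e) 2) c)) _

theorem id (σ : E → ℕ) : CmpIn σ fun e : E => e := ⟨_, PolyBdd.const 0, Computes.id⟩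

/-- A power of two that does not exceed `σ` can be computed. -/
theorem two_pow (hσ : ∀ e, enc e ≤ σ e) {g : F → ℕ} (hg : Cmp g) (hf : CmpIn σ f)
    (h : ∀ e, 2 ^ g (f e) ≤ σ e) : CmpIn σ fun e => (f e, 2 ^ g (f e)) := by
  have hit : ∀ e i, (fun p : F × ℕ => (p.1, 2 * p.2))^[i] (f e, 1) = (f e, 2 ^ i) := by
    intro e i
    induction i with
    | zero => rfl
    | succ i ih => rw [iterate_succ_apply', ih, pow_succ']
  have h1 : Cmp fun p : F × ℕ => (p.1, 2 * p.2) := by fun_prop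
  have h2 : CmpIn σ fun e => (g (f e), (f e, 1)) :=
    cmp_comp hσ (g := fun a => (g a, (a, 1))) (by fun_prop) hf
  obtain ⟨γ, hγ, hγf⟩ := hf.exists_polyBdd hσ
  obtain ⟨β, hβ, h2⟩ := h2
  obtain ⟨δ, ⟨c, hc⟩, h1⟩ := h1
  have hp : PolyBdd fun x => pack (γ x) x := hγ.pack PolyBdd.id
  have h3 : CmpIn σ fun e => (fun p : F × ℕ => (p.1, 2 * p.2))^[g (f e)] (f e, 1) := by
    refine ⟨_, (PolyBdd.id.add hβ).add (hp.add ((hp.add (PolyBdd.const 2)).pow c)),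
      (h1.iterate h2 (γ := fun e => pack (γ (σ e)) (σ e) + (pack (γ (σ e)) (σ e) + 2) ^ c)
        fun e i hi => ?_).mono fun e => ?_⟩
    · rw [hit]
      have h4 : enc (f e, 2 ^ i) ≤ pack (γ (σ e)) (σ e) :=
        pack_mono (hγf e) ((Nat.pow_le_pow_right (by norm_num) hi).trans (h e))
      have h5 := (hc (enc (f e, 2 ^ i))).trans (Nat.pow_le_pow_left (Nat.add_le_add_right h4 2) c)
      exact ⟨h5.trans (by omega), h4.trans (by omega)⟩
    · have := hσ e
      omega
  simpa only [hit] using h3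

end CmpIn

/-! ### The doubly exponential bound and the conclusion -/

theorem le_numCodes₂_and_le_logCap (N : ℕ) : N ≤ numCodes₂ N ∧ numCodes₂ N ≤ logCap N := by
  refine ⟨(le_pairBound _).trans ((le_pairBound _).trans (le_pairBound _)), ?_⟩
  unfold logCap logCodes₃
  nlinarith [Nat.zero_le (numCodes₂ N)]

theorem numCodes₁_le_logCap (n : ℕ) : numCodes₁ n ≤ logCap (2 ^ numCodes₁ n) :=
  (Nat.lt_two_pow_self.le.trans (le_numCodes₂_and_le_logCap _).1).trans (le_numCodes₂_and_le_logCap _).2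

theorem le_two_pow_logCap (x : ℕ) : x ≤ 2 ^ logCap (2 ^ numCodes₁ (lenNum x)) := by
  rw [← bijVal_bijRepr x, lenNum_bijVal]
  have h1 := bijVal_lt_two_pow (bijRepr x)
  have h2 : (bijRepr x).length + 1 ≤ numCodes₁ (bijRepr x).length :=
    (by omega : _ ≤ (bijRepr x).length + 2).trans ((le_pairBound _).trans ((le_pairBound _).trans
      ((le_pairBound _).trans (le_pairBound _))))
  have h3 := Nat.pow_le_pow_right (n := 2) (by norm_num)
    (h2.trans (numCodes₁_le_logCap (bijRepr x).length))
  omega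

/-- The exponent `logCap N` is polynomial in `N = 2 ^ numCodes₁ n`, hence at most exponential in a
polynomial of `n`; raising the cap to a fixed power only multiplies the exponent by a constant. -/
theorem exists_polynomial_bound (c : ℕ) : ∃ q : Polynomial ℕ,
    ∀ n, (2 ^ logCap (2 ^ numCodes₁ n) + 2) ^ (c + 1) + 1 < 2 ^ 2 ^ q.eval n := by
  have h : Cmp fun N : ℕ => (logCap N + 2) * (c + 1) + 1 := by fun_prop
  obtain ⟨γ, ⟨c', hc'⟩, hγ⟩ := h.exists_polyBdd
  have hadd : ∀ a : ℕ, 2 ^ a + 2 ≤ 2 ^ (a + 2) := fun a => by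
    have := Nat.one_le_two_pow (n := a)
    rw [pow_add]
    omega
  -- This is `(numCodes₁ n + 2) * c'` written out, with `pairBound k = 4 * k ^ 2` applied four times
  -- to `n + 2`.
  refine ⟨(4 * (4 * (4 * (4 * (.X + 2) ^ 2) ^ 2) ^ 2) ^ 2 + 2) * .C c', fun n => ?_⟩
  have h1 : Polynomial.eval n ((4 * (4 * (4 * (4 * (.X + 2) ^ 2) ^ 2) ^ 2) ^ 2 + 2) * .C c') =
      (numCodes₁ n + 2) * c' := by
    simp [numCodes₁, pairBound]
  rw [h1]
  have h2 : (logCap (2 ^ numCodes₁ n) + 2) * (c + 1) + 1 ≤ 2 ^ ((numCodes₁ n + 2) * c') := by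
    refine ((hγ _).trans (hc' _)).trans ?_
    rw [enc_nat, pow_mul]
    exact Nat.pow_le_pow_left (hadd _) _
  refine lt_of_lt_of_le ?_ (Nat.pow_le_pow_right (by norm_num) h2)
  generalize logCap (2 ^ numCodes₁ n) = E
  have h3 := Nat.pow_le_pow_left (hadd E) (c + 1)
  rw [← pow_mul] at h3
  have h4 : 2 ≤ 2 ^ ((E + 2) * (c + 1)) := Nat.le_self_pow (by positivity) 2
  rw [pow_succ 2 ((E + 2) * (c + 1))]
  omega

open scoped Classical in
/-- The result of the decision procedure for the word with number `x`. -/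
noncomputable def answer (x N N' cap : ℕ) : ℕ := if IsPositiveCode x N N' cap then 2 else 1

/-- The three powers are computed in turn, each kept for the next stage. None exceeds the cap, so
all registers stay polynomial in it, although not in `x`. -/
theorem cmpIn_answer : CmpIn (fun x => 2 ^ logCap (2 ^ numCodes₁ (lenNum x))) fun x : ℕ =>
    answer x (2 ^ numCodes₁ (lenNum x)) (2 ^ numCodes₂ (2 ^ numCodes₁ (lenNum x)))
      (2 ^ logCap (2 ^ numCodes₁ (lenNum x))) := by
  have h0 : Cmp fun a : ((ℕ × ℕ) × ℕ) × ℕ => answer a.1.1.1 a.1.1.2 a.1.2 a.2 := by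
    unfold answer
    fun_prop
  have h1 := CmpIn.two_pow le_two_pow_logCap (g := fun x => numCodes₁ (lenNum x)) (by fun_prop)
    (CmpIn.id _) fun x => Nat.pow_le_pow_right (by norm_num) (numCodes₁_le_logCap _)
  have h2 := CmpIn.two_pow le_two_pow_logCap (g := fun a => numCodes₂ a.2) (by fun_prop) h1
    fun x => Nat.pow_le_pow_right (by norm_num) (le_numCodes₂_and_le_logCap (2 ^ numCodes₁ (lenNum x))).2
  have h3 := CmpIn.two_pow le_two_pow_logCap (g := fun a => logCap a.1.2) (by fun_prop) h2
    fun x => by dsimp only; rfl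
  exact CmpIn.cmp_comp le_two_pow_logCap h0 h3

theorem abstractSafety_mem_EXPSPACE : AbstractSafety ∈ EXPSPACE := by
  classical
  obtain ⟨γ, ⟨c, hc⟩, hγ⟩ := cmpIn_answer
  obtain ⟨p, hp⟩ := hγ 0
  obtain ⟨q, hq⟩ := exists_polynomial_bound c
  -- The exponent `c + 1` in place of `c` keeps the bound above the input and above the answers `1`
  -- and `2` even if `c = 0`. As bijective numerals these answers are the one-letter words `[false]`
  -- and `[true]`.
  refine mem_EXPSPACE_of_exec p (fun n => (2 ^ logCap (2 ^ numCodes₁ n) + 2) ^ (c + 1)) q hq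
    (fun n => ?_) fun w => ⟨?_, ?_⟩
  · exact (Nat.le_add_left 2 _).trans (Nat.le_self_pow (Nat.succ_ne_zero c) _)
  · have h := le_two_pow_logCap (bijVal w)
    rw [lenNum_bijVal] at h
    exact (h.trans (Nat.le_add_right _ 2)).trans (Nat.le_self_pow (Nat.succ_ne_zero c) _)
  · have h := hp (bijVal w) ((2 ^ logCap (2 ^ numCodes₁ w.length) + 2) ^ (c + 1)) (by
      have := hc (2 ^ logCap (2 ^ numCodes₁ w.length))
      simp only [lenNum_bijVal]
      exact this.trans (Nat.pow_le_pow_right (by positivity) (Nat.le_succ c))) 0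
    have hs : ∀ x, regs 0 0 [x] = Prog.single x := fun x => by
      funext i
      rcases i with - | i <;> simp [regs, Prog.single]
    simp only [enc_nat, hs, lenNum_bijVal] at h
    simpa only [answer, isPositiveCode_iff w rfl] using h

end RegAbs

theorem mainTheorem2 : RegAbs.AbstractSafety ∈ RegAbs.EXPSPACE :=
  RegAbs.abstractSafety_mem_EXPSPACE
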